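/- **Setting.** A weighted directed rooted tree $T=(V,E,W)$ is a finite directed rooted tree (edges point away from the root) with weights $w_{i,j}>0$ for $(i,j)\in E$ and $w_{i,j}=0$ for $(i,j)\notin E$. The degree of a node is the sum of its indegree and outdegree. The additive path query $\widehat Q_T(i,j)$ returns the sum of the edge weights on the directed path (with at least one edge) from $i$ to $j$ if such a path exists, and $0$ otherwise. The node set $V$ is known, $E$ and $W$ are unknown. **Algorithm** (parameter $d\ge 2$, input $V$). Put $Q(i,j)=1$ if $\widehat Q_T(i,j)>0$ and $Q(i,j)=0$ otherwise. Compute $E=\mathrm{Rec}(V)$ with the procedure below, using $Q$; then for every $(i,j)\in E$ query $w_{i,j}=\widehat Q_T(i,j)$ and put all other weights to $0$; output $(E,W)$. $\mathrm{Rec}(U)$: let $m=|U|$. If $m=1$, return $\emptyset$. Otherwise repeat rounds of the following form until one of them finds an even separator. 1. Pick $i,j\in U$ independently and uniformly at random. 2. Find the multidirectional path $x_1,\dots,x_P$ between $i$ and $j$ (the path between them in the underlying undirected tree). If $i=j$, it consists of $i$ alone. If $Q(i,j)=1$, collect all $k\in U\setminus\{i,j\}$ with $Q(i,k)=Q(k,j)=1$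 and merge-sort them by the relation "$a$ before $b$ iff $Q(a,b)=1$"; the path runs from $i$ to $j$. If $Q(j,i)=1$, proceed likewise with $i$ and $j$ exchanged (the path then runs from $j$ to $i$). Otherwise collect and sort all proper ancestors of $i$, let $c$ be the last one of them with $Q(c,j)=1$ (the lowest common ancestor), find the directed paths from $c$ to $i$ and from $c$ to $j$ as above, and join the reverse of the first with the second. 3. Assign every node $k\in U$ off the path to a node of the path, its bag: on each of the two directed parts of the path (starting at the top node of the path), find by binary search the last node $x$ with $Q(x,k)=1$ (the top node if there is none); the bag of $k$ is that node of the left part if it is not the top node, and that of the right part otherwise. Every node of the path belongs to its own bag. 4. The even separator is the edge between $x_r$ and $x_{r+1}$ (with its direction in the tree) for the least $r\in\{1,\dots,P-1\}$ such that the total size of the bags of $x_1,\dots,x_r$ lies in $[\lfloor m/d\rfloor,\lceil (d-1)m/d\rceil]$; if there is no such $r$, the round fails. When the even separator $(a,b)$ is found, let $U_2$ consist of $b$ and all $k\in U$ with $Q(b,k)=1$, let $U_1=U\setminus U_2$, and return $\mathrm{Rec}(U_1)\cup \mathrm{Rec}(U_2)\cup\{(a,b)\}$. Time is counted in units: one for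 every query, every random choice, every elementary operation on numbers and arrays (per iteration of a loop), and every list entry copied; in particular it bounds the number of queries. **Theorem.** For every weighted directed rooted tree $T$ with $n$ nodes and node degree at most $d$, where $d\ge2$, every output of the algorithm is the edge set $E$ and the weights $W$ of $T$, and the algorithm halts with probability $1$. Moreover there is an absolute constant $C>0$ such that, for all such $T$ with $n\ge 2$: * the expected time of the algorithm is at most $C\,dn\log^2 n$; * for every $\delta\in(0,1)$, with probability at least $1-\delta$ the algorithm halts with the correct output within time $C\,\frac1\delta\,dn\log^2 n$. -/

import Mathlib

open scoped ENNReal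

/-! ### Weighted directed rooted trees and additive path queries -/

/-- A directed rooted tree: there is a root without incoming edges, every other vertex has exactly
one parent, and every vertex is reachable from the root along directed edges. -/
def IsDirectedRootedTree {V : Type} (G : Digraph V) : Prop :=
  ∃ r : V, (∀ u, ¬ G.Adj u r) ∧ (∀ v, v ≠ r → ∃! u, G.Adj u v) ∧
    ∀ v, Relation.ReflTransGen G.Adj r v

/-- A weighted directed rooted tree `T = (V, E, W)`: `w i j > 0` on the edges and `w i j = 0`
elsewhere. -/
structure WeightedRootedTree (V : Type) where
  graph : Digraph V
  isTree : IsDirectedRootedTree graph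
  weight : V → V → ℝ
  weight_pos : ∀ i j, graph.Adj i j → 0 < weight i j
  weight_zero : ∀ i j, ¬ graph.Adj i j → weight i j = 0

/-- The degree of a vertex of a directed graph: outdegree plus indegree. -/
noncomputable def Digraph.totalDegree {V : Type} (G : Digraph V) (v : V) : ℕ :=
  {u | G.Adj v u}.ncard + {u | G.Adj u v}.ncard

/-- `l = [i, x₁, …, x_k, j]` is a directed path from `i` to `j` (with at least one edge). -/
def Digraph.IsPathFromTo {V : Type} (G : Digraph V) (i j : V) (l : List V) : Prop :=
  2 ≤ l.length ∧ l.head? = some i ∧ l.getLast? = some j ∧ l.IsChain G.Adj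

/-- The sum of the weights of the edges between consecutive entries of a list of vertices. -/
def pathWeight {V : Type} (w : V → V → ℝ) (l : List V) : ℝ :=
  ((l.zip l.tail).map fun e => w e.1 e.2).sum

open Classical in
/-- The additive path query: the weight sum along the directed path from `i` to `j` if there is
one (in a directed rooted tree it is then unique), and `0` otherwise. -/
noncomputable def WeightedRootedTree.additiveQuery {V : Type} (T : WeightedRootedTree V)
    (i j : V) : ℝ :=
  if h : ∃ l, T.graph.IsPathFromTo i j l then pathWeight T.weight h.choose else 0

/-! ### Computations with a step count -/

/-- The result of a deterministic computation together with the number of time units it took. -/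
structure Timed (α : Type) where
  val : α
  time : ℕ

instance : Monad Timed where
  pure a := ⟨a, 0⟩
  bind x f := ⟨(f x.val).val, x.time + (f x.val).time⟩

/-- Spend `c` time units. -/
def Timed.tick (c : ℕ) : Timed Unit := ⟨(), c⟩

/-- A randomized computation with a step count: the joint law of the output and of the number of
time units spent. The output `none` means that the computation was interrupted. -/
def Comp (α : Type) : Type := PMF (Option α × ℕ)

namespace Comp

noncomputable instance : Monad Comp where
  pure a := PMF.pure (some a, 0)
  bind x f := PMF.bind x fun r =>
    match r with
    | (none, c) => PMF.pure (none, c)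
    | (some a, c) => PMF.map (fun s => (s.1, c + s.2)) (f a)

/-- A deterministic computation as a randomized one. -/
noncomputable def lift {α : Type} (x : Timed α) : Comp α := PMF.pure (some x.val, x.time)

/-- Interrupt the computation. -/
noncomputable def interrupt {α : Type} : Comp α := PMF.pure (none, 0)

/-- Pick a uniformly random element of the set listed by `vs`, in one time unit. -/
noncomputable def pick {V : Type} [DecidableEq V] (vs : List V) : Comp V :=
  if h : vs.toFinset.Nonempty then
    PMF.map (fun v => (some v, 1)) (PMF.uniformOfFinset vs.toFinset h)
  else interrupt

/-- Randomized algorithms that need not halt are given by their truncations `A 0, A 1, …`, where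
`A f` is the algorithm interrupted once its nesting depth (of loop rounds and recursive calls)
reaches `f`; the time of the full run is the increasing limit of the times of the truncated ones.
This is the expected time of the full run. -/
noncomputable def expectedTime {α : Type} (A : ℕ → Comp α) : ℝ≥0∞ :=
  ⨆ f : ℕ, ∑' r : Option α × ℕ, (show PMF (Option α × ℕ) from A f) r * (r.2 : ℝ≥0∞)

/-- The probability that the full run of the algorithm given by the truncations `A 0, A 1, …` halts
with an output `a` after a time `t` such that `S a t`. -/
noncomputable def probHalts {α : Type} (A : ℕ → Comp α) (S : α → ℕ → Prop) : ℝ≥0∞ :=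
  ⨆ f : ℕ, PMF.toOuterMeasure (A f) {r | ∃ a, r.1 = some a ∧ S a r.2}

end Comp

/-! ### The algorithm

Cost model: one time unit for every oracle query, every random choice, every iteration of a loop
(with its constant number of arithmetic operations, comparisons, array accesses and array updates;
lists that are indexed, updated in place or tested for membership of a node stand for arrays), and
every entry that is copied when lists are split, reversed or concatenated. -/

section Algorithm

open Timed

variable {V : Type}

/-- The entries of a list that pass a test. -/
def timedFilter (p : V → Timed Bool) : List V → Timed (List V)
  | [] => pure []
  | k :: ks => do
    tick 1
    let b ← p k
    let r ← timedFilter p ks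
    return if b then k :: r else r

/-- The last entry of a list that passes a test, with `acc` as the default. -/
def timedFindLast (p : V → Timed Bool) : List V → Option V → Timed (Option V)
  | [], acc => pure acc
  | k :: ks, acc => do
    tick 1
    let b ← p k
    timedFindLast p ks (if b then some k else acc)

/-- Merge two sorted lists; `Q x y = true` means that `x` is less than `y`. -/
def timedMerge (Q : V → V → Timed Bool) : List V → List V → Timed (List V)
  | [], ys => pure ys
  | xs, [] => pure xs
  | x :: xs, y :: ys => do
    tick 1
    let b ← Q x y
    if b then
      let r ← timedMerge Q xs (y :: ys)
      return x :: r
    else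
      let r ← timedMerge Q (x :: xs) ys
      return y :: r
  termination_by xs ys => xs.length + ys.length

/-- Merge sort with the order relation "`x` is less than `y` if `Q x y = true`". -/
def timedSort (Q : V → V → Timed Bool) (l : List V) : Timed (List V) :=
  if _h : 2 ≤ l.length then do
    tick l.length
    let xs ← timedSort Q (l.take (l.length / 2))
    let ys ← timedSort Q (l.drop (l.length / 2))
    timedMerge Q xs ys
  else pure l
  termination_by l.length
  decreasing_by all_goals (simp only [List.length_take, List.length_drop]; omega)

variable [DecidableEq V]

/-- The directed path from `i` to `j`, when there is one: collect the nodes in between and sort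
them. -/
def directedPath (Q : V → V → Timed Bool) (vs : List V) (i j : V) : Timed (List V) := do
  let inner ← timedFilter (fun k =>
    if k = i ∨ k = j then pure false
    else do
      let b ← Q i k
      if b then Q k j else pure false) vs
  let sorted ← timedSort Q inner
  tick (sorted.length + 2)
  return i :: (sorted ++ [j])

/-- Find path from root: the sorted list of the proper ancestors of `i`. -/
def findPathFromRoot (Q : V → V → Timed Bool) (vs : List V) (i : V) : Timed (List V) := do
  let anc ← timedFilter (fun j => if j = i then pure false else Q j i) vs
  timedSort Q anc

/-- Find lowest common ancestor (of two nodes none of which is an ancestor of the other): the last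
node on the path from the root to `i` that is an ancestor of `j`. -/
def findLowestCommonAncestor (Q : V → V → Timed Bool) (vs : List V) (i j : V) :
    Timed (Option V) := do
  let p ← findPathFromRoot Q vs i
  timedFindLast (fun k => Q k j) p none

/-- Reconstruct multidirectional path: the multidirectional path between `i` and `j`, and the
position in it (counted from `0`) of the lowest common ancestor. The case `none` does not occur
when `Q` answers for a directed rooted tree. -/
def multidirPath (Q : V → V → Timed Bool) (vs : List V) (i j : V) : Timed (List V × ℕ) := do
  tick 1
  if i = j then return ([i], 0)
  else
    let b ← Q i j
    if b then
      let p ← directedPath Q vs i j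
      return (p, 0)
    else
      let c ← Q j i
      if c then
        let p ← directedPath Q vs j i
        return (p, 0)
      else
        let a ← findLowestCommonAncestor Q vs i j
        match a with
        | none => return ([], 0)
        | some m =>
          let left ← directedPath Q vs m i
          let right ← directedPath Q vs m j
          tick (left.length + right.length)
          return (left.reverse ++ right.tail, left.length - 1)

/-- Binary search on the positions `l, …, r - 1` of a directed path for the last ancestor of `k`,
where position `l` is the default. -/
def findBagBetween (Q : V → V → Timed Bool) (path : List V) (k : V) (l r : ℕ) : Timed ℕ :=
  if _h : l + 1 < r then do
    tick 1
    let b ← match path[(l + r) / 2]? with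
      | some x => Q x k
      | none => pure false
    if b then findBagBetween Q path k ((l + r) / 2) r
    else findBagBetween Q path k l ((l + r) / 2)
  else pure l
  termination_by r - l
  decreasing_by all_goals omega

/-- Find bag: the position (counted from `0`) in a directed path of the node in whose bag `k`
is. -/
def findBag (Q : V → V → Timed Bool) (path : List V) (k : V) : Timed ℕ :=
  findBagBetween Q path k 0 path.length

/-- The sizes of the bags of the nodes of a multidirectional path, which is given together with its
two directed parts `left` and `right`, both starting at the lowest common ancestor. Every node of
the list that is not on the path adds `1` to the size of its bag. -/
def countBags (Q : V → V → Timed Bool) (path left right : List V) :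
    List V → List ℕ → Timed (List ℕ)
  | [], bags => pure bags
  | k :: ks, bags => do
    tick 1
    if k ∈ path then countBags Q path left right ks bags
    else
      let bl ← findBag Q left k
      let br ← findBag Q right k
      let idx := if bl = 0 then left.length - 1 + br else left.length - 1 - bl
      countBags Q path left right ks (bags.modify idx (· + 1))

/-- Scan a multidirectional path `x_r, x_{r+1}, …` for the first edge with a number of nodes
`leftsize` on its left with `⌊n/d⌋ ≤ leftsize ≤ ⌈(d-1)n/d⌉ = n - ⌊n/d⌋`. The edge is returned with
its direction in the tree, which is towards the left in front of the position `a` of the lowest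
common ancestor and towards the right behind it. -/
def scanPath (n d a : ℕ) : ℕ → ℕ → List V → List ℕ → Timed (Option (V × V))
  | r, leftsize, x :: y :: path, b :: bags => do
    tick 1
    if n / d ≤ leftsize + b ∧ leftsize + b ≤ n - n / d then
      return some (if r < a then (y, x) else (x, y))
    else scanPath n d a (r + 1) (leftsize + b) (y :: path) bags
  | _, _, _, _ => pure none

/-- The part of a round that follows the choice of `i` and `j`: look for an even separator in the
multidirectional path between them. -/
def findEvenSeparator (Q : V → V → Timed Bool) (d : ℕ) (vs : List V) (i j : V) :
    Timed (Option (V × V)) := do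
  let (path, a) ← multidirPath Q vs i j
  tick (3 * path.length)
  let left := (path.take (a + 1)).reverse
  let right := path.drop a
  let bags ← countBags Q path left right vs (List.replicate path.length 1)
  scanPath vs.length d a 0 0 path bags

/-- Split tree along an edge with head `j`: the nodes not below `j`, and `j` with the nodes below
it. -/
def splitTree (Q : V → V → Timed Bool) (j : V) : List V → Timed (List V × List V)
  | [] => pure ([], [])
  | k :: ks => do
    tick 1
    let b ← if k = j then pure true else Q j k
    let (v₁, v₂) ← splitTree Q j ks
    return if b then (v₁, k :: v₂) else (k :: v₁, v₂)

/-- Reconstruct tree, from path queries `Q` on the node set listed by `vs`, interrupted when the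
nesting depth reaches the first numerical argument after `d`. A round that finds no even separator
is followed by another round on the same node set. -/
noncomputable def reconstructTree (Q : V → V → Timed Bool) (d : ℕ) :
    ℕ → List V → Comp (List (V × V))
  | 0, _ => Comp.interrupt
  | f + 1, vs => do
    Comp.lift (tick 1)
    if vs.length = 1 then return []
    else
      let i ← Comp.pick vs
      let j ← Comp.pick vs
      let sep ← Comp.lift (findEvenSeparator Q d vs i j)
      match sep with
      | none => reconstructTree Q d f vs
      | some e =>
        let (v₁, v₂) ← Comp.lift (splitTree Q e.2 vs)
        let e₁ ← reconstructTree Q d f v₁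
        let e₂ ← reconstructTree Q d f v₂
        Comp.lift (tick (e₁.length + e₂.length + 1))
        return e₁ ++ e₂ ++ [e]

/-- Query the weight of every edge of a list, starting from the (sparse) weight table `W`. -/
def readWeights (query : V → V → Timed ℝ) :
    List (V × V) → (V → V → ℝ) → Timed (V → V → ℝ)
  | [], W => pure W
  | e :: es, W => do
    tick 1
    let x ← query e.1 e.2
    readWeights query es (fun i j => if i = e.1 ∧ j = e.2 then x else W i j)

/-- Reconstruct weighted tree from additive queries: `oracle` answers the additive path queries,
each of which costs one time unit; the path query answers whether the additive one is positive. The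
output consists of the edge set (as a list) and the edge weights. The first numerical argument after
`d` is the truncation depth. -/
noncomputable def reconstructWeightedTree (oracle : V → V → ℝ) (d f : ℕ) (vs : List V) :
    Comp (List (V × V) × (V → V → ℝ)) := do
  let query : V → V → Timed ℝ := fun i j => ⟨oracle i j, 1⟩
  let Q : V → V → Timed Bool := fun i j => do
    let x ← query i j
    return (open Classical in decide (0 < x))
  let E ← reconstructTree Q d f vs
  let W ← Comp.lift (readWeights query E 0)
  return (E, W)

end Algorithm

/-- The output `(E, W)` of the algorithm is the tree `T`: the list `E` contains every edge exactly
once and nothing else, and `W` is the weight function. -/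
def WeightedRootedTree.IsReconstructedBy {V : Type} (T : WeightedRootedTree V)
    (out : List (V × V) × (V → V → ℝ)) : Prop :=
  out.1.Nodup ∧ (∀ i j, (i, j) ∈ out.1 ↔ T.graph.Adj i j) ∧ out.2 = T.weight

/-! ### Costs and values of the deterministic subroutines -/

namespace Timed

variable {α β : Type}

/-! For the path queries the tree is its ancestor order: edges are covering pairs, the ancestors of
a node form a chain, and the node sets met in the recursion are convex with a least element
(`IsSubtree`). An edge is named by its lower end `b`; cutting above `b` leaves two such sets, joined
by that edge alone, which gives correctness (`IsEdgeList.append`). The analysis uses of the search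
in a round only what `IsEvenSeparatorRule` records.

A round on `m` nodes costs `O(m log n)`. It therefore suffices to have a potential, `m log m` at the
start, whose expected decrease in a round is at least a constant times `m / d`
(`IsPotential.exists_sum_gain`); the expected time is then `O(d log n)` times the potential
(`etime_reconstructTree_le`).

Let `v` be a centroid and call a branch at `v` heavy if it has at least `⌊m/d⌋` nodes. An even cut
has at least `m / (2d)` nodes on its smaller side, so it lowers `m log m` by a constant times `m /
d`. If a fixed proportion of the nodes is heavy, a round succeeds with constant probability, which
is enough. Otherwise `i` is mostly light. No even edge lies between a light `i` and `v`, so if `j`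
is in a heavy branch below `v` with `B` nodes, exactly this branch is cut off (`eq_of_mem_below`).
If `B ≥ m / √d`, the probability `B / m` of hitting the branch times the gain `B / 2` is enough.

There remains the star: heavy nodes are rare and every branch below `v` is smaller than `m / √d`. A
round may now succeed with probability only about `1 / d`, so the cost has to be amortised. With `D`
the degree of `v`, at least `(d + 1 - D) m / (4d)` nodes are heavy (`IsSubtree.card_heavy`), and
cutting off a branch below `v` lowers `D`; the waiting times thus add up like a harmonic series,
which `-log (d + 1 - D)` measures. The branch above `v`, with `u` nodes, can be cut several times
and is measured by `log (1 + ud/M)`, where `M` is the size at the start of the star phase. Both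
logarithms vary by `O(log d)` only, so the phase consumes `O(M log d)`. The cuts themselves pay for
this: a piece of size `s ≤ M / √d` lowers `m log m` by at least `(s/4) log d`, and the last term of
`starPotential` saves a part of this surplus. Once fewer than `M / 4` nodes remain below `v`, the
savings cover the consumption and `m log m` takes over again.

Finally, an interrupted run has taken at least as much time as its nesting depth, so Markov's
inequality yields halting with probability one as well as the tail bound. -/

@[simp] lemma val_pure (a : α) : (pure a : Timed α).val = a := rfl
@[simp] lemma time_pure (a : α) : (pure a : Timed α).time = 0 := rfl
@[simp] lemma val_bind (x : Timed α) (f : α → Timed β) : (x >>= f).val = (f x.val).val := rfl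
@[simp] lemma time_bind (x : Timed α) (f : α → Timed β) :
    (x >>= f).time = x.time + (f x.val).time := rfl
@[simp] lemma time_tick (c : ℕ) : (tick c).time = c := rfl

lemma val_ite (c : Prop) [Decidable c] (x y : Timed α) :
    (if c then x else y).val = if c then x.val else y.val := by split_ifs <;> rfl
lemma time_ite (c : Prop) [Decidable c] (x y : Timed α) :
    (if c then x else y).time = if c then x.time else y.time := by split_ifs <;> rfl

end Timed

/-! ### Filtering, searching and merge sort -/

section Subroutines

open Timed

variable {V : Type}

lemma timedFilter_val (p : V → Timed Bool) (l : List V) :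
    (timedFilter p l).val = l.filter fun k => (p k).val := by
  induction l with
  | nil => rfl
  | cons k ks ih =>
    simp only [timedFilter, val_bind, ih, val_pure, List.filter_cons]

lemma timedFilter_time_le {p : V → Timed Bool} {c : ℕ} (hp : ∀ k, (p k).time ≤ c) (l : List V) :
    (timedFilter p l).time ≤ (c + 1) * l.length := by
  induction l with
  | nil => simp [timedFilter]
  | cons k ks ih =>
    have := hp k
    simp only [timedFilter, time_bind, time_tick, time_pure, List.length_cons]
    nlinarith

lemma timedFindLast_time_le {p : V → Timed Bool} {c : ℕ} (hp : ∀ k, (p k).time ≤ c) (l : List V)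
    (o : Option V) : (timedFindLast p l o).time ≤ (c + 1) * l.length := by
  induction l generalizing o with
  | nil => simp [timedFindLast]
  | cons k ks ih =>
    have := hp k
    simp only [timedFindLast, time_bind, time_tick, List.length_cons]
    have := ih (if (p k).val then some k else o)
    nlinarith

lemma timedFindLast_spec (p : V → Timed Bool) (l : List V) (o : Option V) :
    ((timedFindLast p l o).val = o ∧ ∀ k ∈ l, (p k).val = false) ∨
      ∃ l₁ k l₂, l = l₁ ++ k :: l₂ ∧ (timedFindLast p l o).val = some k ∧ (p k).val = true ∧
        ∀ k' ∈ l₂, (p k').val = false := by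
  induction l generalizing o with
  | nil => simp [timedFindLast]
  | cons k ks ih =>
    have hval : (timedFindLast p (k :: ks) o).val =
      (timedFindLast p ks (if (p k).val then some k else o)).val := rfl
    rcases ih (if (p k).val then some k else o) with ⟨h, h'⟩ | ⟨l₁, x, l₂, h1, h2, h3, h4⟩
    · cases hk : (p k).val
      · left
        refine ⟨by rw [hval, h]; simp [hk], ?_⟩
        simpa [hk] using h'
      · right
        exact ⟨[], k, ks, rfl, by rw [hval, h]; simp [hk], hk, h'⟩
    · right
      exact ⟨k :: l₁, x, l₂, by simp [h1], by rw [hval, h2], h3, h4⟩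

lemma timedMerge_perm (Q : V → V → Timed Bool) (xs ys : List V) :
    (timedMerge Q xs ys).val.Perm (xs ++ ys) := by
  fun_induction timedMerge Q xs ys with
  | case1 ys => simp
  | case2 xs => simp
  | case3 x xs y ys ih1 ih2 =>
    simp only [val_bind, val_ite, val_pure]
    split_ifs with h
    · exact (ih1).cons x
    · refine ((ih2).cons y).trans ?_
      exact (List.perm_middle (l₁ := x :: xs)).symm

lemma timedMerge_time_le {Q : V → V → Timed Bool} (hQ : ∀ i j, (Q i j).time = 1)
    (xs ys : List V) : (timedMerge Q xs ys).time ≤ 2 * (xs.length + ys.length) := by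
  fun_induction timedMerge Q xs ys with
  | case1 ys => simp
  | case2 xs => simp
  | case3 x xs y ys ih1 ih2 =>
    simp only [time_bind, time_tick, time_ite, time_pure, hQ, List.length_cons] at *
    split_ifs <;> omega

lemma timedMerge_sorted [PartialOrder V] {Q : V → V → Timed Bool}
    (hQ : ∀ i j, (Q i j).val = true ↔ i < j) (xs ys : List V) (hx : xs.Pairwise (· < ·))
    (hy : ys.Pairwise (· < ·)) (hxy : ∀ x ∈ xs, ∀ y ∈ ys, x < y ∨ y < x) :
    (timedMerge Q xs ys).val.Pairwise (· < ·) := by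
  fun_induction timedMerge Q xs ys with
  | case1 ys => simpa
  | case2 xs => simpa
  | case3 x xs y ys ih1 ih2 =>
    simp only [val_bind, val_ite, val_pure, List.pairwise_cons, List.mem_cons] at *
    have e1 := timedMerge_perm Q xs (y :: ys)
    have e2 := timedMerge_perm Q (x :: xs) ys
    split_ifs with h
    · rw [hQ] at h
      refine List.pairwise_cons.2 ⟨fun z hz => ?_, ih1 hx.2 hy fun a ha b hb => hxy a (.inr ha) b hb⟩
      rw [e1.mem_iff, List.mem_append, List.mem_cons] at hz
      rcases hz with hz | rfl | hz
      · exact hx.1 z hz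
      · exact h
      · exact h.trans (hy.1 z hz)
    · have h' : y < x := (hxy x (.inl rfl) y (.inl rfl)).resolve_left fun h1 => h ((hQ _ _).2 h1)
      refine List.pairwise_cons.2 ⟨fun z hz => ?_, ih2 hx hy.2 fun a ha b hb => hxy a ha b (.inr hb)⟩
      rw [e2.mem_iff, List.mem_append, List.mem_cons] at hz
      rcases hz with (rfl | hz) | hz
      · exact h'
      · exact h'.trans (hx.1 z hz)
      · exact hy.1 z hz

lemma timedSort_perm (Q : V → V → Timed Bool) (l : List V) : (timedSort Q l).val.Perm l := by
  fun_induction timedSort Q l with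
  | case1 l h ih1 ih2 =>
    simp only [val_bind]
    refine (timedMerge_perm Q _ _).trans ((ih1.append ih2).trans ?_)
    rw [List.take_append_drop]
  | case2 l h => exact List.Perm.refl _

lemma timedSort_sorted [PartialOrder V] {Q : V → V → Timed Bool}
    (hQ : ∀ i j, (Q i j).val = true ↔ i < j) (l : List V) (hl : l.Nodup)
    (hc : ∀ x ∈ l, ∀ y ∈ l, x ≤ y ∨ y ≤ x) : (timedSort Q l).val.Pairwise (· < ·) := by
  fun_induction timedSort Q l with
  | case1 l h ih1 ih2 =>
    simp only [val_bind]
    have t := List.take_subset (l.length / 2) l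
    have t' := List.drop_subset (l.length / 2) l
    refine timedMerge_sorted hQ _ _
      (ih1 (hl.sublist (List.take_sublist _ _)) fun x hx y hy => hc x (t hx) y (t hy))
      (ih2 (hl.sublist (List.drop_sublist _ _)) fun x hx y hy => hc x (t' hx) y (t' hy)) ?_
    intro x hx y hy
    rw [(timedSort_perm Q _).mem_iff] at hx hy
    have hne : x ≠ y := by
      rintro rfl
      exact List.disjoint_take_drop hl le_rfl hx hy
    rcases hc x (t hx) y (t' hy) with h1 | h1
    · exact .inl (lt_of_le_of_ne h1 hne)
    · exact .inr (lt_of_le_of_ne h1 hne.symm)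
  | case2 l h =>
    match l, h with
    | [], _ => simp
    | [x], _ => simp
    | _ :: _ :: _, h => simp at h

/-- Splitting costs `n` and merging at most `2n`, hence `3n` on each of `Nat.clog 2 n` levels. -/
lemma timedSort_time_le {Q : V → V → Timed Bool} (hQ : ∀ i j, (Q i j).time = 1) (l : List V) :
    (timedSort Q l).time ≤ 3 * l.length * Nat.clog 2 l.length := by
  fun_induction timedSort Q l with
  | case1 l h ih1 ih2 =>
    have hm := timedMerge_time_le hQ (timedSort Q (l.take (l.length / 2))).val
      (timedSort Q (l.drop (l.length / 2))).val
    rw [(timedSort_perm Q _).length_eq, (timedSort_perm Q _).length_eq, List.length_take,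
      List.length_drop] at hm
    simp only [List.length_take, List.length_drop] at ih1 ih2
    simp only [time_bind, time_tick]
    have hmin : min (l.length / 2) l.length = l.length / 2 := by omega
    rw [hmin] at ih1 hm
    set n := l.length with hn
    -- The larger half has `⌈n/2⌉ = (n + 2 - 1) / 2` entries, for which `Nat.clog` is smaller by
    -- exactly one.
    have hc : Nat.clog 2 n = Nat.clog 2 ((n + 2 - 1) / 2) + 1 := Nat.clog_of_two_le (by norm_num) h
    have e1 : Nat.clog 2 (n - n / 2) ≤ Nat.clog 2 ((n + 2 - 1) / 2) :=
      Nat.clog_mono_right 2 (by omega)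
    have e2 : Nat.clog 2 (n / 2) ≤ Nat.clog 2 ((n + 2 - 1) / 2) := Nat.clog_mono_right 2 (by omega)
    rw [hc]
    generalize Nat.clog 2 ((n + 2 - 1) / 2) = C at *
    have f1 := Nat.mul_le_mul_left (3 * (n - n / 2)) e1
    have f2 := Nat.mul_le_mul_left (3 * (n / 2)) e2
    have f3 : 3 * (n - n / 2) * C + 3 * (n / 2) * C = 3 * n * C := by
      rw [← add_mul, ← mul_add, Nat.sub_add_cancel (Nat.div_le_self n 2)]
    have f4 : 3 * n * (C + 1) = 3 * n * C + 3 * n := by ring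
    omega
  | case2 l h => simp

end Subroutines

/-! ### Directed paths, lowest common ancestors and multidirectional paths -/

section Paths

open Timed

variable {V : Type}

/-- The entries of `vs` between `i` and `j`, in increasing order. -/
structure IsSortedInterval [PartialOrder V] (vs : List V) (i j : V) (p : List V) : Prop where
  sorted : p.Pairwise (· < ·)
  mem_iff : ∀ k, k ∈ p ↔ k ∈ vs ∧ i ≤ k ∧ k ≤ j

namespace IsSortedInterval

variable [PartialOrder V] {vs : List V} {i j : V} {p : List V}

lemma nodup (h : IsSortedInterval vs i j p) : p.Nodup := h.sorted.imp fun h => h.ne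

lemma length_le (h : IsSortedInterval vs i j p) : p.length ≤ vs.length :=
  (h.nodup.subperm fun k hk => ((h.mem_iff k).1 hk).1).length_le

lemma getElem_lt (h : IsSortedInterval vs i j p) {s t : ℕ} (hst : s < t) (ht : t < p.length) :
    p[s] < p[t] := List.pairwise_iff_getElem.1 h.sorted s t (hst.trans ht) ht hst

lemma getElem_le_iff (h : IsSortedInterval vs i j p) {s t : ℕ} (hs : s < p.length)
    (ht : t < p.length) : p[s] ≤ p[t] ↔ s ≤ t := by
  constructor
  · intro hle
    by_contra! hts
    exact (h.getElem_lt hts hs).not_ge hle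
  · intro hst
    rcases hst.eq_or_lt with rfl | hst
    · exact le_rfl
    · exact (h.getElem_lt hst ht).le

lemma length_pos (h : IsSortedInterval vs i j p) (hi : i ∈ vs) (hij : i ≤ j) : 0 < p.length :=
  List.length_pos_of_mem ((h.mem_iff i).2 ⟨hi, le_rfl, hij⟩)

lemma getElem_zero (h : IsSortedInterval vs i j p) (hi : i ∈ vs) (hij : i ≤ j) :
    p[0]'(h.length_pos hi hij) = i := by
  obtain ⟨t, ht, e⟩ := List.mem_iff_getElem.1 ((h.mem_iff i).2 ⟨hi, le_rfl, hij⟩)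
  refine le_antisymm ?_ ((h.mem_iff _).1 (List.getElem_mem (h.length_pos hi hij))).2.1
  calc p[0]'(h.length_pos hi hij) ≤ p[t] := (h.getElem_le_iff _ _).2 (Nat.zero_le _)
    _ = i := e

/-- By convexity, a node strictly between two consecutive entries would itself be an entry. -/
lemma covBy (h : IsSortedInterval vs i j p)
    (hconv : ∀ a ∈ vs, ∀ b ∈ vs, ∀ k, a ≤ k → k ≤ b → k ∈ vs) {s : ℕ} (hs : s + 1 < p.length) :
    p[s] ⋖ p[s + 1] := by
  refine ⟨h.getElem_lt (Nat.lt_succ_self s) hs, fun k hk hk' => ?_⟩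
  have h1 := (h.mem_iff _).1 (List.getElem_mem (show s < p.length by omega))
  have h2 := (h.mem_iff _).1 (List.getElem_mem hs)
  obtain ⟨t, ht, rfl⟩ := List.mem_iff_getElem.1 ((h.mem_iff k).2
    ⟨hconv _ h1.1 _ h2.1 _ hk.le hk'.le, h1.2.1.trans hk.le, hk'.le.trans h2.2.2⟩)
  have := (h.getElem_le_iff (show s < p.length by omega) ht).1 hk.le
  have := (h.getElem_le_iff ht hs).1 hk'.le
  obtain rfl | rfl : t = s ∨ t = s + 1 := by omega
  · exact lt_irrefl _ hk
  · exact lt_irrefl _ hk'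

lemma singleton (hi : i ∈ vs) : IsSortedInterval vs i i [i] where
  sorted := List.pairwise_singleton _ _
  mem_iff k := by
    rw [List.mem_singleton]
    exact ⟨by rintro rfl; exact ⟨hi, le_rfl, le_rfl⟩, fun h => le_antisymm h.2.2 h.2.1⟩

end IsSortedInterval

/-- The node set of a connected part of a rooted forest. -/
structure IsSubtree [PartialOrder V] (U : Finset V) : Prop where
  exists_root : ∃ r ∈ U, ∀ k ∈ U, r ≤ k
  convex : ∀ a ∈ U, ∀ b ∈ U, ∀ k, a ≤ k → k ≤ b → k ∈ U

variable [DecidableEq V]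

lemma directedPath_time_le {Q : V → V → Timed Bool} (hT : ∀ i j, (Q i j).time = 1) (vs : List V)
    (i j : V) :
    (directedPath Q vs i j).time ≤ 3 * vs.length * Nat.clog 2 vs.length + 4 * vs.length + 2 := by
  set p : V → Timed Bool := fun k =>
    if k = i ∨ k = j then pure false
    else do
      let b ← Q i k
      if b then Q k j else pure false with hp
  have h1 : (timedFilter p vs).time ≤ (2 + 1) * vs.length := by
    refine timedFilter_time_le (fun k => ?_) vs
    simp only [hp, time_ite, time_bind, time_pure, hT]
    split_ifs <;> omega
  have hl : (timedFilter p vs).val.length ≤ vs.length := by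
    rw [timedFilter_val]; exact List.length_filter_le _ _
  have h2 := timedSort_time_le hT (timedFilter p vs).val
  have h3 : 3 * (timedFilter p vs).val.length * Nat.clog 2 (timedFilter p vs).val.length ≤
    3 * vs.length * Nat.clog 2 vs.length := by
      gcongr
  have h4 := (timedSort_perm Q (timedFilter p vs).val).length_eq
  simp only [directedPath, time_bind, time_tick, time_pure, ← hp]
  omega

variable [PartialOrder V] {Q : V → V → Timed Bool}

lemma directedPath_spec (hQ : ∀ i j, (Q i j).val = true ↔ i < j)
    (hF : ∀ a b c : V, a ≤ c → b ≤ c → a ≤ b ∨ b ≤ a) {vs : List V} (hvs : vs.Nodup)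
    {i j : V} (hi : i ∈ vs) (hj : j ∈ vs) (hij : i < j) :
    IsSortedInterval vs i j (directedPath Q vs i j).val := by
  set p : V → Timed Bool := fun k =>
    if k = i ∨ k = j then pure false
    else do
      let b ← Q i k
      if b then Q k j else pure false with hp
  have hmem : ∀ k, k ∈ (timedFilter p vs).val ↔ k ∈ vs ∧ i < k ∧ k < j := by
    intro k
    rw [timedFilter_val, List.mem_filter]
    simp only [hp, val_ite, val_bind, val_pure]
    refine and_congr_right fun _ => ?_
    split_ifs with h1 h2
    · rcases h1 with rfl | rfl <;> simp
    · rw [hQ] at h2 ⊢; simp [h2]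
    · rw [hQ] at h2; simp [h2]
  have hnd : (timedFilter p vs).val.Nodup := by rw [timedFilter_val]; exact hvs.filter _
  have hs := timedSort_sorted hQ _ hnd fun x hx y hy =>
    hF x y j ((hmem x).1 hx).2.2.le ((hmem y).1 hy).2.2.le
  have hperm := timedSort_perm Q (timedFilter p vs).val
  have hval : (directedPath Q vs i j).val = i :: ((timedSort Q (timedFilter p vs).val).val ++ [j]) :=
    rfl
  rw [hval]
  constructor
  · rw [List.pairwise_cons, List.pairwise_append]
    refine ⟨fun k hk => ?_, hs, List.pairwise_singleton _ _, fun k hk b hb => ?_⟩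
    · rw [List.mem_append, hperm.mem_iff, hmem, List.mem_singleton] at hk
      rcases hk with hk | rfl
      · exact hk.2.1
      · exact hij
    · rw [List.mem_singleton] at hb
      rw [hperm.mem_iff, hmem] at hk
      exact hb ▸ hk.2.2
  · intro k
    rw [List.mem_cons, List.mem_append, hperm.mem_iff, hmem, List.mem_singleton]
    constructor
    · rintro (rfl | h | rfl)
      · exact ⟨hi, le_rfl, hij.le⟩
      · exact ⟨h.1, h.2.1.le, h.2.2.le⟩
      · exact ⟨hj, hij.le, le_rfl⟩
    · rintro ⟨h, h1, h2⟩
      rcases h1.eq_or_lt with rfl | h1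
      · exact .inl rfl
      rcases h2.eq_or_lt with rfl | h2
      · exact .inr (.inr rfl)
      · exact .inr (.inl ⟨h, h1, h2⟩)

omit [PartialOrder V] in
lemma findLowestCommonAncestor_time_le (hT : ∀ i j, (Q i j).time = 1) (vs : List V) (i j : V) :
    (findLowestCommonAncestor Q vs i j).time ≤
      3 * vs.length * Nat.clog 2 vs.length + 4 * vs.length := by
  set p : V → Timed Bool := fun j => if j = i then pure false else Q j i with hp
  have h1 : (timedFilter p vs).time ≤ (1 + 1) * vs.length := by
    refine timedFilter_time_le (fun k => ?_) vs
    simp only [hp, time_ite, time_pure, hT]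
    split_ifs <;> omega
  have hl : (timedFilter p vs).val.length ≤ vs.length := by
    rw [timedFilter_val]; exact List.length_filter_le _ _
  have h2 := timedSort_time_le hT (timedFilter p vs).val
  have h3 : 3 * (timedFilter p vs).val.length * Nat.clog 2 (timedFilter p vs).val.length ≤
    3 * vs.length * Nat.clog 2 vs.length := by
      gcongr
  have h4 := (timedSort_perm Q (timedFilter p vs).val).length_eq
  have h5 := timedFindLast_time_le (p := fun k => Q k j) (c := 1) (fun k => (hT k j).le)
    (timedSort Q (timedFilter p vs).val).val none
  simp only [findLowestCommonAncestor, findPathFromRoot, time_bind, val_bind, ← hp]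
  omega

/-- The proper ancestors of `i` form a chain. In its sorted list every common ancestor stands at or
before the last entry that is an ancestor of `j`. -/
lemma findLowestCommonAncestor_spec (hQ : ∀ i j, (Q i j).val = true ↔ i < j)
    (hF : ∀ a b c : V, a ≤ c → b ≤ c → a ≤ b ∨ b ≤ a) {vs : List V} (hvs : vs.Nodup)
    (hU : IsSubtree vs.toFinset) {i j : V} (hi : i ∈ vs) (hj : j ∈ vs)
    (hij : ¬ i ≤ j) (hji : ¬ j ≤ i) :
    ∃ c ∈ vs, (findLowestCommonAncestor Q vs i j).val = some c ∧ c < i ∧ c < j ∧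
      ∀ k ∈ vs, k ≤ i → k ≤ j → k ≤ c := by
  set p : V → Timed Bool := fun j => if j = i then pure false else Q j i with hp
  have hmem : ∀ k, k ∈ (timedFilter p vs).val ↔ k ∈ vs ∧ k < i := by
    intro k
    rw [timedFilter_val, List.mem_filter]
    simp only [hp, val_ite, val_pure]
    refine and_congr_right fun _ => ?_
    split_ifs with h1
    · subst h1; simp
    · rw [hQ]
  have hnd : (timedFilter p vs).val.Nodup := by rw [timedFilter_val]; exact hvs.filter _
  have hs := timedSort_sorted hQ _ hnd fun x hx y hy =>
    hF x y i ((hmem x).1 hx).2.le ((hmem y).1 hy).2.le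
  have hmem' : ∀ k, k ∈ (timedSort Q (timedFilter p vs).val).val ↔ k ∈ vs ∧ k < i := by
    intro k; rw [(timedSort_perm Q _).mem_iff, hmem]
  obtain ⟨r, hr, hr'⟩ := hU.exists_root
  simp only [List.mem_toFinset] at hr hr'
  have hri : r < i := lt_of_le_of_ne (hr' i hi) (by rintro rfl; exact hij (hr' j hj))
  have hrj : r < j := lt_of_le_of_ne (hr' j hj) (by rintro rfl; exact hji (hr' i hi))
  have hval : (findLowestCommonAncestor Q vs i j).val =
    (timedFindLast (fun k => Q k j) (timedSort Q (timedFilter p vs).val).val none).val := rfl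
  rcases timedFindLast_spec (fun k => Q k j) (timedSort Q (timedFilter p vs).val).val none with
    ⟨_, h⟩ | ⟨l₁, c, l₂, h1, h2, h3, h4⟩
  -- The root is a common ancestor, so the search does not end with its default `none`.
  · have := h r ((hmem' r).2 ⟨hr, hri⟩)
    rw [(hQ r j).2 hrj] at this
    cases this
  · have hc := (hmem' c).1 (by rw [h1]; simp)
    refine ⟨c, hc.1, by rw [hval, h2], hc.2, (hQ _ _).1 h3, fun k hk hki hkj => ?_⟩
    have hki' : k < i := lt_of_le_of_ne hki (by rintro rfl; exact hij hkj)
    have hkj' : k < j := lt_of_le_of_ne hkj (by rintro rfl; exact hji hki)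
    have hk' := (hmem' k).2 ⟨hk, hki'⟩
    rw [h1, List.mem_append, List.mem_cons] at hk'
    rw [h1, List.pairwise_append] at hs
    rcases hk' with hk' | rfl | hk'
    · exact (hs.2.2 k hk' c (by simp)).le
    · exact le_rfl
    · have := h4 k hk'
      rw [(hQ k j).2 hkj'] at this
      cases this

/-- `path` is the path from `i` to `j` in the tree with node set `vs`, made of an ascending part
(the reverse of `left`) and a descending part `right`, and `c` is the lowest common ancestor. -/
structure IsMultidirPath (vs : List V) (i j c : V) (left right path : List V) : Prop where
  mem_start : i ∈ vs
  mem_end : j ∈ vs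
  mem_top : c ∈ vs
  top_le_start : c ≤ i
  top_le_end : c ≤ j
  le_top : ∀ k ∈ vs, k ≤ i → k ≤ j → k ≤ c
  left_interval : IsSortedInterval vs c i left
  right_interval : IsSortedInterval vs c j right
  path_eq : path = left.reverse ++ right.tail

/-- The ends are exchanged only if `j` is a proper ancestor of `i`. This has to be recorded because
the first even edge depends on the direction of traversal. When one end is an ancestor of the other,
the ascending part is a single node. -/
lemma multidirPath_spec (hQ : ∀ i j, (Q i j).val = true ↔ i < j)
    (hF : ∀ a b c : V, a ≤ c → b ≤ c → a ≤ b ∨ b ≤ a) {vs : List V} (hvs : vs.Nodup)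
    (hU : IsSubtree vs.toFinset) {i j : V} (hi : i ∈ vs) (hj : j ∈ vs) :
    ∃ i' j' c left right, ((i' = i ∧ j' = j) ∨ (i' = j ∧ j' = i ∧ j < i)) ∧
      IsMultidirPath vs i' j' c left right (multidirPath Q vs i j).val.1 ∧
      (multidirPath Q vs i j).val.2 + 1 = left.length := by
  rcases eq_or_ne i j with rfl | hne
  · refine ⟨i, i, i, [i], [i], .inl ⟨rfl, rfl⟩, ?_⟩
    have hval : (multidirPath Q vs i i).val = ([i], 0) := by simp [multidirPath]
    rw [hval]
    exact ⟨⟨hi, hi, hi, le_rfl, le_rfl, fun _ _ h _ => h, .singleton hi, .singleton hi, rfl⟩, rfl⟩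
  by_cases hij : i < j
  · have hval : (multidirPath Q vs i j).val = ((directedPath Q vs i j).val, 0) := by
      simp [multidirPath, hne, (hQ i j).2 hij]
    refine ⟨i, j, i, [i], (directedPath Q vs i j).val, .inl ⟨rfl, rfl⟩, ?_⟩
    rw [hval]
    exact ⟨⟨hi, hj, hi, le_rfl, hij.le, fun _ _ h _ => h, .singleton hi,
      directedPath_spec hQ hF hvs hi hj hij, rfl⟩, rfl⟩
  have hij' : (Q i j).val = false := by rw [← Bool.not_eq_true, hQ]; exact hij
  by_cases hji : j < i
  · have hval : (multidirPath Q vs i j).val = ((directedPath Q vs j i).val, 0) := by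
      simp [multidirPath, hne, hij', (hQ j i).2 hji]
    refine ⟨j, i, j, [j], (directedPath Q vs j i).val, .inr ⟨rfl, rfl, hji⟩, ?_⟩
    rw [hval]
    exact ⟨⟨hj, hi, hj, le_rfl, hji.le, fun _ _ h _ => h, .singleton hj,
      directedPath_spec hQ hF hvs hj hi hji, rfl⟩, rfl⟩
  have hji' : (Q j i).val = false := by rw [← Bool.not_eq_true, hQ]; exact hji
  obtain ⟨c, hc, hcv, hci, hcj, hmax⟩ := findLowestCommonAncestor_spec hQ hF hvs hU hi hj
    (fun h => hij (lt_of_le_of_ne h hne)) (fun h => hji (lt_of_le_of_ne h hne.symm))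
  have hl := directedPath_spec hQ hF hvs hc hi hci
  have hval : (multidirPath Q vs i j).val = ((directedPath Q vs c i).val.reverse ++
      (directedPath Q vs c j).val.tail, (directedPath Q vs c i).val.length - 1) := by
    simp [multidirPath, hne, hij', hji', hcv]
  refine ⟨i, j, c, (directedPath Q vs c i).val, (directedPath Q vs c j).val, .inl ⟨rfl, rfl⟩, ?_⟩
  rw [hval]
  exact ⟨⟨hi, hj, hc, hci.le, hcj.le, hmax, hl, directedPath_spec hQ hF hvs hc hj hcj, rfl⟩,
    Nat.sub_add_cancel (hl.length_pos hc hci.le)⟩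

lemma multidirPath_time_le (hQ : ∀ i j, (Q i j).val = true ↔ i < j)
    (hT : ∀ i j, (Q i j).time = 1)
    (hF : ∀ a b c : V, a ≤ c → b ≤ c → a ≤ b ∨ b ≤ a) {vs : List V} (hvs : vs.Nodup)
    (hU : IsSubtree vs.toFinset) {i j : V} (hi : i ∈ vs) (hj : j ∈ vs) :
    (multidirPath Q vs i j).time ≤ 9 * vs.length * Nat.clog 2 vs.length + 14 * vs.length + 7 := by
  have h1 := directedPath_time_le hT vs i j
  have h2 := directedPath_time_le hT vs j i
  have h3 := findLowestCommonAncestor_time_le hT vs i j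
  rcases eq_or_ne i j with rfl | hne
  · simp [multidirPath]
  by_cases hij : i < j
  · have : (multidirPath Q vs i j).time = 2 + (directedPath Q vs i j).time := by
      simp [multidirPath, hne, (hQ i j).2 hij, hT, ← add_assoc]
    nlinarith
  have hij' : (Q i j).val = false := by rw [← Bool.not_eq_true, hQ]; exact hij
  by_cases hji : j < i
  · have : (multidirPath Q vs i j).time = 3 + (directedPath Q vs j i).time := by
      simp [multidirPath, hne, hij', (hQ j i).2 hji, hT, ← add_assoc]
    nlinarith
  have hji' : (Q j i).val = false := by rw [← Bool.not_eq_true, hQ]; exact hji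
  obtain ⟨c, hc, hcv, hci, hcj, hmax⟩ := findLowestCommonAncestor_spec hQ hF hvs hU hi hj
    (fun h => hij (lt_of_le_of_ne h hne)) (fun h => hji (lt_of_le_of_ne h hne.symm))
  have hl := (directedPath_spec hQ hF hvs hc hi hci).length_le
  have hr := (directedPath_spec hQ hF hvs hc hj hcj).length_le
  have h4 := directedPath_time_le hT vs c i
  have h5 := directedPath_time_le hT vs c j
  have : (multidirPath Q vs i j).time = 3 + (findLowestCommonAncestor Q vs i j).time +
      (directedPath Q vs c i).time + (directedPath Q vs c j).time +
      ((directedPath Q vs c i).val.length + (directedPath Q vs c j).val.length) := by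
    simp [multidirPath, hne, hij', hji', hcv, hT]; omega
  nlinarith

end Paths

/-! ### Bags and the scan for an even edge -/

section Bags

open Timed

variable {V : Type}

section Order

variable [PartialOrder V] {Q : V → V → Timed Bool}

/-- The ancestors of `k` form an initial segment of a directed path, so the test is monotone along
it. Position `l` is never tested, being the default; hence the strict bound `l < t`. -/
lemma findBagBetween_spec (hQ : ∀ i j, (Q i j).val = true ↔ i < j) {path : List V}
    (hp : path.Pairwise (· < ·)) (k : V) {l r : ℕ} (hlr : l < r) (hr : r ≤ path.length) :
    l ≤ (findBagBetween Q path k l r).val ∧ (findBagBetween Q path k l r).val < r ∧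
      ∀ t (ht : t < path.length), l < t → t < r →
        (path[t] < k ↔ t ≤ (findBagBetween Q path k l r).val) := by
  induction hn : r - l using Nat.strong_induction_on generalizing l r with
  | _ n ih =>
    have hlt : ∀ s t (hs : s < path.length) (ht : t < path.length), s ≤ t → path[t] < k →
        path[s] < k := by
      intro s t hs ht hst h
      rcases hst.eq_or_lt with rfl | hst
      · exact h
      · exact (List.pairwise_iff_getElem.1 hp s t hs ht hst).trans h
    by_cases h : l + 1 < r
    · have hm : (l + r) / 2 < path.length := by omega
      have hval : (findBagBetween Q path k l r).val = if (Q path[(l + r) / 2] k).val then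
          (findBagBetween Q path k ((l + r) / 2) r).val
          else (findBagBetween Q path k l ((l + r) / 2)).val := by
        rw [findBagBetween]
        simp only [h, dif_pos, val_bind, val_ite, List.getElem?_eq_getElem hm]
      rw [hval]
      split_ifs with hb
      · rw [hQ] at hb
        obtain ⟨h1, h2, h3⟩ := ih (r - (l + r) / 2) (by omega) (l := (l + r) / 2) (r := r)
          (by omega) hr rfl
        refine ⟨by omega, h2, fun t ht hlt' htr => ?_⟩
        rcases le_or_gt t ((l + r) / 2) with hc | hc
        · exact iff_of_true (hlt _ _ ht hm hc hb) (hc.trans h1)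
        · exact h3 t ht hc htr
      · rw [hQ] at hb
        obtain ⟨h1, h2, h3⟩ := ih ((l + r) / 2 - l) (by omega) (l := l) (r := (l + r) / 2)
          (by omega) hm.le rfl
        refine ⟨h1, by omega, fun t ht hlt' htr => ?_⟩
        rcases lt_or_ge t ((l + r) / 2) with hc | hc
        · exact h3 t ht hlt' hc
        · exact iff_of_false (fun h => hb (hlt _ _ hm ht hc h)) (by omega)
    · have hval : (findBagBetween Q path k l r).val = l := by
        rw [findBagBetween]; simp [h]
      rw [hval]
      exact ⟨le_rfl, hlr, fun t ht h1 h2 => by omega⟩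

lemma findBag_lt (hQ : ∀ i j, (Q i j).val = true ↔ i < j) {path : List V}
    (hp : path.Pairwise (· < ·)) (k : V) (h : 0 < path.length) :
    (findBag Q path k).val < path.length :=
  (findBagBetween_spec hQ hp k h le_rfl).2.1

lemma findBag_spec (hQ : ∀ i j, (Q i j).val = true ↔ i < j) {path : List V}
    (hp : path.Pairwise (· < ·)) (k : V) {t : ℕ} (h0 : 0 < t) (ht : t < path.length) :
    path[t] < k ↔ t ≤ (findBag Q path k).val :=
  (findBagBetween_spec hQ hp k (h0.trans ht) le_rfl).2.2 t ht h0 ht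

end Order

lemma findBagBetween_time_le {Q : V → V → Timed Bool} (hT : ∀ i j, (Q i j).time = 1)
    (path : List V) (k : V) (l r : ℕ) :
    (findBagBetween Q path k l r).time ≤ 2 * Nat.clog 2 (r - l) := by
  induction hn : r - l using Nat.strong_induction_on generalizing l r with
  | _ n ih =>
    by_cases h : l + 1 < r
    · have h1 := ih (r - (l + r) / 2) (by omega) ((l + r) / 2) r rfl
      have h2 := ih ((l + r) / 2 - l) (by omega) l ((l + r) / 2) rfl
      have e1 : Nat.clog 2 (r - (l + r) / 2) ≤ Nat.clog 2 ((n + 2 - 1) / 2) :=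
        Nat.clog_mono_right 2 (by omega)
      have e2 : Nat.clog 2 ((l + r) / 2 - l) ≤ Nat.clog 2 ((n + 2 - 1) / 2) :=
        Nat.clog_mono_right 2 (by omega)
      have hc : Nat.clog 2 n = Nat.clog 2 ((n + 2 - 1) / 2) + 1 :=
        Nat.clog_of_two_le (by norm_num) (by omega)
      rw [findBagBetween]
      simp only [h, dif_pos, time_bind, time_tick]
      cases path[(l + r) / 2]? with
      | none =>
        simp only [time_bind, time_pure, time_ite]
        split_ifs <;> omega
      | some x =>
        simp only [time_bind, hT, time_ite]
        split_ifs <;> omega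
    · rw [findBagBetween]; simp [h]

lemma findBag_time_le {Q : V → V → Timed Bool} (hT : ∀ i j, (Q i j).time = 1)
    (path : List V) (k : V) : (findBag Q path k).time ≤ 2 * Nat.clog 2 path.length :=
  findBagBetween_time_le hT path k 0 path.length

/-- The position in a multidirectional path of the node in whose bag `k` is. -/
def bagIndex (Q : V → V → Timed Bool) (left right : List V) (k : V) : ℕ :=
  if (findBag Q left k).val = 0 then left.length - 1 + (findBag Q right k).val
  else left.length - 1 - (findBag Q left k).val

lemma sum_take_modify_succ (l : List ℕ) (i r : ℕ) :
    ((l.modify i (· + 1)).take r).sum =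
      (l.take r).sum + if i < r ∧ i < l.length then 1 else 0 := by
  induction l generalizing i r with
  | nil => simp
  | cons x l ih =>
    cases r with
    | zero => simp
    | succ r =>
      cases i with
      | zero => simp; omega
      | succ i => simp [ih, add_assoc]

section CountBags

variable [DecidableEq V] (Q : V → V → Timed Bool) (path left right : List V)

lemma countBags_val_cons (k : V) (ks : List V) (bags : List ℕ) :
    (countBags Q path left right (k :: ks) bags).val =
      (countBags Q path left right ks
        (if k ∈ path then bags else bags.modify (bagIndex Q left right k) (· + 1))).val := by
  by_cases h : k ∈ path <;> simp [countBags, h, bagIndex]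

lemma countBags_length (ks : List V) (bags : List ℕ) :
    (countBags Q path left right ks bags).val.length = bags.length := by
  induction ks generalizing bags with
  | nil => rfl
  | cons k ks ih =>
    rw [countBags_val_cons, ih]
    split_ifs <;> simp

/-- The hypothesis on `r` matters: `List.modify` beyond the end of the list changes nothing, so such
a bag would not be counted. -/
lemma countBags_sum_take (ks : List V) (bags : List ℕ) {r : ℕ} (hr : r ≤ bags.length) :
    ((countBags Q path left right ks bags).val.take r).sum = (bags.take r).sum +
      (ks.filter fun k => k ∉ path ∧ bagIndex Q left right k < r).length := by
  induction ks generalizing bags with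
  | nil => simp [countBags]
  | cons k ks ih =>
    rw [countBags_val_cons, ih _ (by split_ifs <;> simp [hr]), List.filter_cons]
    by_cases h : k ∈ path
    · simp [h]
    · simp only [h, if_false, not_false_eq_true, true_and, sum_take_modify_succ]
      by_cases h2 : bagIndex Q left right k < r
      · have : bagIndex Q left right k < bags.length := h2.trans_le hr
        simp [h2, this]; omega
      · simp [h2]

lemma countBags_time_le {B : ℕ} (hl : ∀ k, (findBag Q left k).time ≤ B)
    (hr : ∀ k, (findBag Q right k).time ≤ B) (ks : List V) (bags : List ℕ) :
    (countBags Q path left right ks bags).time ≤ (2 * B + 1) * ks.length := by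
  induction ks generalizing bags with
  | nil => simp [countBags]
  | cons k ks ih =>
    have h1 := hl k
    have h2 := hr k
    by_cases h : k ∈ path
    · have := ih bags
      simp only [countBags, time_bind, time_tick, if_pos h, List.length_cons]
      nlinarith
    · simp only [countBags, time_bind, time_tick, if_neg h, List.length_cons]
      have := ih (bags.modify (if (findBag Q left k).val = 0 then
        left.length - 1 + (findBag Q right k).val else left.length - 1 - (findBag Q left k).val)
          (· + 1))
      nlinarith

end CountBags

lemma scanPath_time_le (n d a r s : ℕ) (path : List V) (bags : List ℕ) :
    (scanPath n d a r s path bags).time ≤ path.length := by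
  induction path generalizing r s bags with
  | nil => simp [scanPath]
  | cons x path ih =>
    cases path with
    | nil => simp [scanPath]
    | cons y path =>
      cases bags with
      | nil => simp [scanPath]
      | cons b bags =>
        have := ih (r + 1) (s + b) bags
        simp only [scanPath, time_bind, time_tick, time_ite, time_pure, List.length_cons] at *
        split_ifs <;> omega

lemma scanPath_spec (n d a r s : ℕ) (path : List V) (bags : List ℕ)
    (hlen : path.length = bags.length) :
    ((scanPath n d a r s path bags).val = none ∧ ∀ t, t + 1 < path.length →
      ¬ (n / d ≤ s + (bags.take (t + 1)).sum ∧ s + (bags.take (t + 1)).sum ≤ n - n / d)) ∨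
    ∃ t, ∃ h : t + 1 < path.length,
      (scanPath n d a r s path bags).val =
        some (if r + t < a then (path[t + 1], path[t]) else (path[t], path[t + 1])) ∧
      (n / d ≤ s + (bags.take (t + 1)).sum ∧ s + (bags.take (t + 1)).sum ≤ n - n / d) ∧
      ∀ t' < t,
        ¬ (n / d ≤ s + (bags.take (t' + 1)).sum ∧ s + (bags.take (t' + 1)).sum ≤ n - n / d) := by
  induction path generalizing r s bags with
  | nil => left; simp [scanPath]
  | cons x path ih =>
    cases path with
    | nil => left; simp [scanPath]
    | cons y path =>
      cases bags with
      | nil => simp at hlen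
      | cons b bags =>
        have hv : (scanPath n d a r s (x :: y :: path) (b :: bags)).val =
          if n / d ≤ s + b ∧ s + b ≤ n - n / d then some (if r < a then (y, x) else (x, y))
          else (scanPath n d a (r + 1) (s + b) (y :: path) bags).val := by
            simp only [scanPath, val_bind, val_ite, val_pure]
        rw [hv]
        split_ifs with h h'
        · right; exact ⟨0, by simp, by simp [h'], by simpa using h, by simp⟩
        · right; exact ⟨0, by simp, by simp [h'], by simpa using h, by simp⟩
        · rcases ih (r + 1) (s + b) bags (by simpa using hlen) with ⟨h1, h2⟩ | ⟨t, ht, h1, h2, h3⟩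
          · left
            refine ⟨h1, fun t ht => ?_⟩
            cases t with
            | zero => simpa using h
            | succ t =>
              have := h2 t (by simpa using ht)
              simpa [add_assoc] using this
          · right
            refine ⟨t + 1, by simpa using ht, ?_, by simpa [add_assoc] using h2, fun t' ht' => ?_⟩
            · rw [h1]
              simp [add_assoc, add_comm 1 t]
            · cases t' with
              | zero => simpa using h
              | succ t' =>
                have := h3 t' (by omega)
                simpa [add_assoc] using this

end Bags

/-! ### Prefixes of a multidirectional path as sides of a cut -/

section EvenSeparator

open Timed

variable {V : Type} [PartialOrder V]

namespace IsMultidirPath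

variable {vs : List V} {i j c : V} {left right path : List V}

lemma left_pos (h : IsMultidirPath vs i j c left right path) : 0 < left.length :=
  h.left_interval.length_pos h.mem_top h.top_le_start

lemma right_pos (h : IsMultidirPath vs i j c left right path) : 0 < right.length :=
  h.right_interval.length_pos h.mem_top h.top_le_end

lemma left_zero (h : IsMultidirPath vs i j c left right path) : left[0]'h.left_pos = c :=
  h.left_interval.getElem_zero h.mem_top h.top_le_start

lemma right_zero (h : IsMultidirPath vs i j c left right path) : right[0]'h.right_pos = c :=
  h.right_interval.getElem_zero h.mem_top h.top_le_end

lemma right_eq (h : IsMultidirPath vs i j c left right path) : right = c :: right.tail := by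
  have h0 := h.right_zero
  have h1 := h.right_pos
  cases right with
  | nil => simp at h1
  | cons x l => simpa using h0

lemma length_path (h : IsMultidirPath vs i j c left right path) :
    path.length + 1 = left.length + right.length := by
  have := h.right_pos
  rw [h.path_eq, List.length_append, List.length_reverse, List.length_tail]
  omega

lemma getElem_left (h : IsMultidirPath vs i j c left right path) {s : ℕ}
    (hs : s < left.length) (hs' : s < path.length) :
    path[s] = left[left.length - 1 - s]'(by omega) := by
  have e := h.path_eq
  subst e
  rw [List.getElem_append_left (by simpa using hs), List.getElem_reverse]

lemma getElem_right (h : IsMultidirPath vs i j c left right path) {s : ℕ}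
    (hs : s < right.length) (hs' : left.length - 1 + s < path.length) :
    path[left.length - 1 + s] = right[s] := by
  have hl := h.left_pos
  rcases Nat.eq_zero_or_pos s with rfl | h0
  · rw [h.right_zero]
    have := h.getElem_left (s := left.length - 1) (by omega) (by omega)
    simp only [Nat.add_zero, this, Nat.sub_self]
    exact h.left_zero
  · have e := h.path_eq
    subst e
    rw [List.getElem_append_right (by simp; omega), List.getElem_tail]
    congr 1
    rw [List.length_reverse]
    omega

lemma mem_path_iff (h : IsMultidirPath vs i j c left right path) (k : V) :
    k ∈ path ↔ k ∈ left ∨ k ∈ right := by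
  have hc : c ∈ left := (h.left_interval.mem_iff c).2 ⟨h.mem_top, le_rfl, h.top_le_start⟩
  have hr := h.right_eq
  rw [h.path_eq, List.mem_append, List.mem_reverse]
  constructor
  · exact Or.imp_right fun h => List.mem_of_mem_tail h
  · rintro (h1 | h1)
    · exact .inl h1
    · rw [hr, List.mem_cons] at h1
      rcases h1 with rfl | h1
      · exact .inl hc
      · exact .inr h1

lemma mem_of_mem_path (h : IsMultidirPath vs i j c left right path) {k : V} (hk : k ∈ path) :
    k ∈ vs := by
  rcases (h.mem_path_iff k).1 hk with h1 | h1
  · exact ((h.left_interval.mem_iff k).1 h1).1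
  · exact ((h.right_interval.mem_iff k).1 h1).1

lemma not_le_end (h : IsMultidirPath vs i j c left right path) {s : ℕ} (h0 : 0 < s)
    (hs : s < left.length) : ¬ left[s] ≤ j := by
  intro hj
  have hm := (h.left_interval.mem_iff _).1 (List.getElem_mem hs)
  have := h.le_top _ hm.1 hm.2.2 hj
  rw [← h.left_zero, h.left_interval.getElem_le_iff] at this
  omega

lemma not_le_start (h : IsMultidirPath vs i j c left right path) {s : ℕ} (h0 : 0 < s)
    (hs : s < right.length) : ¬ right[s] ≤ i := by
  intro hj
  have hm := (h.right_interval.mem_iff _).1 (List.getElem_mem hs)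
  have := h.le_top _ hm.1 hj hm.2.2
  rw [← h.right_zero, h.right_interval.getElem_le_iff] at this
  omega

lemma left_le (h : IsMultidirPath vs i j c left right path) {s : ℕ} (hs : s < left.length) :
    left[s] ≤ i := ((h.left_interval.mem_iff _).1 (List.getElem_mem hs)).2.2

lemma right_le (h : IsMultidirPath vs i j c left right path) {s : ℕ} (hs : s < right.length) :
    right[s] ≤ j := ((h.right_interval.mem_iff _).1 (List.getElem_mem hs)).2.2

lemma nodup (h : IsMultidirPath vs i j c left right path) : path.Nodup := by
  rw [h.path_eq, List.nodup_append]
  refine ⟨List.nodup_reverse.2 h.left_interval.nodup, h.right_interval.nodup.tail, ?_⟩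
  intro a ha b hb hab
  subst hab
  rw [List.mem_reverse] at ha
  obtain ⟨s, hs, rfl⟩ := List.mem_iff_getElem.1 hb
  rw [List.getElem_tail] at ha
  rw [List.length_tail] at hs
  exact h.not_le_start (s := s + 1) (by omega) (by omega) ((h.left_interval.mem_iff _).1 ha).2.2

lemma length_path_le (h : IsMultidirPath vs i j c left right path) : path.length ≤ vs.length :=
  (h.nodup.subperm fun _ hk => h.mem_of_mem_path hk).length_le

variable {Q : V → V → Timed Bool}

/-- A prefix that ends before the top node is cut off by the edge above its last node, so its bags
make up everything at or below that node. For `k` off the path this is what the binary search in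
`left` decides. -/
lemma left_le_iff (hQ : ∀ i j, (Q i j).val = true ↔ i < j)
    (h : IsMultidirPath vs i j c left right path) {t : ℕ} (ht : t + 1 < left.length) (k : V) :
    left[left.length - 1 - t] ≤ k ↔
      k ∈ path.take (t + 1) ∨ (k ∉ path ∧ bagIndex Q left right k < t + 1) := by
  have hlen := h.length_path
  have hr := h.right_pos
  by_cases hk : k ∈ path
  · simp only [hk, not_true, false_and, or_false]
    rw [List.mem_take_iff_getElem]
    constructor
    · intro hle
      rcases (h.mem_path_iff k).1 hk with h1 | h1
      · obtain ⟨u, hu, rfl⟩ := List.mem_iff_getElem.1 h1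
        rw [h.left_interval.getElem_le_iff] at hle
        refine ⟨left.length - 1 - u, by omega, ?_⟩
        rw [h.getElem_left (by omega)]
        congr 1; omega
      · obtain ⟨u, hu, rfl⟩ := List.mem_iff_getElem.1 h1
        exact absurd (hle.trans (h.right_le hu)) (h.not_le_end (by omega) (by omega))
    · rintro ⟨s, hs, rfl⟩
      rw [h.getElem_left (by omega), h.left_interval.getElem_le_iff]
      omega
  · have hk' : k ∉ path.take (t + 1) := fun h => hk (List.mem_of_mem_take h)
    simp only [hk, hk', not_false_eq_true, true_and, false_or]
    have hne : left[left.length - 1 - t] ≠ k := by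
      rintro rfl
      exact hk ((h.mem_path_iff _).2 (.inl (List.getElem_mem _)))
    have h1 := findBag_lt hQ h.left_interval.sorted k h.left_pos
    rw [le_iff_lt_or_eq, or_iff_left hne, findBag_spec hQ h.left_interval.sorted k (by omega),
      bagIndex]
    split_ifs <;> omega

/-- A prefix that contains the top node is cut off by the edge to the next node `right[u]`, so its
bags make up everything not below `right[u]`. -/
lemma not_right_le_iff (hQ : ∀ i j, (Q i j).val = true ↔ i < j)
    (hF : ∀ a b c : V, a ≤ c → b ≤ c → a ≤ b ∨ b ≤ a)
    (h : IsMultidirPath vs i j c left right path) {u : ℕ} (h0 : 0 < u) (hu : u < right.length)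
    (k : V) :
    ¬ right[u] ≤ k ↔ k ∈ path.take (left.length - 1 + u) ∨
      (k ∉ path ∧ bagIndex Q left right k < left.length - 1 + u) := by
  have hlen := h.length_path
  have hl := h.left_pos
  by_cases hk : k ∈ path
  · simp only [hk, not_true, false_and, or_false]
    rw [List.mem_take_iff_getElem]
    constructor
    · intro hle
      rcases (h.mem_path_iff k).1 hk with h1 | h1
      · obtain ⟨w, hw, rfl⟩ := List.mem_iff_getElem.1 h1
        refine ⟨left.length - 1 - w, by omega, ?_⟩
        rw [h.getElem_left (by omega)]
        congr 1; omega
      · obtain ⟨w, hw, rfl⟩ := List.mem_iff_getElem.1 h1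
        rw [h.right_interval.getElem_le_iff] at hle
        exact ⟨left.length - 1 + w, by omega, h.getElem_right hw (by omega)⟩
    · rintro ⟨s, hs, rfl⟩ hle
      rcases lt_or_ge s left.length with hs' | hs'
      · rw [h.getElem_left hs'] at hle
        exact h.not_le_start h0 hu (hle.trans (h.left_le (by omega)))
      · have e := h.getElem_right (s := s - (left.length - 1)) (by omega) (by omega)
        have e' : path[s] = right[s - (left.length - 1)] := by
          rw [← e]; congr 1; omega
        rw [e', h.right_interval.getElem_le_iff] at hle
        omega
  · have hk' : k ∉ path.take (left.length - 1 + u) := fun h => hk (List.mem_of_mem_take h)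
    simp only [hk, hk', not_false_eq_true, true_and, false_or]
    have hne : right[u] ≠ k := by
      rintro rfl
      exact hk ((h.mem_path_iff _).2 (.inr (List.getElem_mem _)))
    have h1 := findBag_lt hQ h.left_interval.sorted k h.left_pos
    have h2 := findBag_spec hQ h.right_interval.sorted k h0 hu
    rw [le_iff_lt_or_eq, or_iff_left hne, bagIndex]
    split_ifs with hb
    · rw [h2]; omega
    -- Here `k` is below `left[1]`. If it were below `right[u]` too, these two nodes would be
    -- comparable, and the upper one would be a common ancestor of both ends below the lowest one.
    · refine iff_of_true (fun hlt => ?_) (by omega)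
      have h3 := (findBag_spec hQ h.left_interval.sorted k one_pos (by omega)).2
        (show 1 ≤ (findBag Q left k).val by omega)
      rcases hF _ _ _ hlt.le h3.le with h4 | h4
      · exact h.not_le_start h0 hu (h4.trans (h.left_le (by omega)))
      · exact h.not_le_end one_pos (by omega) (h4.trans (h.right_le hu))

end IsMultidirPath

open Classical in
/-- The part of `U` at or below `b`. -/
noncomputable def below (U : Finset V) (b : V) : Finset V := U.filter fun k => b ≤ k

open Classical in
/-- The part of `U` that is not at or below `b`. -/
noncomputable def notBelow (U : Finset V) (b : V) : Finset V := U.filter fun k => ¬ b ≤ k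

@[simp] lemma mem_below {U : Finset V} {b k : V} : k ∈ below U b ↔ k ∈ U ∧ b ≤ k := by
  classical exact Finset.mem_filter

@[simp] lemma mem_notBelow {U : Finset V} {b k : V} : k ∈ notBelow U b ↔ k ∈ U ∧ ¬ b ≤ k := by
  classical exact Finset.mem_filter

lemma card_below_add_card_notBelow (U : Finset V) (b : V) :
    (below U b).card + (notBelow U b).card = U.card := by
  classical exact Finset.card_filter_add_card_filter_not _

/-- Cutting above `c` leaves at least `⌊|U|/d⌋` nodes on both sides. -/
def IsEven (U : Finset V) (d : ℕ) (c : V) : Prop :=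
  U.card / d ≤ (below U c).card ∧ (below U c).card ≤ U.card - U.card / d

/-- Cutting above `c` separates `i` from `j`. -/
def Separates (c i j : V) : Prop := (c ≤ i ∧ ¬ c ≤ j) ∨ (¬ c ≤ i ∧ c ≤ j)

open Classical in
/-- The part of `U` that contains `i` after cutting above `c`. -/
noncomputable def sideOf (U : Finset V) (i c : V) : Finset V :=
  if c ≤ i then below U c else notBelow U c

/-- `sep i j` is an even separator on the path between `i` and `j`, the first one from `i`
(unless the path is traversed from its ancestor `j`), if there is one. -/
structure IsEvenSeparatorRule (U : Finset V) (d : ℕ) (sep : V → V → Option (V × V)) : Prop where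
  even : ∀ i ∈ U, ∀ j ∈ U, ∀ e, sep i j = some e →
    e.1 ∈ U ∧ e.2 ∈ U ∧ e.1 ⋖ e.2 ∧ Separates e.2 i j ∧ IsEven U d e.2
  minimal : ∀ i ∈ U, ∀ j ∈ U, ∀ e, sep i j = some e → ¬ j < i → ∀ c ∈ U, Separates c i j →
    IsEven U d c → (sideOf U i e.2).card ≤ (sideOf U i c).card
  exhaustive : ∀ i ∈ U, ∀ j ∈ U, sep i j = none → ∀ c ∈ U, Separates c i j → ¬ IsEven U d c

lemma Separates.symm {c i j : V} (h : Separates c i j) : Separates c j i := by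
  unfold Separates at *; tauto

variable [DecidableEq V] {Q : V → V → Timed Bool}

/-- The initial entries `1` count the nodes of the path and the increments count the others;
together they count the side of `i` without repetition. The lower end of the edge at `t` is
`path[t]` on the ascending part and `path[t + 1]` on the descending one. -/
lemma IsMultidirPath.card_side (hQ : ∀ i j, (Q i j).val = true ↔ i < j)
    (hF : ∀ a b c : V, a ≤ c → b ≤ c → a ≤ b ∨ b ≤ a) {vs : List V} (hvs : vs.Nodup)
    {i j c : V} {left right path : List V} (h : IsMultidirPath vs i j c left right path) {t : ℕ}
    (ht : t + 1 < path.length) :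
    ((countBags Q path left right vs (List.replicate path.length 1)).val.take (t + 1)).sum =
      (sideOf vs.toFinset i
        (if t < left.length - 1 then path[t] else path[t + 1])).card := by
  have hlen := h.length_path
  have hl := h.left_pos
  rw [countBags_sum_take _ _ _ _ _ _ (by simp; omega)]
  have h1 : ((List.replicate path.length 1).take (t + 1)).sum = (path.take (t + 1)).length := by
    simp
  rw [h1, ← List.length_append]
  have hnd : (path.take (t + 1) ++
      vs.filter fun k => k ∉ path ∧ bagIndex Q left right k < t + 1).Nodup := by
    rw [List.nodup_append]
    refine ⟨h.nodup.sublist (List.take_sublist _ _), hvs.filter _, ?_⟩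
    rintro a ha b hb rfl
    simp only [List.mem_filter, decide_eq_true_eq] at hb
    exact hb.2.1 (List.mem_of_mem_take ha)
  rw [← List.toFinset_card_of_nodup hnd]
  congr 1
  ext k
  simp only [List.mem_toFinset, List.mem_append, List.mem_filter, decide_eq_true_eq]
  have hin : k ∈ path.take (t + 1) → k ∈ vs := fun hk =>
    h.mem_of_mem_path (List.mem_of_mem_take hk)
  by_cases hta : t < left.length - 1
  · have hp := h.getElem_left (s := t) (by omega) (by omega)
    rw [if_pos hta, sideOf, if_pos (by rw [hp]; exact h.left_le _), mem_below, List.mem_toFinset,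
      hp, h.left_le_iff hQ (by omega)]
    tauto
  · have hp := h.getElem_right (s := t + 1 - (left.length - 1)) (by omega) (by omega)
    have hp' : path[t + 1] = right[t + 1 - (left.length - 1)] := by
      rw [← hp]; congr 1; omega
    rw [if_neg hta, sideOf, if_neg (by rw [hp']; exact h.not_le_start (by omega) (by omega)),
      mem_notBelow, List.mem_toFinset, hp', h.not_right_le_iff hQ hF (by omega) (by omega),
      show left.length - 1 + (t + 1 - (left.length - 1)) = t + 1 by omega]
    tauto

end EvenSeparator

/-! ### The search finds the first even edge on the path -/

section FindEvenSeparator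

open Timed

variable {V : Type} [PartialOrder V]

/-- The two bounds in `IsEven` add up to `|U|`, so it does not matter which side is measured. -/
lemma isEven_iff_card_sideOf (U : Finset V) (d : ℕ) (i c : V) :
    IsEven U d c ↔ U.card / d ≤ (sideOf U i c).card ∧
      (sideOf U i c).card ≤ U.card - U.card / d := by
  have h := card_below_add_card_notBelow U c
  have := Nat.div_le_self U.card d
  unfold IsEven sideOf
  split_ifs
  · rfl
  · omega

namespace IsMultidirPath

variable {vs : List V} {i j c : V} {left right path : List V}

/-- An ancestor of just one end is comparable with the top node and not above it, hence it lies
strictly inside one of the two directed parts. -/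
lemma exists_index (hF : ∀ a b c : V, a ≤ c → b ≤ c → a ≤ b ∨ b ≤ a)
    (h : IsMultidirPath vs i j c left right path) {x : V} (hx : x ∈ vs) (hs : Separates x i j) :
    ∃ t, ∃ ht : t + 1 < path.length,
      (if t < left.length - 1 then path[t] else path[t + 1]) = x := by
  have hlen := h.length_path
  have hl := h.left_pos
  have hr := h.right_pos
  rcases hs with ⟨h1, h2⟩ | ⟨h1, h2⟩
  · have hcx : c ≤ x := (hF _ _ _ h1 h.top_le_start).resolve_left
      fun h' => h2 (h'.trans h.top_le_end)
    obtain ⟨s, hs, rfl⟩ := List.mem_iff_getElem.1 ((h.left_interval.mem_iff x).2 ⟨hx, hcx, h1⟩)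
    have hs0 : s ≠ 0 := by
      rintro rfl
      rw [h.left_zero] at h2
      exact h2 h.top_le_end
    refine ⟨left.length - 1 - s, by omega, ?_⟩
    rw [if_pos (by omega), h.getElem_left (by omega)]
    congr 1; omega
  · have hcx : c ≤ x := (hF _ _ _ h2 h.top_le_end).resolve_left
      fun h' => h1 (h'.trans h.top_le_start)
    obtain ⟨s, hs, rfl⟩ := List.mem_iff_getElem.1 ((h.right_interval.mem_iff x).2 ⟨hx, hcx, h2⟩)
    have hs0 : s ≠ 0 := by
      rintro rfl
      rw [h.right_zero] at h1
      exact h1 h.top_le_start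
    refine ⟨left.length - 1 + s - 1, by omega, ?_⟩
    rw [if_neg (by omega), ← h.getElem_right hs (by omega)]
    congr 1; omega

lemma edge_spec (hconv : ∀ a ∈ vs, ∀ b ∈ vs, ∀ k, a ≤ k → k ≤ b → k ∈ vs)
    (h : IsMultidirPath vs i j c left right path) {t : ℕ} (ht : t + 1 < path.length)
    {e : V × V}
    (he : e = if t < left.length - 1 then (path[t + 1], path[t]) else (path[t], path[t + 1])) :
    e.1 ∈ vs ∧ e.2 ∈ vs ∧ e.1 ⋖ e.2 ∧ Separates e.2 i j := by
  have hlen := h.length_path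
  subst he
  split_ifs with hta
  · refine ⟨h.mem_of_mem_path (List.getElem_mem _), h.mem_of_mem_path (List.getElem_mem _), ?_, ?_⟩
    · simp only
      rw [h.getElem_left (by omega), h.getElem_left (by omega)]
      have := h.left_interval.covBy hconv (s := left.length - 1 - (t + 1)) (by omega)
      convert this using 2
      omega
    · simp only
      rw [h.getElem_left (by omega)]
      exact .inl ⟨h.left_le _, h.not_le_end (by omega) _⟩
  · have h1 := h.getElem_right (s := t - (left.length - 1)) (by omega) (by omega)
    have h2 := h.getElem_right (s := t - (left.length - 1) + 1) (by omega) (by omega)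
    have e1 : path[t] = right[t - (left.length - 1)] := by
      rw [← h1]; congr 1; omega
    have e2 : path[t + 1] = right[t - (left.length - 1) + 1] := by
      rw [← h2]; congr 1; omega
    refine ⟨h.mem_of_mem_path (List.getElem_mem _), h.mem_of_mem_path (List.getElem_mem _), ?_, ?_⟩
    · simp only
      rw [e1, e2]
      exact h.right_interval.covBy hconv (by omega)
    · simp only
      rw [e2]
      exact .inr ⟨h.not_le_start (by omega) _, h.right_le _⟩

end IsMultidirPath

variable [DecidableEq V] {Q : V → V → Timed Bool}

lemma findEvenSeparator_val {d : ℕ} {vs : List V} {i j i' j' c : V} {left right : List V}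
    (h : IsMultidirPath vs i' j' c left right (multidirPath Q vs i j).val.1)
    (ha : (multidirPath Q vs i j).val.2 + 1 = left.length) :
    (findEvenSeparator Q d vs i j).val =
      (scanPath vs.length d (left.length - 1) 0 0 (multidirPath Q vs i j).val.1
        (countBags Q (multidirPath Q vs i j).val.1 left right vs
          (List.replicate (multidirPath Q vs i j).val.1.length 1)).val).val := by
  have hval : (findEvenSeparator Q d vs i j).val =
      (scanPath vs.length d (multidirPath Q vs i j).val.2 0 0 (multidirPath Q vs i j).val.1
        (countBags Q (multidirPath Q vs i j).val.1
          ((multidirPath Q vs i j).val.1.take ((multidirPath Q vs i j).val.2 + 1)).reverse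
          ((multidirPath Q vs i j).val.1.drop (multidirPath Q vs i j).val.2) vs
          (List.replicate (multidirPath Q vs i j).val.1.length 1)).val).val := rfl
  have e1 : ((multidirPath Q vs i j).val.1.take ((multidirPath Q vs i j).val.2 + 1)).reverse =
      left := by
    rw [ha, h.path_eq, List.take_left' (by simp), List.reverse_reverse]
  have e2 : (multidirPath Q vs i j).val.1.drop (multidirPath Q vs i j).val.2 = right := by
    have hl := h.left_pos
    have hl0 := h.left_zero
    have hr := h.right_eq
    have ha' : (multidirPath Q vs i j).val.2 = left.length - 1 := by omega
    rw [ha', h.path_eq]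
    cases left with
    | nil => simp at hl
    | cons x l =>
      simp only [List.getElem_cons_zero] at hl0
      subst hl0
      rw [List.reverse_cons, List.append_assoc, List.drop_left' (by simp)]
      exact hr.symm
  rw [hval, e1, e2, show (multidirPath Q vs i j).val.2 = left.length - 1 by omega]

/-- The scan visits every edge that separates the ends, and prefix sums of bag sizes do not
decrease, so the first even edge is the one with the smallest side at the start. -/
lemma isEvenSeparatorRule_findEvenSeparator (hQ : ∀ i j, (Q i j).val = true ↔ i < j)
    (hF : ∀ a b c : V, a ≤ c → b ≤ c → a ≤ b ∨ b ≤ a) (d : ℕ) {vs : List V} (hvs : vs.Nodup)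
    (hU : IsSubtree vs.toFinset) :
    IsEvenSeparatorRule vs.toFinset d fun i j => (findEvenSeparator Q d vs i j).val := by
  have hconv : ∀ a ∈ vs, ∀ b ∈ vs, ∀ k, a ≤ k → k ≤ b → k ∈ vs := by
    simpa using hU.convex
  have hcard : vs.toFinset.card = vs.length := List.toFinset_card_of_nodup hvs
  -- Everything is shown for the ends `i'`, `j'` in the order of traversal. Separation is symmetric;
  -- minimality is transferred only when the ends are not exchanged.
  have key : ∀ i ∈ vs, ∀ j ∈ vs, ∃ i' j', ((i' = i ∧ j' = j) ∨ (i' = j ∧ j' = i ∧ j < i)) ∧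
      (((findEvenSeparator Q d vs i j).val = none ∧
        ∀ c ∈ vs, Separates c i' j' → ¬ IsEven vs.toFinset d c) ∨
      ∃ e, (findEvenSeparator Q d vs i j).val = some e ∧
        (e.1 ∈ vs ∧ e.2 ∈ vs ∧ e.1 ⋖ e.2 ∧ Separates e.2 i' j') ∧ IsEven vs.toFinset d e.2 ∧
        ∀ c ∈ vs, Separates c i' j' → IsEven vs.toFinset d c →
          (sideOf vs.toFinset i' e.2).card ≤ (sideOf vs.toFinset i' c).card) := by
    intro i hi j hj
    obtain ⟨i', j', c, left, right, hij, h, ha⟩ := multidirPath_spec hQ hF hvs hU hi hj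
    refine ⟨i', j', hij, ?_⟩
    have hval := findEvenSeparator_val (d := d) h ha
    rw [hval]
    set path := (multidirPath Q vs i j).val.1 with hpath
    set bags := (countBags Q path left right vs (List.replicate path.length 1)).val with hbags
    have hbl : path.length = bags.length := by
      rw [hbags, countBags_length, List.length_replicate]
    have hside : ∀ t (ht : t + 1 < path.length), (bags.take (t + 1)).sum =
        (sideOf vs.toFinset i' (if t < left.length - 1 then path[t] else path[t + 1])).card :=
      fun t ht => h.card_side hQ hF hvs ht
    have heven : ∀ t (ht : t + 1 < path.length),
        (vs.length / d ≤ 0 + (bags.take (t + 1)).sum ∧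
          0 + (bags.take (t + 1)).sum ≤ vs.length - vs.length / d) ↔
        IsEven vs.toFinset d (if t < left.length - 1 then path[t] else path[t + 1]) := by
      intro t ht
      rw [isEven_iff_card_sideOf _ _ i', ← hside t ht, hcard, zero_add]
    rcases scanPath_spec vs.length d (left.length - 1) 0 0 path bags hbl with
      ⟨h1, h2⟩ | ⟨t, ht, h1, h2, h3⟩
    · left
      refine ⟨h1, fun x hx hs he => ?_⟩
      obtain ⟨t, ht, rfl⟩ := h.exists_index hF hx hs
      exact h2 t ht ((heven t ht).2 he)
    · right
      rw [zero_add] at h1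
      refine ⟨_, h1, h.edge_spec hconv ht rfl, ?_⟩
      have he2 : (if t < left.length - 1 then (path[t + 1], path[t])
          else (path[t], path[t + 1])).2 =
          if t < left.length - 1 then path[t] else path[t + 1] := by
        split_ifs <;> rfl
      rw [he2]
      refine ⟨(heven t ht).1 h2, fun x hx hs he => ?_⟩
      obtain ⟨t', ht', rfl⟩ := h.exists_index hF hx hs
      rw [← hside t ht, ← hside t' ht']
      have htt : t ≤ t' := by
        by_contra! hlt
        exact h3 t' hlt ((heven t' ht').2 he)
      have hcat : bags.take (t' + 1) = bags.take (t + 1) ++ (bags.drop (t + 1)).take (t' - t) := by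
        rw [← List.take_add]; congr 1; omega
      rw [hcat, List.sum_append]
      exact Nat.le_add_right _ _
  constructor
  · intro i hi j hj e he
    rw [List.mem_toFinset] at hi hj
    obtain ⟨i', j', hij, ⟨h, -⟩ | ⟨e', h1, h2, h3, -⟩⟩ := key i hi j hj
    · simp [h] at he
    · obtain rfl : e' = e := by simpa [h1] using he
      refine ⟨by simpa using h2.1, by simpa using h2.2.1, h2.2.2.1, ?_, h3⟩
      rcases hij with ⟨rfl, rfl⟩ | ⟨rfl, rfl, -⟩
      · exact h2.2.2.2
      · exact h2.2.2.2.symm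
  · intro i hi j hj e he hji c hc hs hev
    rw [List.mem_toFinset] at hi hj hc
    obtain ⟨i', j', hij, ⟨h, -⟩ | ⟨e', h1, -, -, h2⟩⟩ := key i hi j hj
    · simp [h] at he
    · obtain rfl : e' = e := by simpa [h1] using he
      rcases hij with ⟨rfl, rfl⟩ | ⟨rfl, rfl, h'⟩
      · exact h2 c hc hs hev
      · exact absurd h' hji
  · intro i hi j hj he c hc hs
    rw [List.mem_toFinset] at hi hj hc
    obtain ⟨i', j', hij, ⟨-, h⟩ | ⟨e', h1, -⟩⟩ := key i hi j hj
    · rcases hij with ⟨rfl, rfl⟩ | ⟨rfl, rfl, -⟩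
      · exact h c hc hs
      · exact h c hc hs.symm
    · simp [h1] at he

lemma findEvenSeparator_time_le (hQ : ∀ i j, (Q i j).val = true ↔ i < j)
    (hT : ∀ i j, (Q i j).time = 1)
    (hF : ∀ a b c : V, a ≤ c → b ≤ c → a ≤ b ∨ b ≤ a) (d : ℕ) {vs : List V} (hvs : vs.Nodup)
    (hU : IsSubtree vs.toFinset) {i j : V} (hi : i ∈ vs) (hj : j ∈ vs) :
    (findEvenSeparator Q d vs i j).time ≤
      13 * vs.length * Nat.clog 2 vs.length + 19 * vs.length + 7 := by
  have h1 := multidirPath_time_le hQ hT hF hvs hU hi hj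
  obtain ⟨i', j', c, left, right, hij, h, ha⟩ := multidirPath_spec hQ hF hvs hU hi hj
  have hp := h.length_path_le
  set path := (multidirPath Q vs i j).val.1 with hpath
  set a := (multidirPath Q vs i j).val.2 with hadef
  have hb : ∀ l : List V, l.length ≤ path.length → ∀ k,
      (findBag Q l k).time ≤ 2 * Nat.clog 2 vs.length := fun l hl k =>
    (findBag_time_le hT l k).trans (Nat.mul_le_mul_left 2 (Nat.clog_mono_right 2 (hl.trans hp)))
  have h2 := countBags_time_le Q path (path.take (a + 1)).reverse (path.drop a)
    (hb _ (by simp)) (hb _ (by simp)) vs (List.replicate path.length 1)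
  have h3 := scanPath_time_le vs.length d a 0 0 path (countBags Q path
    (path.take (a + 1)).reverse (path.drop a) vs (List.replicate path.length 1)).val
  have htime : (findEvenSeparator Q d vs i j).time = (multidirPath Q vs i j).time +
      (3 * path.length + ((countBags Q path (path.take (a + 1)).reverse (path.drop a) vs
        (List.replicate path.length 1)).time + (scanPath vs.length d a 0 0 path (countBags Q path
          (path.take (a + 1)).reverse (path.drop a) vs
            (List.replicate path.length 1)).val).time)) := rfl
  rw [htime]
  -- Apart from the path, the cost consists of copying `3 * path.length` entries, two binary
  -- searches and a loop step per node, and the scan.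
  nlinarith

end FindEvenSeparator

/-! ### Heavy and light branches at a node -/

section Branches

variable {V : Type} [PartialOrder V] {U : Finset V} {d : ℕ} {v : V}

lemma isSubtree_below (hU : IsSubtree U) {b : V} (hb : b ∈ U) : IsSubtree (below U b) where
  exists_root := ⟨b, by simp [hb], fun k hk => (mem_below.1 hk).2⟩
  convex a ha c hc k hak hkc := by
    rw [mem_below] at *
    exact ⟨hU.convex a ha.1 c hc.1 k hak hkc, ha.2.trans hak⟩

lemma isSubtree_notBelow (hU : IsSubtree U) {a b : V} (ha : a ∈ U) (hab : a < b) :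
    IsSubtree (notBelow U b) where
  exists_root := by
    obtain ⟨r, hr, hr'⟩ := hU.exists_root
    refine ⟨r, mem_notBelow.2 ⟨hr, fun h => ?_⟩, fun k hk => hr' k (mem_notBelow.1 hk).1⟩
    exact (hab.trans_le (h.trans (hr' a ha))).false
  convex a ha c hc k hak hkc := by
    rw [mem_notBelow] at *
    exact ⟨hU.convex a ha.1 c hc.1 k hak hkc, fun h => hc.2 (h.trans hkc)⟩

lemma card_below_le (U : Finset V) (b : V) : (below U b).card ≤ U.card := by
  have := card_below_add_card_notBelow U b
  omega

open Classical in
/-- The neighbours of `v` in `U`. -/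
noncomputable def neighbors (U : Finset V) (v : V) : Finset V := U.filter fun u => v ⋖ u ∨ u ⋖ v

lemma mem_neighbors {u : V} : u ∈ neighbors U v ↔ u ∈ U ∧ (v ⋖ u ∨ u ⋖ v) := by
  classical exact Finset.mem_filter

lemma neighbors_mono {U' : Finset V} (h : U' ⊆ U) (v : V) : neighbors U' v ⊆ neighbors U v := by
  intro u hu
  rw [mem_neighbors] at *
  exact ⟨h hu.1, hu.2⟩

open Classical in
/-- The nodes of `U` that lie in a branch at `v` with at least `⌊|U|/d⌋` nodes. -/
noncomputable def heavy (U : Finset V) (d : ℕ) (v : V) : Finset V :=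
  U.filter fun k => (∃ c ∈ U, v ⋖ c ∧ c ≤ k ∧ U.card / d ≤ (below U c).card) ∨
    (¬ v ≤ k ∧ U.card / d ≤ (notBelow U v).card)

lemma mem_heavy {k : V} : k ∈ heavy U d v ↔ k ∈ U ∧
    ((∃ c ∈ U, v ⋖ c ∧ c ≤ k ∧ U.card / d ≤ (below U c).card) ∨
      (¬ v ≤ k ∧ U.card / d ≤ (notBelow U v).card)) := by
  classical exact Finset.mem_filter

lemma heavy_subset : heavy U d v ⊆ U := fun _ hk => (mem_heavy.1 hk).1

variable [Finite V]

lemma exists_child {k : V} (h : v < k) : ∃ c, v ⋖ c ∧ c ≤ k := exists_covBy_le_of_lt h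

lemma IsSubtree.exists_parent (hU : IsSubtree U) (hv : v ∈ U) {k : V} (hk : k ∈ U)
    (hvk : ¬ v ≤ k) : ∃ p ∈ U, p ⋖ v := by
  obtain ⟨r, hr, hr'⟩ := hU.exists_root
  have hrv : r < v := lt_of_le_of_ne (hr' v hv) (by rintro rfl; exact hvk (hr' k hk))
  obtain ⟨p, hrp, hpv⟩ := exists_le_covBy_of_lt hrv
  exact ⟨p, hU.convex r hr v hv p hrp hpv.le, hpv⟩

/-- An edge that cuts `i` off from `v` lies in the branch of `i` at `v` or joins it to `v`, so this
branch contains the whole side of `i`. Consequently no even edge lies between `v` and a light node.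
-/
lemma mem_heavy_of_le (hF : ∀ a b c : V, a ≤ c → b ≤ c → a ≤ b ∨ b ≤ a) (hU : IsSubtree U)
    (hv : v ∈ U) {i b : V} (hi : i ∈ U) (hb : b ∈ U) (hbi : b ≤ i) (hbv : ¬ b ≤ v)
    (hq : U.card / d ≤ (below U b).card) : i ∈ heavy U d v := by
  refine mem_heavy.2 ⟨hi, ?_⟩
  by_cases hvb : v ≤ b
  · obtain ⟨c, hc, hcb⟩ := exists_child (lt_of_le_not_ge hvb hbv)
    refine .inl ⟨c, hU.convex v hv b hb c hc.le hcb, hc, hcb.trans hbi, hq.trans ?_⟩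
    exact Finset.card_le_card fun k hk => mem_below.2
      ⟨(mem_below.1 hk).1, hcb.trans (mem_below.1 hk).2⟩
  · refine .inr ⟨fun h => (hF _ _ _ h hbi).elim hvb hbv, hq.trans ?_⟩
    exact Finset.card_le_card fun k hk => mem_notBelow.2
      ⟨(mem_below.1 hk).1, fun h => (hF _ _ _ h (mem_below.1 hk).2).elim hvb hbv⟩

omit [Finite V] in
-- The counterpart for an edge that is passed upwards on the way from `v` to `i`.
lemma mem_heavy_of_not_le {i b : V} (hi : i ∈ U) (hbi : ¬ b ≤ i) (hbv : b ≤ v)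
    (hq : U.card / d ≤ (notBelow U b).card) : i ∈ heavy U d v := by
  refine mem_heavy.2 ⟨hi, .inr ⟨fun h => hbi (hbv.trans h), hq.trans ?_⟩⟩
  exact Finset.card_le_card fun k hk => mem_notBelow.2
    ⟨(mem_notBelow.1 hk).1, fun h => (mem_notBelow.1 hk).2 (hbv.trans h)⟩

omit [Finite V] in
lemma IsEven.le_notBelow {b : V} (h : IsEven U d b) : U.card / d ≤ (notBelow U b).card := by
  have := card_below_add_card_notBelow U b
  have := Nat.div_le_self U.card d
  have := h.2
  omega

variable {sep : V → V → Option (V × V)}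

/-- No edge between a light `i` and `v` is even, so the first even edge towards `j` is the first one
behind `v`. The path is not traversed from `j`, since an ancestor `j` of `i` would put `i` in the
heavy branch at `c`. -/
lemma IsEvenSeparatorRule.eq_of_mem_below
    (hF : ∀ a b c : V, a ≤ c → b ≤ c → a ≤ b ∨ b ≤ a) (hU : IsSubtree U)
    (hsep : IsEvenSeparatorRule U d sep) (hv : v ∈ U) {i j c : V} (hi : i ∈ U)
    (hi' : i ∉ heavy U d v) (hc : c ∈ U) (hvc : v ⋖ c) (hj : j ∈ U) (hcj : c ≤ j)
    (hev : IsEven U d c) : ∃ e, sep i j = some e ∧ e.2 = c := by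
  have hci : ¬ c ≤ i := fun h => hi' (mem_heavy.2 ⟨hi, .inl ⟨c, hc, hvc, h, hev.1⟩⟩)
  have hs : Separates c i j := .inr ⟨hci, hcj⟩
  have hji : ¬ j < i := fun h => hci (hcj.trans h.le)
  rcases he : sep i j with _ | e
  · exact absurd hev (hsep.exhaustive i hi j hj he c hc hs)
  refine ⟨e, rfl, ?_⟩
  obtain ⟨-, hb, -, hsb, hevb⟩ := hsep.even i hi j hj e he
  have hmin := hsep.minimal i hi j hj e he hji c hc hs hev
  rcases hsb with ⟨h1, h2⟩ | ⟨h1, h2⟩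
  · exact absurd (mem_heavy_of_le hF hU hv hi hb h1
      (fun h => h2 (h.trans (hvc.le.trans hcj))) hevb.1) hi'
  · have hbv : ¬ e.2 ≤ v := fun h => hi' (mem_heavy_of_not_le hi h1 h hevb.le_notBelow)
    rcases hF _ _ _ h2 hcj with h3 | h3
    · refine h3.eq_or_lt.resolve_right fun h4 => ?_
      rcases hF _ _ _ h4.le hvc.le with h5 | h5
      · exact hbv h5
      · exact hvc.2 (lt_of_le_not_ge h5 hbv) h4
    -- If the edge found lies below `c`, minimality forces the two cuts to have equal sizes, hence
    -- to coincide.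
    · rw [sideOf, if_neg h1, sideOf, if_neg hci] at hmin
      have e1 := card_below_add_card_notBelow U e.2
      have e2 := card_below_add_card_notBelow U c
      have hsub : below U e.2 ⊆ below U c := fun k hk => mem_below.2
        ⟨(mem_below.1 hk).1, h3.trans (mem_below.1 hk).2⟩
      have heq := Finset.eq_of_subset_of_card_le hsub (by omega)
      have hcm : c ∈ below U e.2 := by rw [heq]; exact mem_below.2 ⟨hc, le_rfl⟩
      exact le_antisymm (mem_below.1 hcm).2 h3

/-- Here `j` may be an ancestor of `i`, and then the path is traversed from `j`. The edge found may
thus be anywhere in the branch above `v` (or at `v`); it suffices that it is not strictly below `v`.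
-/
lemma IsEvenSeparatorRule.not_lt_of_mem_notBelow
    (hF : ∀ a b c : V, a ≤ c → b ≤ c → a ≤ b ∨ b ≤ a) (hU : IsSubtree U)
    (hsep : IsEvenSeparatorRule U d sep) (hv : v ∈ U) {i j : V} (hi : i ∈ U)
    (hi' : i ∉ heavy U d v) (hj : j ∈ U) (hvj : ¬ v ≤ j)
    (hev : IsEven U d v) : ∃ e, sep i j = some e ∧ ¬ v < e.2 := by
  have hvi : v ≤ i := by
    by_contra h
    exact hi' (mem_heavy_of_not_le hi h le_rfl hev.le_notBelow)
  rcases he : sep i j with _ | e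
  · exact absurd hev (hsep.exhaustive i hi j hj he v hv (.inl ⟨hvi, hvj⟩))
  refine ⟨e, rfl, fun hlt => ?_⟩
  obtain ⟨-, hb, -, hsb, hevb⟩ := hsep.even i hi j hj e he
  rcases hsb with ⟨h1, h2⟩ | ⟨h1, h2⟩
  · exact hi' (mem_heavy_of_le hF hU hv hi hb h1 hlt.not_ge hevb.1)
  · exact hvj (hlt.le.trans h2)

omit [Finite V] in
/-- A centroid of `U`. -/
lemma IsSubtree.exists_centroid (hU : IsSubtree U) : ∃ v ∈ U,
    (∀ c ∈ U, v ⋖ c → 2 * (below U c).card ≤ U.card) ∧ 2 * (notBelow U v).card ≤ U.card := by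
  classical
  obtain ⟨r, hr, hr'⟩ := hU.exists_root
  have hpos : 0 < U.card := Finset.card_pos.2 ⟨r, hr⟩
  have hne : (U.filter fun v => U.card < 2 * (below U v).card).Nonempty := by
    refine ⟨r, Finset.mem_filter.2 ⟨hr, ?_⟩⟩
    have : below U r = U := by
      ext k; rw [mem_below]; exact ⟨fun h => h.1, fun h => ⟨h, hr' k h⟩⟩
    rw [this]; omega
  -- A lowest node with more than half of `U` at or below it.
  obtain ⟨v, hv, hmin⟩ := Finset.exists_min_image _ (fun v => (below U v).card) hne
  rw [Finset.mem_filter] at hv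
  refine ⟨v, hv.1, fun c hc hvc => ?_, ?_⟩
  · by_contra! hlt
    have h1 := hmin c (Finset.mem_filter.2 ⟨hc, hlt⟩)
    have h2 : (below U c).card < (below U v).card := by
      refine Finset.card_lt_card ⟨fun k hk => mem_below.2
        ⟨(mem_below.1 hk).1, hvc.le.trans (mem_below.1 hk).2⟩, fun h => ?_⟩
      have := h (mem_below.2 ⟨hv.1, le_rfl⟩)
      exact hvc.lt.not_ge (mem_below.1 this).2
    omega
  · have := card_below_add_card_notBelow U v
    omega

/-- With `q = ⌊m/d⌋`, the light nodes number at most `D(q - 1) + 1`: at most `D` light branches with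
at most `q - 1` nodes each, and `v`. For `D < d` this leaves about `(d - D) m / d` heavy nodes; for
`D = d` it still leaves one, and with it a whole heavy branch. -/
lemma IsSubtree.card_heavy (hU : IsSubtree U) (hv : v ∈ U) (hm : 2 ≤ U.card) (hd : 2 ≤ d)
    (hD : (neighbors U v).card ≤ d) :
    (d + 1 - (neighbors U v).card) * U.card ≤ 4 * d * (heavy U d v).card := by
  classical
  set q := U.card / d with hq
  set D := (neighbors U v).card with hDdef
  set br : V → Finset V := fun u => if v ⋖ u then below U u else notBelow U v with hbr
  have hcover : (U.erase v) \ heavy U d v ⊆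
      ((neighbors U v).filter fun u => (br u).card < q).biUnion br := by
    intro k hk
    rw [Finset.mem_sdiff, Finset.mem_erase] at hk
    obtain ⟨⟨hkv, hkU⟩, hkh⟩ := hk
    rw [Finset.mem_biUnion]
    by_cases hvk : v ≤ k
    · obtain ⟨c, hc, hck⟩ := exists_child (lt_of_le_of_ne hvk hkv.symm)
      have hcU := hU.convex v hv k hkU c hc.le hck
      refine ⟨c, Finset.mem_filter.2 ⟨mem_neighbors.2 ⟨hcU, .inl hc⟩, ?_⟩, ?_⟩
      · simp only [hbr, if_pos hc]
        by_contra! h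
        exact hkh (mem_heavy.2 ⟨hkU, .inl ⟨c, hcU, hc, hck, h⟩⟩)
      · simp only [hbr, if_pos hc]
        exact mem_below.2 ⟨hkU, hck⟩
    · obtain ⟨p, hp, hpv⟩ := hU.exists_parent hv hkU hvk
      have hn : ¬ v ⋖ p := fun h => (h.lt.trans hpv.lt).false
      refine ⟨p, Finset.mem_filter.2 ⟨mem_neighbors.2 ⟨hp, .inr hpv⟩, ?_⟩, ?_⟩
      · simp only [hbr, if_neg hn]
        by_contra! h
        exact hkh (mem_heavy.2 ⟨hkU, .inr ⟨hvk, h⟩⟩)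
      · simp only [hbr, if_neg hn]
        exact mem_notBelow.2 ⟨hkU, hvk⟩
  have h1 : U.card ≤ (heavy U d v).card + D * (q - 1) + 1 := by
    have e1 := Finset.card_le_card hcover
    have e2 : (((neighbors U v).filter fun u => (br u).card < q).biUnion br).card ≤
        ((neighbors U v).filter fun u => (br u).card < q).card * (q - 1) := by
      refine Finset.card_biUnion_le_card_mul _ _ _ fun u hu => ?_
      have := (Finset.mem_filter.1 hu).2
      omega
    have e3 : ((neighbors U v).filter fun u => (br u).card < q).card * (q - 1) ≤ D * (q - 1) :=
      Nat.mul_le_mul_right _ (Finset.card_filter_le _ _)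
    have e4 := Finset.le_card_sdiff (heavy U d v) (U.erase v)
    rw [Finset.card_erase_of_mem hv] at e4
    omega
  have h2 : (heavy U d v).card = 0 ∨ q ≤ (heavy U d v).card := by
    rcases Finset.eq_empty_or_nonempty (heavy U d v) with h | ⟨k, hk⟩
    · exact .inl (by rw [h]; rfl)
    right
    obtain ⟨hkU, ⟨c, hc, hvc, hck, hcq⟩ | ⟨hvk, hvq⟩⟩ := mem_heavy.1 hk
    · refine hcq.trans (Finset.card_le_card fun x hx => mem_heavy.2 ⟨(mem_below.1 hx).1, .inl ?_⟩)
      exact ⟨c, hc, hvc, (mem_below.1 hx).2, hcq⟩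
    · exact hvq.trans (Finset.card_le_card fun x hx => mem_heavy.2
        ⟨(mem_notBelow.1 hx).1, .inr ⟨(mem_notBelow.1 hx).2, hvq⟩⟩)
  have h3 : q * d ≤ U.card := Nat.div_mul_le_self _ _
  have h4 : U.card < (q + 1) * d := by
    rw [mul_comm]; exact Nat.lt_mul_div_succ _ (by omega)
  clear_value q D
  generalize (heavy U d v).card = H at *
  generalize U.card = m at *
  obtain ⟨x, rfl⟩ := Nat.exists_eq_add_of_le hD
  have hx : D + x + 1 - D = x + 1 := by omega
  rw [hx]
  rcases Nat.eq_zero_or_pos q with rfl | hq0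
  · simp only [Nat.zero_sub, mul_zero, add_zero] at h1
    nlinarith
  obtain ⟨q, rfl⟩ : ∃ q', q = q' + 1 := ⟨q - 1, by omega⟩
  simp only [Nat.add_sub_cancel] at h1
  rcases Nat.eq_zero_or_pos D with rfl | hD0
  · simp only [zero_mul, add_zero, zero_add] at h1 ⊢
    nlinarith
  -- With `d = D + x`: multiply `h1` by `d` and use `D (q + 1) d ≤ D m`, where `q` now denotes
  -- `⌊m/d⌋ - 1`. The surplus `d` is absorbed because `D ≥ 1`.
  have h5 : x * m ≤ (D + x) * H := by
    have : (D + x) * m ≤ (D + x) * H + D * (q * (D + x)) + (D + x) := by nlinarith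
    have : D * (q * (D + x)) + D * (D + x) ≤ D * m := by nlinarith
    nlinarith
  rcases Nat.eq_zero_or_pos x with rfl | hx0
  · simp only [add_zero, zero_add, one_mul] at *
    have : q + 1 ≤ H := by
      rcases h2 with rfl | h2
      · nlinarith
      · exact h2
    nlinarith
  · nlinarith

end Branches

/-! ### Real inequalities for the two potentials -/

section Potential

/-- The potential `m log m` of a tree with `m` nodes. -/
noncomputable def mulLogSelf (m : ℕ) : ℝ := m * Real.log m

lemma mulLogSelf_nonneg (m : ℕ) : 0 ≤ mulLogSelf m :=
  mul_nonneg (Nat.cast_nonneg m) (Real.log_natCast_nonneg m)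

/-- Splitting off `a` nodes gains `a log ((a + b) / a)`; what the other part gains is given away. -/
lemma mulLogSelf_add_le (a b : ℕ) :
    mulLogSelf a + mulLogSelf b + a * (Real.log (a + b : ℕ) - Real.log a) ≤
      mulLogSelf (a + b) := by
  unfold mulLogSelf
  have h : (b : ℝ) * Real.log b ≤ b * Real.log (a + b : ℕ) := by
    rcases Nat.eq_zero_or_pos b with rfl | hb
    · simp
    · refine mul_le_mul_of_nonneg_left (Real.log_le_log (by exact_mod_cast hb) ?_)
        (Nat.cast_nonneg b)
      exact_mod_cast Nat.le_add_left b a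
  push_cast at *
  nlinarith

/-- The part of the potential of a star that measures the expected time for which its heavy branches
resist. Here `u` is the size of the branch above the centre and `D` is the degree of the centre. -/
noncomputable def starLevel (d M u D : ℕ) : ℝ :=
  Real.log (1 + u * d / M) - Real.log (d + 1 - D)

/-- The potential of a tree with `m` nodes that was a star with `M` nodes and level `g`. -/
noncomputable def starPotential (d M : ℕ) (g : ℝ) (m u D : ℕ) : ℝ :=
  mulLogSelf m + 1 / 1024 * M * (starLevel d M u D - g) +
    1 / 16 * (M / 2 - (m - u)) * Real.log d

lemma div_le_log_sub_log {x y : ℝ} (hx : 0 < x) (hy : 0 < y) :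
    (x - y) / x ≤ Real.log x - Real.log y := by
  have h := Real.one_sub_inv_le_log_of_pos (div_pos hx hy)
  rw [Real.log_div hx.ne' hy.ne', inv_div] at h
  rw [sub_div, div_self hx.ne']
  exact h

lemma log_succ_sub_le {d D D' : ℕ} (hD : D' ≤ D) (hd : D ≤ d) :
    Real.log (d + 1 - D : ℝ) ≤ Real.log (d + 1 - D' : ℝ) := by
  have h1 : (D' : ℝ) ≤ D := by exact_mod_cast hD
  have h2 : (D : ℝ) ≤ d := by exact_mod_cast hd
  exact Real.log_le_log (by linarith) (by linarith)

/-- A cut in the branch above the centre keeps `m - u`, hence the last term of the potential. The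
first bound comes from `m log m`, the second from the fall of `log (1 + ud/M)`. -/
lemma starPotential_drop_above {d M m u D D' s : ℕ} {g : ℝ} (hM : 0 < M) (hs : 0 < s)
    (hu : 3 * (u + s) ≤ 2 * (m + s)) (hD : D' ≤ D) (hd : D ≤ d) :
    starPotential d M g m u D' + mulLogSelf s + s / 3 ≤
        starPotential d M g (m + s) (u + s) D ∧
      starPotential d M g m u D' + mulLogSelf s +
          1 / 1024 * (s * d / (1 + (u + s : ℕ) * d / M)) ≤
        starPotential d M g (m + s) (u + s) D := by
  have hM' : (0 : ℝ) < M := by exact_mod_cast hM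
  have hs' : (0 : ℝ) < s := by exact_mod_cast hs
  have h1 := mulLogSelf_add_le s m
  have h2 := log_succ_sub_le hD hd
  have hA' : (0 : ℝ) < 1 + u * d / M := by positivity
  have hA : (0 : ℝ) < 1 + (u + s : ℕ) * d / M := by positivity
  have h3 := div_le_log_sub_log hA hA'
  have h4 : (1 + (u + s : ℕ) * d / M - (1 + u * d / M) : ℝ) = s * d / M := by
    push_cast; ring
  rw [h4] at h3
  have h5 : (0 : ℝ) ≤ s * d / M / (1 + (u + s : ℕ) * d / M) := by positivity
  have h6 : (1 : ℝ) / 3 ≤ Real.log (s + m : ℕ) - Real.log s := by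
    have hx : (0 : ℝ) < (s + m : ℕ) := by positivity
    have h7 := div_le_log_sub_log hx hs'
    refine le_trans ?_ h7
    rw [div_le_div_iff₀ (by norm_num) hx]
    -- The branch above has at most two thirds of the nodes, so at least a third remains after the
    -- cut.
    have : s ≤ 2 * m := by omega
    have : (s : ℝ) ≤ 2 * m := by exact_mod_cast this
    push_cast
    linarith
  have h7 : (s : ℝ) / 3 ≤ s * (Real.log (s + m : ℕ) - Real.log s) := by nlinarith
  have h8 : (M : ℝ) * (s * d / M / (1 + (u + s : ℕ) * d / M)) =
      s * d / (1 + (u + s : ℕ) * d / M) := by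
    field_simp
  have h9 : (M : ℝ) * (s * d / M / (1 + (u + s : ℕ) * d / M)) ≤
      M * (starLevel d M (u + s) D - starLevel d M u D') := by
    refine mul_le_mul_of_nonneg_left ?_ hM'.le
    unfold starLevel
    linarith
  have h10 : 0 ≤ (M : ℝ) * (s * d / M / (1 + (u + s : ℕ) * d / M)) := by positivity
  rw [add_comm s m] at h1 h7
  have h11 : ((m + s : ℕ) : ℝ) - ((u + s : ℕ) : ℝ) = m - u := by push_cast; ring
  unfold starPotential
  rw [h11]
  constructor
  · nlinarith
  · rw [← h8]
    nlinarith

/-- From `s ≤ M / √d` and `M ≤ 4(m + s)` one gets `log ((m + s) / s) ≥ (log d) / 4`, because `log 16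
≤ (log d) / 2`. A quarter of this pays for the growth of the last term; the remaining `(3/16) log d`
is at least `1`, as `d ≥ 256`. The fall of the level comes on top. -/
lemma starPotential_drop_below {d M m u D D' s : ℕ} {g : ℝ} (hs : 0 < s)
    (hd256 : 256 ≤ d) (hsM : s ^ 2 * d ≤ M ^ 2) (hM : M ≤ 4 * (m + s)) :
    starPotential d M g m u D' + mulLogSelf s + s +
        1 / 1024 * M * (Real.log (d + 1 - D') - Real.log (d + 1 - D)) ≤
      starPotential d M g (m + s) u D := by
  have hs' : (0 : ℝ) < s := by exact_mod_cast hs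
  have hd' : (256 : ℝ) ≤ d := by exact_mod_cast hd256
  have h1 := mulLogSelf_add_le s m
  have hlog2 := Real.log_two_gt_d9
  have h256 : Real.log 256 = 8 * Real.log 2 := by
    rw [show (256 : ℝ) = 2 ^ 8 by norm_num, Real.log_pow]; norm_num
  have h16 : Real.log 16 = 4 * Real.log 2 := by
    rw [show (16 : ℝ) = 2 ^ 4 by norm_num, Real.log_pow]; norm_num
  have hlogd : Real.log 256 ≤ Real.log d := Real.log_le_log (by norm_num) hd'
  have h2 : Real.log d + 2 * Real.log s ≤ Real.log 16 + 2 * Real.log (m + s : ℕ) := by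
    have e1 : s ^ 2 * d ≤ 16 * (m + s) ^ 2 := by nlinarith
    have e2 : (s : ℝ) ^ 2 * d ≤ 16 * ((m + s : ℕ) : ℝ) ^ 2 := by exact_mod_cast e1
    have e3 := Real.log_le_log (by positivity) e2
    rw [Real.log_mul (by positivity) (by positivity), Real.log_mul (by positivity) (by positivity),
      Real.log_pow, Real.log_pow] at e3
    push_cast at e3 ⊢
    linarith
  have h3 : 1 / 4 * Real.log d ≤ Real.log (m + s : ℕ) - Real.log s := by linarith
  have h4 : (s : ℝ) * (1 / 4 * Real.log d) ≤ s * (Real.log (m + s : ℕ) - Real.log s) := by gcongr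
  have h5 : (s : ℝ) ≤ s * (3 / 16 * Real.log d) := by nlinarith
  rw [add_comm s m] at h1
  unfold starPotential starLevel
  push_cast at *
  nlinarith

lemma log_succ_le_two_mul_log {d : ℕ} (hd : 2 ≤ d) : Real.log (d + 1) ≤ 2 * Real.log d := by
  have h : (2 : ℝ) ≤ d := by exact_mod_cast hd
  have e : 2 * Real.log d = Real.log ((d : ℝ) ^ 2) := by rw [Real.log_pow]; norm_num
  rw [e]
  exact Real.log_le_log (by linarith) (by nlinarith)

lemma neg_le_starLevel {d M u D : ℕ} (hD : D ≤ d) : -Real.log (d + 1) ≤ starLevel d M u D := by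
  have h1 : (0 : ℝ) ≤ Real.log (1 + u * d / M) := Real.log_nonneg (by
    have : (0 : ℝ) ≤ u * d / M := by positivity
    linarith)
  have h2 := log_succ_sub_le (Nat.zero_le D) hD
  unfold starLevel
  simp only [Nat.cast_zero, sub_zero] at h2
  linarith

lemma starLevel_le {d M u D : ℕ} (hD : D ≤ d) (hu : u ≤ M) :
    starLevel d M u D ≤ Real.log (d + 1) := by
  have h0 : (D : ℝ) ≤ d := by exact_mod_cast hD
  have h1 : (0 : ℝ) ≤ Real.log (d + 1 - D) := Real.log_nonneg (by linarith)
  have h2 : Real.log (1 + u * d / M : ℝ) ≤ Real.log (d + 1) := by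
    refine Real.log_le_log (by positivity) ?_
    have hu' : (u : ℝ) ≤ M := by exact_mod_cast hu
    have h3 : (u : ℝ) * d / M ≤ d := by
      rcases Nat.eq_zero_or_pos M with rfl | hM
      · simp
      · rw [div_le_iff₀ (by exact_mod_cast hM)]
        nlinarith [Nat.cast_nonneg (α := ℝ) d]
    linarith
  unfold starLevel
  linarith

/-- The end of a star phase: with at most `M / 4` nodes left at or below the centre, the last term
is at least `(M/64) log d`, whereas the level has fallen by at most `4 log d` and costs at most
`(M/256) log d`. -/
lemma mulLogSelf_le_starPotential {d M m u D : ℕ} {g : ℝ} (hd : 2 ≤ d) (hD : D ≤ d)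
    (hg : g ≤ Real.log (d + 1)) (hm : 4 * (m - u : ℝ) ≤ M) :
    mulLogSelf m ≤ starPotential d M g m u D := by
  have h1 := log_succ_le_two_mul_log hd
  have h2 := neg_le_starLevel (M := M) (u := u) hD
  have h3 : (0 : ℝ) ≤ Real.log d := Real.log_natCast_nonneg d
  have h4 : (M : ℝ) * (-(4 * Real.log d)) ≤ M * (starLevel d M u D - g) := by
    gcongr; linarith
  have h5 : (M : ℝ) / 4 * Real.log d ≤ (M / 2 - (m - u)) * Real.log d := by
    gcongr; linarith
  have h6 : 0 ≤ (M : ℝ) * Real.log d := by positivity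
  unfold starPotential
  nlinarith

/-- Since `m ≥ 64` and `d ≤ 4m`, one has `log d ≤ (4/3) log m`, so `m log m` outweighs the two other
terms. -/
lemma starPotential_nonneg {d M m u D : ℕ} {g : ℝ} (hd : 256 ≤ d) (hD : D ≤ d)
    (hg : g ≤ Real.log (d + 1)) (hdM : d ≤ M) (hM : M ≤ 4 * m) :
    0 ≤ starPotential d M g m u D := by
  have h1 := log_succ_le_two_mul_log (show 2 ≤ d by omega)
  have h2 := neg_le_starLevel (M := M) (u := u) hD
  have h3 : (0 : ℝ) ≤ Real.log d := Real.log_natCast_nonneg d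
  have hm : (64 : ℝ) ≤ m := by
    have : 64 ≤ m := by omega
    exact_mod_cast this
  have hlog : Real.log d ≤ 4 / 3 * Real.log m := by
    have e1 : (d : ℝ) ≤ 4 * m := by exact_mod_cast hdM.trans hM
    have e2 := Real.log_le_log (by positivity) e1
    rw [Real.log_mul (by norm_num) (by positivity)] at e2
    have e3 := Real.log_le_log (by norm_num) hm
    have e4 : Real.log 64 = 3 * Real.log 4 := by
      rw [show (64 : ℝ) = 4 ^ 3 by norm_num, Real.log_pow]; norm_num
    linarith
  have hM' : (M : ℝ) ≤ 4 * m := by exact_mod_cast hM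
  have h4 : (M : ℝ) * (-(4 * Real.log d)) ≤ M * (starLevel d M u D - g) := by
    gcongr; linarith
  have h5 : (-m : ℝ) * Real.log d ≤ (M / 2 - (m - u)) * Real.log d := by
    gcongr
    have : (0 : ℝ) ≤ M / 2 := by positivity
    have : (0 : ℝ) ≤ u := by positivity
    linarith
  have h6 : (M : ℝ) * Real.log d ≤ 4 * m * Real.log d := by gcongr
  have h7 : (m : ℝ) * Real.log d ≤ m * (4 / 3 * Real.log m) := by gcongr
  have h8 : (0 : ℝ) ≤ m * Real.log d := by positivity
  unfold starPotential mulLogSelf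
  nlinarith

/-- The start of a star phase: the level term vanishes and the last term is not positive. -/
lemma starPotential_le_mulLogSelf {d m u D : ℕ} (hu : 2 * u ≤ m) :
    starPotential d m (starLevel d m u D) m u D ≤ mulLogSelf m := by
  have h1 : (0 : ℝ) ≤ Real.log d := Real.log_natCast_nonneg d
  have h2 : (2 : ℝ) * u ≤ m := by exact_mod_cast hu
  unfold starPotential
  nlinarith

end Potential

/-! ### Stars, the two parts of a cut, and counting successful pairs -/

section PotentialDrop

variable {V : Type} [PartialOrder V] {U : Finset V} {d M : ℕ} {v : V}

/-- The branches below `v` in `U` are small in comparison with `M`, and `U` makes up a constant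
proportion of `M`. -/
structure IsStar (U : Finset V) (d M : ℕ) (v : V) : Prop where
  mem : v ∈ U
  le_d : 256 ≤ d
  d_le : d ≤ M
  card_le : U.card ≤ M
  le_below : M ≤ 4 * (below U v).card
  notBelow_le : 2 * (notBelow U v).card ≤ M
  child_le : ∀ c ∈ U, v ⋖ c → (below U c).card ^ 2 * d ≤ M ^ 2

/-- The star potential of `U` with centre `v`. -/
noncomputable def starPotentialOf (U : Finset V) (d M : ℕ) (v : V) (g : ℝ) : ℝ :=
  starPotential d M g U.card (notBelow U v).card (neighbors U v).card

/-- The potentials of `U`. -/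
def IsPotential (U : Finset V) (d : ℕ) (x : ℝ) : Prop :=
  x = mulLogSelf U.card ∨
    ∃ v M g, IsStar U d M v ∧ g ≤ Real.log (d + 1) ∧ x = starPotentialOf U d M v g

lemma IsPotential.nonneg (hD : ∀ v, (neighbors U v).card ≤ d) {x : ℝ} (hx : IsPotential U d x) :
    0 ≤ x := by
  rcases hx with rfl | ⟨v, M, g, h, hg, rfl⟩
  · exact mulLogSelf_nonneg _
  · have := card_below_le U v
    have := h.le_below
    exact starPotential_nonneg h.le_d (hD v) hg h.d_le (by omega)

lemma IsStar.exists_potential_le (h : IsStar U d M v) {U' : Finset V} (hU' : U' ⊆ U)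
    (hv : v ∈ U') (hD : (neighbors U v).card ≤ d) {g : ℝ} (hg : g ≤ Real.log (d + 1)) :
    ∃ x, IsPotential U' d x ∧ x ≤ starPotentialOf U' d M v g := by
  have hle := h.le_d
  have hb : ∀ c, below U' c ⊆ below U c := fun c k hk =>
    mem_below.2 ⟨hU' (mem_below.1 hk).1, (mem_below.1 hk).2⟩
  -- The part stays a star while it has at least `M / 4` nodes at or below `v`; after that it
  -- returns to `m log m`.
  by_cases hM : M ≤ 4 * (below U' v).card
  · refine ⟨_, .inr ⟨v, M, g, ⟨hv, h.le_d, h.d_le, (Finset.card_le_card hU').trans h.card_le, hM,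
      ?_, ?_⟩, hg, rfl⟩, le_rfl⟩
    · refine (Nat.mul_le_mul_left 2 (Finset.card_le_card fun k hk => ?_)).trans h.notBelow_le
      exact mem_notBelow.2 ⟨hU' (mem_notBelow.1 hk).1, (mem_notBelow.1 hk).2⟩
    · intro c hc hvc
      refine le_trans ?_ (h.child_le c (hU' hc) hvc)
      gcongr
      exact hb c
  · refine ⟨_, .inl rfl, mulLogSelf_le_starPotential (by omega)
      ((Finset.card_le_card (neighbors_mono hU' v)).trans hD) hg ?_⟩
    have h1 : (below U' v).card + (notBelow U' v).card = U'.card :=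
      card_below_add_card_notBelow U' v
    have h2 : (U'.card : ℝ) = (below U' v).card + (notBelow U' v).card := by exact_mod_cast h1.symm
    have h3 : 4 * (below U' v).card ≤ M := by omega
    have h4 : (4 : ℝ) * (below U' v).card ≤ M := by exact_mod_cast h3
    rw [h2]
    linarith

open Classical in
/-- The part of `U` with `v` after cutting above `b`. -/
noncomputable def restOf (U : Finset V) (v b : V) : Finset V :=
  if b ≤ v then below U b else notBelow U b

open Classical in
/-- The part of `U` without `v` after cutting above `b`. -/
noncomputable def pieceOf (U : Finset V) (v b : V) : Finset V :=
  if b ≤ v then notBelow U b else below U b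

lemma card_restOf_add_card_pieceOf (U : Finset V) (v b : V) :
    (restOf U v b).card + (pieceOf U v b).card = U.card := by
  have := card_below_add_card_notBelow U b
  unfold restOf pieceOf
  split_ifs <;> omega

lemma restOf_subset (U : Finset V) (v b : V) : restOf U v b ⊆ U := by
  intro k hk
  unfold restOf at hk
  split_ifs at hk
  · exact (mem_below.1 hk).1
  · exact (mem_notBelow.1 hk).1

lemma mem_restOf (hv : v ∈ U) (b : V) : v ∈ restOf U v b := by
  unfold restOf
  split_ifs with h
  · exact mem_below.2 ⟨hv, h⟩
  · exact mem_notBelow.2 ⟨hv, h⟩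

/-- An edge whose lower end is not strictly below `v` belongs to the branch above `v` or joins it to
`v`, so the piece comes entirely from this branch. -/
lemma card_notBelow_restOf_of_not_lt (hF : ∀ a b c : V, a ≤ c → b ≤ c → a ≤ b ∨ b ≤ a) {b : V}
    (hvb : ¬ v < b) :
    (notBelow (restOf U v b) v).card + (pieceOf U v b).card = (notBelow U v).card := by
  have h := card_below_add_card_notBelow (notBelow U v) b
  unfold restOf pieceOf
  split_ifs with hb
  · have e1 : notBelow (below U b) v = below (notBelow U v) b := by
      ext k; simp only [mem_below, mem_notBelow]; tauto
    have e2 : notBelow U b = notBelow (notBelow U v) b := by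
      ext k; simp only [mem_notBelow]
      exact ⟨fun hk => ⟨⟨hk.1, fun h' => hk.2 (hb.trans h')⟩, hk.2⟩, fun hk => ⟨hk.1.1, hk.2⟩⟩
    rw [e1, e2, h]
  · have e1 : notBelow (notBelow U b) v = notBelow (notBelow U v) b := by
      ext k; simp only [mem_notBelow]; tauto
    have e2 : below U b = below (notBelow U v) b := by
      ext k; simp only [mem_below, mem_notBelow]
      refine ⟨fun hk => ⟨⟨hk.1, fun h' => ?_⟩, hk.2⟩, fun hk => ⟨hk.1.1, hk.2⟩⟩
      rcases hF _ _ _ h' hk.2 with h1 | h1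
      · exact hvb (lt_of_le_not_ge h1 hb)
      · exact hb h1
    rw [e1, e2, add_comm, h]

lemma card_notBelow_restOf_of_lt {b : V} (hvb : v < b) :
    (notBelow (restOf U v b) v).card = (notBelow U v).card := by
  unfold restOf
  rw [if_neg hvb.not_ge]
  congr 1
  ext k
  simp only [mem_notBelow]
  exact ⟨fun hk => ⟨hk.1.1, hk.2⟩, fun hk => ⟨⟨hk.1, fun h => hk.2 (hvb.le.trans h)⟩, hk.2⟩⟩

lemma card_neighbors_restOf {b : V} (hb : b ∈ U) (hvb : v ⋖ b) :
    (neighbors (restOf U v b) v).card + 1 ≤ (neighbors U v).card := by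
  classical
  have hmem : b ∈ neighbors U v := mem_neighbors.2 ⟨hb, .inl hvb⟩
  rw [← Finset.card_erase_add_one hmem]
  refine Nat.add_le_add_right (Finset.card_le_card fun k hk => Finset.mem_erase.2 ⟨?_, ?_⟩) 1
  · rintro rfl
    have := (mem_neighbors.1 hk).1
    rw [restOf, if_neg hvb.lt.not_ge] at this
    exact (mem_notBelow.1 this).2 le_rfl
  · exact neighbors_mono (restOf_subset U v b) v hk

lemma card_pieceOf_pos {a b : V} (ha : a ∈ U) (hb : b ∈ U) (hab : a < b) :
    0 < (pieceOf U v b).card := by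
  refine Finset.card_pos.2 ?_
  unfold pieceOf
  split_ifs
  · exact ⟨a, mem_notBelow.2 ⟨ha, hab.not_ge⟩⟩
  · exact ⟨b, mem_below.2 ⟨hb, le_rfl⟩⟩

/-- The piece has at least `max(⌊m/d⌋, 1)` nodes, and `m < d(⌊m/d⌋ + 1)`. Positivity is needed
because `⌊m/d⌋` may be `0`. -/
lemma IsEven.card_le_pieceOf {b : V} (hd : 0 < d) (h : IsEven U d b)
    (hpos : 0 < (pieceOf U v b).card) : U.card ≤ 2 * d * (pieceOf U v b).card := by
  have hq : U.card / d ≤ (pieceOf U v b).card := by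
    unfold pieceOf
    split_ifs
    · exact h.le_notBelow
    · exact h.1
  have h4 : U.card < d * (U.card / d + 1) := Nat.lt_mul_div_succ _ hd
  nlinarith

/-- The decrease from `x` to the potential `y` after a round. -/
def separatorGain (x : ℝ) (y : V → ℝ) : Option (V × V) → ℝ
  | none => 0
  | some e => x - y e.2

omit [PartialOrder V] in
lemma mul_le_sum_sum {A B : Finset V} {G : V → V → ℝ} {γ : ℝ} (hA : A ⊆ U) (hB : B ⊆ U)
    (hG : ∀ i ∈ U, ∀ j ∈ U, 0 ≤ G i j) (hγ : ∀ i ∈ A, ∀ j ∈ B, γ ≤ G i j) :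
    (A.card * B.card : ℝ) * γ ≤ ∑ i ∈ U, ∑ j ∈ U, G i j := by
  have h1 : ∑ i ∈ A, ∑ j ∈ B, G i j ≤ ∑ i ∈ U, ∑ j ∈ U, G i j := by
    refine (Finset.sum_le_sum fun i hi => Finset.sum_le_sum_of_subset_of_nonneg hB
      fun j hj _ => hG i (hA hi) j hj).trans ?_
    exact Finset.sum_le_sum_of_subset_of_nonneg hA fun i hi _ =>
      Finset.sum_nonneg fun j hj => hG i hi j hj
  refine le_trans ?_ h1
  have h2 : ∑ i ∈ A, ∑ j ∈ B, γ ≤ ∑ i ∈ A, ∑ j ∈ B, G i j :=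
    Finset.sum_le_sum fun i hi => Finset.sum_le_sum fun j hj => hγ i hi j hj
  simpa [mul_assoc] using h2

variable {sep : V → V → Option (V × V)}

lemma IsEvenSeparatorRule.ne_none (hsep : IsEvenSeparatorRule U d sep) {i j c : V} (hi : i ∈ U)
    (hj : j ∈ U) (hc : c ∈ U) (hs : Separates c i j) (hev : IsEven U d c) : sep i j ≠ none :=
  fun h => hsep.exhaustive i hi j hj h c hc hs hev

/-- If no branch at `v` is too large, then a third of the pairs whose first node lies in a heavy
branch lead to a cut. -/
lemma IsEvenSeparatorRule.mul_le_sum_sum (hsep : IsEvenSeparatorRule U d sep) (hv : v ∈ U)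
    (hchild : ∀ c ∈ U, v ⋖ c →
      (below U c).card ≤ U.card - U.card / d ∧ 3 * (below U c).card ≤ 2 * U.card)
    (hup : (notBelow U v).card ≤ U.card - U.card / d ∧ 3 * (notBelow U v).card ≤ 2 * U.card)
    {G : V → V → ℝ} {γ : ℝ} (hγ : 0 ≤ γ) (hG : ∀ i ∈ U, ∀ j ∈ U, 0 ≤ G i j)
    (hG' : ∀ i ∈ U, ∀ j ∈ U, sep i j ≠ none → γ ≤ G i j) :
    (heavy U d v).card * (U.card / 3) * γ ≤ ∑ i ∈ U, ∑ j ∈ U, G i j := by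
  have key : ∀ i ∈ heavy U d v, (U.card / 3 : ℝ) * γ ≤ ∑ j ∈ U, G i j := by
    intro i hi
    have hiU := heavy_subset hi
    -- `B` will be the complement of the branch of `i`; the edge joining this branch to `v` is even
    -- and separates `i` from all of `B`.
    have aux : ∀ B ⊆ U, U.card ≤ 3 * B.card → (∀ j ∈ B, sep i j ≠ none) →
        (U.card / 3 : ℝ) * γ ≤ ∑ j ∈ U, G i j := by
      intro B hB hcard hj
      have h1 : ∑ j ∈ B, γ ≤ ∑ j ∈ U, G i j :=
        (Finset.sum_le_sum fun j hjB => hG' i hiU j (hB hjB) (hj j hjB)).trans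
          (Finset.sum_le_sum_of_subset_of_nonneg hB fun j hj _ => hG i hiU j hj)
      rw [Finset.sum_const, nsmul_eq_mul] at h1
      refine le_trans ?_ h1
      gcongr
      have : (U.card : ℝ) ≤ 3 * B.card := by exact_mod_cast hcard
      linarith
    obtain ⟨-, ⟨c, hc, hvc, hci, hq⟩ | ⟨hvi, hq⟩⟩ := mem_heavy.1 hi
    · have h1 := card_below_add_card_notBelow U c
      have h2 := hchild c hc hvc
      refine aux (notBelow U c) (fun k hk => (mem_notBelow.1 hk).1) (by omega) fun j hj => ?_
      rw [mem_notBelow] at hj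
      exact hsep.ne_none hiU hj.1 hc (.inl ⟨hci, hj.2⟩) ⟨hq, h2.1⟩
    · have h1 := card_below_add_card_notBelow U v
      refine aux (below U v) (fun k hk => (mem_below.1 hk).1) (by omega) fun j hj => ?_
      rw [mem_below] at hj
      refine hsep.ne_none hiU hj.1 hv (.inr ⟨hvi, hj.2⟩) ⟨?_, ?_⟩
      · have := Nat.div_le_self U.card d
        omega
      · omega
  calc ((heavy U d v).card * (U.card / 3) * γ : ℝ) = ∑ i ∈ heavy U d v, (U.card / 3 : ℝ) * γ := by
        rw [Finset.sum_const, nsmul_eq_mul, mul_assoc]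
    _ ≤ ∑ i ∈ heavy U d v, ∑ j ∈ U, G i j := Finset.sum_le_sum key
    _ ≤ _ := Finset.sum_le_sum_of_subset_of_nonneg heavy_subset fun i hi _ =>
        Finset.sum_nonneg fun j hj => hG i hi j hj

/-- For `|U| < d` the threshold `⌊|U|/d⌋` is `0`, so every branch is heavy. -/
lemma sub_one_le_card_heavy [Finite V] (hU : IsSubtree U) (hv : v ∈ U) (hd : U.card < d) :
    U.card ≤ (heavy U d v).card + 1 := by
  classical
  have hq : U.card / d = 0 := Nat.div_eq_of_lt hd
  have h : U.erase v ⊆ heavy U d v := by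
    intro k hk
    rw [Finset.mem_erase] at hk
    refine mem_heavy.2 ⟨hk.2, ?_⟩
    rw [hq]
    by_cases hvk : v ≤ k
    · obtain ⟨c, hc, hck⟩ := exists_child (lt_of_le_of_ne hvk hk.1.symm)
      exact .inl ⟨c, hU.convex v hv k hk.2 c hc.le hck, hc, hck, Nat.zero_le _⟩
    · exact .inr ⟨hvk, Nat.zero_le _⟩
  have := Finset.card_le_card h
  rw [Finset.card_erase_of_mem hv] at this
  omega

/-- If less than a fixed proportion of `U` lies in heavy branches, then `d` is large and at most
the size of `U`. -/
lemma IsSubtree.le_of_card_heavy_lt [Finite V] (hU : IsSubtree U) (hv : v ∈ U)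
    (hm : 2 ≤ U.card) (hd : 2 ≤ d) (hD : (neighbors U v).card ≤ d)
    (h : 1024 * (heavy U d v).card < U.card) : 256 ≤ d ∧ d ≤ U.card := by
  constructor
  · have h1 := hU.card_heavy hv hm hd hD
    have h2 : 1 * U.card ≤ (d + 1 - (neighbors U v).card) * U.card :=
      Nat.mul_le_mul_right _ (by omega)
    by_contra! h3
    nlinarith
  · by_contra! h1
    have := sub_one_le_card_heavy hU hv h1
    omega

end PotentialDrop

/-! ### Expected decrease of the star potential -/

section PotentialStep

variable {V : Type} [PartialOrder V] {U : Finset V} {d M : ℕ} {v : V}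
  {sep : V → V → Option (V × V)}

/-- The bound on the potentials after cutting above `b` a tree that was a star. -/
noncomputable def starPotentialAfter (U : Finset V) (d M : ℕ) (v : V) (g : ℝ) (b : V) : ℝ :=
  starPotentialOf (restOf U v b) d M v g + mulLogSelf (pieceOf U v b).card

lemma IsStar.drop_above (hF : ∀ a b c : V, a ≤ c → b ≤ c → a ≤ b ∨ b ≤ a) (h : IsStar U d M v)
    (hD : (neighbors U v).card ≤ d) {a b : V} (ha : a ∈ U) (hb : b ∈ U) (hab : a < b)
    (hvb : ¬ v < b) (g : ℝ) :
    (pieceOf U v b).card / 3 ≤ starPotentialOf U d M v g - starPotentialAfter U d M v g b ∧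
      1 / 1024 * ((pieceOf U v b).card * d / (1 + (notBelow U v).card * d / M)) ≤
        starPotentialOf U d M v g - starPotentialAfter U d M v g b := by
  have hle := h.le_d
  have hdM := h.d_le
  have h1 := card_restOf_add_card_pieceOf U v b
  have h2 := card_notBelow_restOf_of_not_lt (U := U) hF hvb
  have h3 := card_below_add_card_notBelow U v
  have h4 := h.le_below
  have h5 := h.notBelow_le
  have h6 := starPotential_drop_above (d := d) (M := M) (m := (restOf U v b).card)
    (u := (notBelow (restOf U v b) v).card) (D := (neighbors U v).card)
    (D' := (neighbors (restOf U v b) v).card) (s := (pieceOf U v b).card) (g := g) (by omega)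
    (card_pieceOf_pos ha hb hab) (by omega)
    (Finset.card_le_card (neighbors_mono (restOf_subset U v b) v)) hD
  rw [h1, h2] at h6
  unfold starPotentialAfter starPotentialOf
  constructor <;> linarith [h6.1, h6.2]

lemma IsStar.drop_below [Finite V] (hU : IsSubtree U) (h : IsStar U d M v) {a b : V}
    (ha : a ∈ U) (hb : b ∈ U) (hab : a < b) (hvb : v < b) (g : ℝ) :
    (pieceOf U v b).card + 1 / 1024 * M *
      (Real.log (d + 1 - (neighbors (restOf U v b) v).card) -
        Real.log (d + 1 - (neighbors U v).card)) ≤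
      starPotentialOf U d M v g - starPotentialAfter U d M v g b := by
  have h1 := card_restOf_add_card_pieceOf U v b
  have h2 := card_notBelow_restOf_of_lt (U := U) hvb
  have h3 := card_below_le U v
  have h4 := h.le_below
  obtain ⟨c, hc, hcb⟩ := exists_child hvb
  have hcU := hU.convex v h.mem b hb c hc.le hcb
  have h5 : (pieceOf U v b).card ^ 2 * d ≤ M ^ 2 := by
    refine le_trans ?_ (h.child_le c hcU hc)
    gcongr
    rw [pieceOf, if_neg hvb.not_ge]
    exact fun k hk => mem_below.2 ⟨(mem_below.1 hk).1, hcb.trans (mem_below.1 hk).2⟩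
  have h6 := starPotential_drop_below (d := d) (M := M) (m := (restOf U v b).card)
    (u := (notBelow (restOf U v b) v).card) (D := (neighbors U v).card)
    (D' := (neighbors (restOf U v b) v).card) (s := (pieceOf U v b).card) (g := g)
    (card_pieceOf_pos ha hb hab) h.le_d h5 (by omega)
  rw [h1, h2] at h6
  unfold starPotentialAfter starPotentialOf
  rw [h2]
  linarith

lemma IsStar.drop [Finite V] (hF : ∀ a b c : V, a ≤ c → b ≤ c → a ≤ b ∨ b ≤ a)
    (hU : IsSubtree U) (h : IsStar U d M v)
    (hD : (neighbors U v).card ≤ d) {a b : V} (ha : a ∈ U) (hb : b ∈ U) (hab : a < b) (g : ℝ) :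
    (pieceOf U v b).card / 3 ≤ starPotentialOf U d M v g - starPotentialAfter U d M v g b := by
  by_cases hvb : v < b
  · have h1 := h.drop_below hU ha hb hab hvb g
    have h2 := log_succ_sub_le (Finset.card_le_card (neighbors_mono (restOf_subset U v b) v)) hD
    have h3 : 0 ≤ 1 / 1024 * (M : ℝ) *
      (Real.log (d + 1 - (neighbors (restOf U v b) v).card) -
        Real.log (d + 1 - (neighbors U v).card)) :=
      mul_nonneg (by positivity) (by linarith)
    have h4 : (0 : ℝ) ≤ (pieceOf U v b).card := Nat.cast_nonneg _
    linarith
  · exact (h.drop_above hF hD ha hb hab hvb g).1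

lemma card_sdiff_heavy (U : Finset V) (d : ℕ) (v : V) [DecidableEq V] :
    (U \ heavy U d v).card + (heavy U d v).card = U.card :=
  Finset.card_sdiff_add_card_eq_card heavy_subset

lemma IsStar.exists_potential_after (h : IsStar U d M v)
    (hD : (neighbors U v).card ≤ d) {g : ℝ} (hg : g ≤ Real.log (d + 1)) (b : V) :
    ∃ x₁ x₂, IsPotential (notBelow U b) d x₁ ∧ IsPotential (below U b) d x₂ ∧
      x₁ + x₂ ≤ starPotentialAfter U d M v g b := by
  obtain ⟨x, hx, hx'⟩ := h.exists_potential_le (restOf_subset U v b) (mem_restOf h.mem b) hD hg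
  by_cases hb : b ≤ v
  · refine ⟨mulLogSelf (pieceOf U v b).card, x, ?_, ?_, ?_⟩
    · rw [pieceOf, if_pos hb]; exact .inl rfl
    · rwa [restOf, if_pos hb] at hx
    · unfold starPotentialAfter; linarith
  · refine ⟨x, mulLogSelf (pieceOf U v b).card, ?_, ?_, ?_⟩
    · rwa [restOf, if_neg hb] at hx
    · rw [pieceOf, if_neg hb]; exact .inl rfl
    · unfold starPotentialAfter; linarith

/-- If many nodes are heavy, the gain `m / (6d)` of every cut is enough. Otherwise cuts are rarer
but the level falls more: the rarity of pairs with `j` above `v`, or in a heavy branch below `v`, is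
offset by the factor `1 / (1 + ud/M)`, or `1 / (d + 1 - D)`, in the gain. The constant `40000`
exceeds those of all three cases. -/
lemma IsStar.sum_gain [Finite V] (hF : ∀ a b c : V, a ≤ c → b ≤ c → a ≤ b ∨ b ≤ a)
    (hU : IsSubtree U) (hm : 2 ≤ U.card) (h : IsStar U d M v)
    (hD : (neighbors U v).card ≤ d) (hsep : IsEvenSeparatorRule U d sep) (g : ℝ) :
    (U.card : ℝ) ^ 3 / (40000 * d) ≤ ∑ i ∈ U, ∑ j ∈ U,
      separatorGain (starPotentialOf U d M v g) (starPotentialAfter U d M v g) (sep i j) := by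
  classical
  have hd256 := h.le_d
  have hdM := h.d_le
  have hmM := h.card_le
  have hMb := h.le_below
  have huM := h.notBelow_le
  have hsum := card_below_add_card_notBelow U v
  set m := U.card with hmdef
  set u := (notBelow U v).card with hu
  set q := m / d with hq
  have hqd : q * 256 ≤ m := (Nat.mul_le_mul_left q hd256).trans (Nat.div_mul_le_self m d)
  have hqU : U.card / d * 256 ≤ U.card := hqd
  have hdR : (0 : ℝ) < d := by exact_mod_cast (show 0 < d by omega)
  have hmR : (0 : ℝ) < m := by exact_mod_cast (show 0 < m by omega)
  have hMR : (0 : ℝ) < M := by exact_mod_cast (show 0 < M by omega)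
  have hmMR : (m : ℝ) ≤ M := by exact_mod_cast hmM
  have hM4 : (M : ℝ) ≤ 4 * m := by exact_mod_cast (show M ≤ 4 * m by omega)
  set G : V → V → ℝ := fun i j =>
    separatorGain (starPotentialOf U d M v g) (starPotentialAfter U d M v g) (sep i j) with hG
  -- every cut gains at least a constant times `m / d`
  have hpiece : ∀ i ∈ U, ∀ j ∈ U, ∀ e, sep i j = some e →
      (m : ℝ) ≤ 2 * d * (pieceOf U v e.2).card := by
    intro i hi j hj e he
    obtain ⟨h1, h2, h3, -, h4⟩ := hsep.even i hi j hj e he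
    exact_mod_cast h4.card_le_pieceOf (by omega) (card_pieceOf_pos h1 h2 h3.lt)
  have hG1 : ∀ i ∈ U, ∀ j ∈ U, sep i j ≠ none → (m : ℝ) / (6 * d) ≤ G i j := by
    intro i hi j hj hne
    obtain ⟨e, he⟩ := Option.ne_none_iff_exists'.1 hne
    obtain ⟨h1, h2, h3, -, -⟩ := hsep.even i hi j hj e he
    have h4 := h.drop hF hU hD h1 h2 h3.lt g
    have h5 := hpiece i hi j hj e he
    simp only [hG, he, separatorGain]
    refine le_trans ?_ h4
    rw [div_le_div_iff₀ (by positivity) (by norm_num)]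
    linarith
  have hG0 : ∀ i ∈ U, ∀ j ∈ U, 0 ≤ G i j := by
    intro i hi j hj
    by_cases hne : sep i j = none
    · simp [hG, hne, separatorGain]
    · exact (by positivity : (0 : ℝ) ≤ m / (6 * d)).trans (hG1 i hi j hj hne)
  -- From `d ≥ 256`, a branch below `v` has at most `M / 16` nodes, and `M ≤ 4m`.
  have hchild : ∀ c ∈ U, v ⋖ c → 4 * (below U c).card ≤ m := by
    intro c hc hvc
    have h1 := h.child_le c hc hvc
    have h2 : (16 * (below U c).card) ^ 2 ≤ M ^ 2 := by nlinarith
    have := (Nat.pow_le_pow_iff_left two_ne_zero).1 h2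
    omega
  rcases le_or_gt m (1024 * (heavy U d v).card) with hH | hH
  · have h1 := hsep.mul_le_sum_sum (G := G) (γ := m / (6 * d)) h.mem
      (fun c hc hvc => by have := hchild c hc hvc; omega) (by omega) (by positivity) hG0 hG1
    refine le_trans ?_ h1
    have h2 : (m : ℝ) / 1024 ≤ (heavy U d v).card := by
      rw [div_le_iff₀ (by norm_num)]
      exact_mod_cast (by omega : m ≤ (heavy U d v).card * 1024)
    calc (m : ℝ) ^ 3 / (40000 * d) ≤ (m : ℝ) ^ 3 / (18432 * d) := by gcongr; norm_num
      _ = (m / 1024 * (m / 3) * (m / (6 * d)) : ℝ) := by field_simp; norm_num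
      _ ≤ _ := by gcongr
  · obtain ⟨-, hdm⟩ := hU.le_of_card_heavy_lt h.mem hm (by omega) hD hH
    have hlight : (m : ℝ) / 2 ≤ (U \ heavy U d v).card := by
      have := card_sdiff_heavy U d v
      rw [div_le_iff₀ (by norm_num)]
      exact_mod_cast (by omega : m ≤ (U \ heavy U d v).card * 2)
    by_cases hup : q ≤ u
    · -- the branch above `v` is heavy
      have hup' : U.card / d ≤ u := hup
      have hev : IsEven U d v := ⟨by omega, by omega⟩
      have h1 := mul_le_sum_sum (A := U \ heavy U d v) (B := notBelow U v) (U := U) (G := G)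
        (γ := 1 / 2048 * (m / (1 + u * d / M))) Finset.sdiff_subset
        (fun k hk => (mem_notBelow.1 hk).1) hG0 (fun i hi j hj => by
          rw [Finset.mem_sdiff] at hi
          rw [mem_notBelow] at hj
          obtain ⟨e, he, hve⟩ := hsep.not_lt_of_mem_notBelow hF hU h.mem hi.1 hi.2 hj.1 hj.2 hev
          obtain ⟨e1, e2, e3, -, -⟩ := hsep.even i hi.1 j hj.1 e he
          have e4 := (h.drop_above hF hD e1 e2 e3.lt hve g).2
          have e5 := hpiece i hi.1 j hj.1 e he
          simp only [hG, he, separatorGain]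
          refine le_trans ?_ e4
          have e6 : (m : ℝ) / (1 + u * d / M) ≤
              2 * d * (pieceOf U v e.2).card / (1 + u * d / M) := by gcongr
          calc _ ≤ 1 / 2048 * (2 * d * (pieceOf U v e.2).card / (1 + u * d / M) : ℝ) := by gcongr
            _ = _ := by ring)
      refine le_trans ?_ h1
      have hud : (m : ℝ) ≤ 2 * d * u := by
        have e1 : m < d * (m / d + 1) := Nat.lt_mul_div_succ _ (by omega)
        have e2 : 1 ≤ q := (Nat.one_le_div_iff (by omega)).2 hdm
        have e3 : m ≤ 2 * d * u := by nlinarith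
        exact_mod_cast e3
      have hu0 : (0 : ℝ) ≤ u := Nat.cast_nonneg _
      -- As `m ≤ M` and `m ≤ 2du`, the product `m (1 + ud/M)` is at most `3du`; `9` leaves room.
      have hkey : (m : ℝ) / (9 * d) ≤ u / (1 + u * d / M) := by
        rw [div_le_div_iff₀ (by positivity) (by positivity)]
        have e1 : (m : ℝ) * (1 + u * d / M) = m + m * (u * d) / M := by ring
        have e2 : (m : ℝ) * (u * d) / M ≤ u * d := by
          rw [div_le_iff₀ hMR]
          nlinarith [mul_nonneg hu0 hdR.le]
        rw [e1]
        nlinarith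
      calc (m : ℝ) ^ 3 / (40000 * d) ≤ (m : ℝ) ^ 3 / (36864 * d) := by gcongr; norm_num
        _ = (m / 2 * (m / (9 * d)) * (m / 2048) : ℝ) := by field_simp; norm_num
        _ ≤ ((U \ heavy U d v).card * (u / (1 + u * d / M)) * (m / 2048) : ℝ) := by gcongr
        _ = _ := by ring
    · -- all heavy branches are below `v`
      set D := (neighbors U v).card with hDdef
      have hDR : (D : ℝ) ≤ d := by exact_mod_cast hD
      have h1 := mul_le_sum_sum (A := U \ heavy U d v) (B := heavy U d v) (U := U) (G := G)
        (γ := 1 / 2048 * (M / (d + 1 - D))) Finset.sdiff_subset heavy_subset hG0 (fun i hi j hj => by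
          rw [Finset.mem_sdiff] at hi
          obtain ⟨hjU, ⟨c, hc, hvc, hcj, hcq⟩ | ⟨-, hvq⟩⟩ := mem_heavy.1 hj
          · have := hchild c hc hvc
            obtain ⟨e, he, rfl⟩ := hsep.eq_of_mem_below hF hU h.mem hi.1 hi.2 hc hvc hjU hcj
              ⟨hcq, by omega⟩
            obtain ⟨e1, e2, e3, -, -⟩ := hsep.even i hi.1 j hjU e he
            have e4 := h.drop_below hU e1 e2 e3.lt hvc.lt g
            have e5 := card_neighbors_restOf hc hvc
            simp only [hG, he, separatorGain]
            refine le_trans ?_ e4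
            have e6 : ((neighbors (restOf U v e.2) v).card : ℝ) + 1 ≤ D := by exact_mod_cast e5
            set D' : ℝ := ((neighbors (restOf U v e.2) v).card : ℝ) with hD'
            have e7 : Real.log (d + 1 - (D - 1)) ≤ Real.log (d + 1 - D' : ℝ) :=
              Real.log_le_log (by linarith) (by linarith)
            -- Losing one neighbour lowers the level by at least `1 / (d + 2 - D)`, which is at
            -- least half of `1 / (d + 1 - D)`.
            have e8 := div_le_log_sub_log (x := d + 1 - (D - 1 : ℝ)) (y := d + 1 - D)
              (by linarith) (by linarith)
            have e9 : 1 / (2 * (d + 1 - D : ℝ)) ≤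
                (d + 1 - (D - 1) - (d + 1 - D)) / (d + 1 - (D - 1)) := by
              rw [div_le_div_iff₀ (by linarith) (by linarith)]
              nlinarith
            have e10 : (M : ℝ) * (1 / (2 * (d + 1 - D : ℝ))) ≤
                M * (Real.log (d + 1 - D') - Real.log (d + 1 - D)) := by
              gcongr; linarith
            have e11 : 1 / 2048 * (M / (d + 1 - D) : ℝ) =
                1 / 1024 * (M * (1 / (2 * (d + 1 - D : ℝ)))) := by
              have : (d + 1 - D : ℝ) ≠ 0 := by linarith
              field_simp; norm_num
            have e12 : (0 : ℝ) ≤ (pieceOf U v e.2).card := Nat.cast_nonneg _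
            rw [e11]
            linarith
          · exact absurd hvq hup)
      refine le_trans ?_ h1
      have h2 := hU.card_heavy h.mem hm (by omega) hD
      have h3 : (d + 1 - D : ℝ) * m ≤ 4 * d * (heavy U d v).card := by
        have e : ((d + 1 - D : ℕ) : ℝ) * m ≤ 4 * d * (heavy U d v).card := by exact_mod_cast h2
        rw [Nat.cast_sub (by omega)] at e
        push_cast at e
        exact e
      have hpos : (0 : ℝ) < d + 1 - D := by linarith
      have hkey : (m : ℝ) / (4 * d) ≤ (heavy U d v).card / (d + 1 - D) := by
        rw [div_le_div_iff₀ (by positivity) hpos]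
        linarith
      calc (m : ℝ) ^ 3 / (40000 * d) ≤ (m : ℝ) ^ 3 / (16384 * d) := by gcongr; norm_num
        _ = (m / 2 * (m / (4 * d)) * (m / 2048) : ℝ) := by field_simp; norm_num
        _ ≤ ((U \ heavy U d v).card * ((heavy U d v).card / (d + 1 - D)) * (M / 2048) : ℝ) := by gcongr
        _ = _ := by ring

end PotentialStep

/-! ### Expected decrease of `m log m`, and the choice of the potential -/

section PotentialStep

variable {V : Type} [PartialOrder V] {U : Finset V} {d : ℕ} {v : V}
  {sep : V → V → Option (V × V)}

/-- The sum of the potentials after cutting above `b`. -/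
noncomputable def mulLogSelfAfter (U : Finset V) (b : V) : ℝ :=
  mulLogSelf (notBelow U b).card + mulLogSelf (below U b).card

/-- The smaller part gains `s log (m / s) ≥ s log 2`. -/
lemma half_mul_card_le_drop {b : V} {s : ℕ} (hs : s = (below U b).card ∨ s = (notBelow U b).card)
    (hs0 : 0 < s) (hle : 2 * s ≤ U.card) :
    (s : ℝ) / 2 ≤ mulLogSelf U.card - mulLogSelfAfter U b := by
  have h1 := card_below_add_card_notBelow U b
  have hlog := Real.log_two_gt_d9
  have h2 : ∀ t, s + t = U.card →
      (s : ℝ) / 2 ≤ mulLogSelf U.card - (mulLogSelf s + mulLogSelf t) := by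
    intro t ht
    have e1 := mulLogSelf_add_le s t
    have hsR : (0 : ℝ) < s := by exact_mod_cast hs0
    have e2 : Real.log 2 + Real.log s ≤ Real.log (s + t : ℕ) := by
      rw [← Real.log_mul (by norm_num) hsR.ne']
      refine Real.log_le_log (by positivity) ?_
      exact_mod_cast (by omega : 2 * s ≤ s + t)
    rw [ht] at e1 e2
    nlinarith
  unfold mulLogSelfAfter
  rcases hs with rfl | rfl
  · linarith [h2 _ h1]
  · linarith [h2 (below U b).card (by omega)]

variable [Finite V]

omit [Finite V] in
-- A constant proportion of the pairs leads to a cut, and each cut gains at least `m / (4d)`.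
lemma mulLogSelf_sum_gain_of_heavy (hd : 2 ≤ d)
    (hsep : IsEvenSeparatorRule U d sep) (hv : v ∈ U)
    (hchild : ∀ c ∈ U, v ⋖ c → 2 * (below U c).card ≤ U.card)
    (hup : 2 * (notBelow U v).card ≤ U.card)
    (hH : U.card ≤ 1024 * (heavy U d v).card) :
    (U.card : ℝ) ^ 3 / (40000 * d) ≤ ∑ i ∈ U, ∑ j ∈ U,
      separatorGain (mulLogSelf U.card) (mulLogSelfAfter U) (sep i j) := by
  have hU0 : 0 < U.card := Finset.card_pos.2 ⟨v, hv⟩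
  have hdR : (0 : ℝ) < d := by exact_mod_cast (show 0 < d by omega)
  have hq : U.card / d * 2 ≤ U.card :=
    (Nat.mul_le_mul_left _ hd).trans (Nat.div_mul_le_self _ d)
  have hG1 : ∀ i ∈ U, ∀ j ∈ U, sep i j ≠ none → (U.card : ℝ) / (4 * d) ≤
      separatorGain (mulLogSelf U.card) (mulLogSelfAfter U) (sep i j) := by
    intro i hi j hj hne
    obtain ⟨e, he⟩ := Option.ne_none_iff_exists'.1 hne
    obtain ⟨h1, h2, h3, -, h4⟩ := hsep.even i hi j hj e he
    have h5 := card_below_add_card_notBelow U e.2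
    have h6 : 0 < (below U e.2).card := Finset.card_pos.2 ⟨e.2, mem_below.2 ⟨h2, le_rfl⟩⟩
    have h7 : 0 < (notBelow U e.2).card :=
      Finset.card_pos.2 ⟨e.1, mem_notBelow.2 ⟨h1, h3.lt.not_ge⟩⟩
    have h8 : U.card < d * (U.card / d + 1) := Nat.lt_mul_div_succ _ (by omega)
    have key : ∀ s, (s = (below U e.2).card ∨ s = (notBelow U e.2).card) → 0 < s →
        2 * s ≤ U.card → U.card / d ≤ s → (U.card : ℝ) / (4 * d) ≤
          mulLogSelf U.card - mulLogSelfAfter U e.2 := by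
      intro s hs hs0 hs2 hsq
      refine le_trans ?_ (half_mul_card_le_drop hs hs0 hs2)
      rw [div_le_div_iff₀ (by positivity) (by norm_num)]
      have : U.card ≤ 2 * d * s := by nlinarith
      have : (U.card : ℝ) ≤ 2 * d * s := by exact_mod_cast this
      linarith
    simp only [he, separatorGain]
    rcases le_total (below U e.2).card (notBelow U e.2).card with h | h
    · exact key _ (.inl rfl) h6 (by omega) h4.1
    · exact key _ (.inr rfl) h7 (by omega) h4.le_notBelow
  have hG0 : ∀ i ∈ U, ∀ j ∈ U,
      0 ≤ separatorGain (mulLogSelf U.card) (mulLogSelfAfter U) (sep i j) := by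
    intro i hi j hj
    by_cases hne : sep i j = none
    · simp [hne, separatorGain]
    · exact (by positivity : (0 : ℝ) ≤ U.card / (4 * d)).trans (hG1 i hi j hj hne)
  have h1 := hsep.mul_le_sum_sum hv
    (fun c hc hvc => by have := hchild c hc hvc; omega) (by omega)
    (by positivity : (0 : ℝ) ≤ U.card / (4 * d)) hG0 hG1
  refine le_trans ?_ h1
  have h2 : (U.card : ℝ) / 1024 ≤ (heavy U d v).card := by
    rw [div_le_iff₀ (by norm_num)]
    exact_mod_cast (by omega : U.card ≤ (heavy U d v).card * 1024)
  calc (U.card : ℝ) ^ 3 / (40000 * d) ≤ (U.card : ℝ) ^ 3 / (12288 * d) := by gcongr; norm_num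
    _ = (U.card / 1024 * (U.card / 3) * (U.card / (4 * d)) : ℝ) := by field_simp; norm_num
    _ ≤ _ := by gcongr

/-- At least `(m/2) B` pairs have `i` light and `j` in the branch at `c`; each cuts off exactly this
branch and gains `B / 2`. The sum is at least `m B² / 4`, and `B² ≥ m² / d`. -/
lemma mulLogSelf_sum_gain_of_child (hF : ∀ a b c : V, a ≤ c → b ≤ c → a ≤ b ∨ b ≤ a)
    (hU : IsSubtree U) (hd : 2 ≤ d)
    (hsep : IsEvenSeparatorRule U d sep) (hv : v ∈ U) {c : V} (hc : c ∈ U) (hvc : v ⋖ c)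
    (hle : 2 * (below U c).card ≤ U.card) (hB : U.card ^ 2 ≤ (below U c).card ^ 2 * d)
    (hH : 1024 * (heavy U d v).card < U.card) :
    (U.card : ℝ) ^ 3 / (40000 * d) ≤ ∑ i ∈ U, ∑ j ∈ U,
      separatorGain (mulLogSelf U.card) (mulLogSelfAfter U) (sep i j) := by
  classical
  have hU0 : 0 < U.card := Finset.card_pos.2 ⟨v, hv⟩
  have hdR : (0 : ℝ) < d := by exact_mod_cast (show 0 < d by omega)
  have hq : U.card / d * 2 ≤ U.card :=
    (Nat.mul_le_mul_left _ hd).trans (Nat.div_mul_le_self _ d)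
  set B := (below U c).card with hBdef
  have hBpos : 0 < B := Finset.card_pos.2 ⟨c, mem_below.2 ⟨hc, le_rfl⟩⟩
  have hBq : U.card / d ≤ B := by
    refine Nat.div_le_of_le_mul ?_
    refine (Nat.pow_le_pow_iff_left two_ne_zero).1 (hB.trans ?_)
    nlinarith [Nat.mul_le_mul_left (B ^ 2 * d) (show 1 ≤ d by omega)]
  have hev : IsEven U d c := ⟨hBq, by omega⟩
  have hG0 : ∀ i ∈ U, ∀ j ∈ U,
      0 ≤ separatorGain (mulLogSelf U.card) (mulLogSelfAfter U) (sep i j) := by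
    intro i hi j hj
    cases sep i j with
    | none => exact le_rfl
    | some e =>
      have h1 := card_below_add_card_notBelow U e.2
      have h2 := mulLogSelf_add_le (below U e.2).card (notBelow U e.2).card
      rw [h1] at h2
      have h3 : 0 ≤ ((below U e.2).card : ℝ) *
          (Real.log U.card - Real.log (below U e.2).card) := by
        rcases Nat.eq_zero_or_pos (below U e.2).card with h0 | h0
        · simp [h0]
        · refine mul_nonneg (Nat.cast_nonneg _) (sub_nonneg.2 (Real.log_le_log ?_ ?_))
          · exact_mod_cast h0
          · exact_mod_cast card_below_le U e.2
      simp only [separatorGain, mulLogSelfAfter]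
      linarith
  have h1 := mul_le_sum_sum (A := U \ heavy U d v) (B := below U c) (γ := B / 2)
    Finset.sdiff_subset (fun k hk => (mem_below.1 hk).1) hG0 (fun i hi j hj => by
      rw [Finset.mem_sdiff] at hi
      rw [mem_below] at hj
      obtain ⟨e, he, rfl⟩ := hsep.eq_of_mem_below hF hU hv hi.1 hi.2 hc hvc hj.1 hj.2 hev
      simp only [he, separatorGain]
      exact half_mul_card_le_drop (.inl rfl) hBpos hle)
  refine le_trans ?_ h1
  have hlight : (U.card : ℝ) / 2 ≤ (U \ heavy U d v).card := by
    have := card_sdiff_heavy U d v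
    rw [div_le_iff₀ (by norm_num)]
    exact_mod_cast (by omega : U.card ≤ (U \ heavy U d v).card * 2)
  have hB' : (U.card : ℝ) ^ 2 ≤ (B : ℝ) ^ 2 * d := by exact_mod_cast hB
  have hB'' : (U.card : ℝ) ^ 2 / d ≤ (B : ℝ) ^ 2 := by rwa [div_le_iff₀ hdR]
  calc (U.card : ℝ) ^ 3 / (40000 * d) ≤ (U.card : ℝ) ^ 3 / (4 * d) := by gcongr; norm_num
    _ = (U.card / 2 * ((U.card : ℝ) ^ 2 / d / 2) : ℝ) := by field_simp; norm_num
    _ ≤ ((U \ heavy U d v).card * ((B : ℝ) ^ 2 / 2) : ℝ) := by gcongr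
    _ = _ := by ring

/-- The expected decrease of the potential in a round is at least a constant times `|U| / d`. -/
theorem IsPotential.exists_sum_gain (hF : ∀ a b c : V, a ≤ c → b ≤ c → a ≤ b ∨ b ≤ a)
    (hU : IsSubtree U) (hm : 2 ≤ U.card) (hd : 2 ≤ d) (hD : ∀ v, (neighbors U v).card ≤ d)
    (hsep : IsEvenSeparatorRule U d sep) {x : ℝ} (hx : IsPotential U d x) :
    ∃ y : V → ℝ, (∀ b, ∃ x₁ x₂, IsPotential (notBelow U b) d x₁ ∧ IsPotential (below U b) d x₂ ∧
        x₁ + x₂ ≤ y b) ∧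
      (U.card : ℝ) ^ 3 / (40000 * d) ≤ ∑ i ∈ U, ∑ j ∈ U, separatorGain x y (sep i j) := by
  rcases hx with rfl | ⟨v, M, g, h, hg, rfl⟩
  · obtain ⟨v, hv, hchild, hup⟩ := hU.exists_centroid
    have hafter : ∀ b, ∃ x₁ x₂, IsPotential (notBelow U b) d x₁ ∧ IsPotential (below U b) d x₂ ∧
        x₁ + x₂ ≤ mulLogSelfAfter U b := fun b => ⟨_, _, .inl rfl, .inl rfl, le_rfl⟩
    rcases le_or_gt U.card (1024 * (heavy U d v).card) with hH | hH
    · exact ⟨_, hafter, mulLogSelf_sum_gain_of_heavy hd hsep hv hchild hup hH⟩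
    by_cases hB : ∃ c ∈ U, v ⋖ c ∧ U.card ^ 2 ≤ (below U c).card ^ 2 * d
    · obtain ⟨c, hc, hvc, hB⟩ := hB
      exact ⟨_, hafter, mulLogSelf_sum_gain_of_child hF hU hd hsep hv hc hvc (hchild c hc hvc) hB hH⟩
    push Not at hB
    obtain ⟨h256, hdm⟩ := hU.le_of_card_heavy_lt hv hm hd (hD v) hH
    have hsum := card_below_add_card_notBelow U v
    have h : IsStar U d U.card v := ⟨hv, h256, hdm, le_rfl, by omega, hup,
      fun c hc hvc => (hB c hc hvc).le⟩
    -- With this reference level the star potential starts at or below `m log m`, so a gain measured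
    -- from it is a gain from `m log m`.
    set g := starLevel d U.card (notBelow U v).card (neighbors U v).card with hgdef
    have hg : g ≤ Real.log (d + 1) := starLevel_le (hD v) (by omega)
    refine ⟨starPotentialAfter U d U.card v g, h.exists_potential_after (hD v) hg, ?_⟩
    refine (h.sum_gain hF hU hm (hD v) hsep g).trans ?_
    refine Finset.sum_le_sum fun i _ => Finset.sum_le_sum fun j _ => ?_
    have hle : starPotentialOf U d U.card v g ≤ mulLogSelf U.card :=
      starPotential_le_mulLogSelf hup
    cases sep i j with
    | none => exact le_rfl
    | some e => exact sub_le_sub_right hle _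
  · exact ⟨starPotentialAfter U d M v g, h.exists_potential_after (hD v) hg,
      h.sum_gain hF hU hm (hD v) hsep g⟩

end PotentialStep

/-! ### Expected time and guaranteed properties of randomized computations -/

namespace Comp

variable {α β : Type}

/-- The joint law of the output and the time of a computation. -/
noncomputable def toPMF (x : Comp α) : PMF (Option α × ℕ) := x

lemma toPMF_bind (x : Comp α) (f : α → Comp β) :
    toPMF (x >>= f) = (toPMF x).bind fun r =>
      match r with
      | (none, c) => PMF.pure (none, c)
      | (some a, c) => PMF.map (fun s => (s.1, c + s.2)) (toPMF (f a)) := rfl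

lemma toPMF_pure (a : α) : toPMF (pure a : Comp α) = PMF.pure (some a, 0) := rfl

lemma toPMF_lift (x : Timed α) : toPMF (lift x) = PMF.pure (some x.val, x.time) := rfl

lemma toPMF_interrupt : toPMF (interrupt : Comp α) = PMF.pure (none, 0) := rfl

lemma toPMF_pick {V : Type} [DecidableEq V] {vs : List V} (h : vs.toFinset.Nonempty) :
    toPMF (pick vs) = PMF.map (fun v => (some v, 1)) (PMF.uniformOfFinset vs.toFinset h) :=
  dif_pos h

/-- The expected time of a computation. -/
noncomputable def etime (x : Comp α) : ℝ≥0∞ :=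
  ∑' r : Option α × ℕ, toPMF x r * (r.2 : ℝ≥0∞)

/-- Every possible result of the computation has the property `P`. -/
def Ensures (x : Comp α) (P : Option α → ℕ → Prop) : Prop :=
  ∀ r ∈ (toPMF x).support, P r.1 r.2

lemma tsum_bind_mul {γ δ : Type} (p : PMF γ) (f : γ → PMF δ) (g : δ → ℝ≥0∞) :
    ∑' b, (p.bind f) b * g b = ∑' a, p a * ∑' b, f a b * g b := by
  simp only [PMF.bind_apply, ← ENNReal.tsum_mul_right, ← ENNReal.tsum_mul_left]
  rw [ENNReal.tsum_comm]
  simp only [mul_assoc]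

lemma tsum_pure_mul {γ : Type} (a : γ) (g : γ → ℝ≥0∞) : ∑' b, (PMF.pure a) b * g b = g a := by
  rw [tsum_eq_single a]
  · simp
  · intro b hb
    simp [PMF.pure_apply, hb]

lemma tsum_map_mul {γ δ : Type} (p : PMF γ) (f : γ → δ) (g : δ → ℝ≥0∞) :
    ∑' b, (p.map f) b * g b = ∑' a, p a * g (f a) := by
  rw [PMF.map, tsum_bind_mul]
  simp only [Function.comp_apply, tsum_pure_mul]

lemma etime_bind (x : Comp α) (f : α → Comp β) :
    etime (x >>= f) = ∑' r : Option α × ℕ, toPMF x r *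
      (r.2 + match r.1 with
        | none => 0
        | some a => etime (f a)) := by
  unfold etime
  rw [toPMF_bind, tsum_bind_mul]
  congr 1
  ext ⟨o, c⟩
  congr 1
  cases o with
  | none => simp only [tsum_pure_mul, add_zero]
  | some a =>
    simp only [tsum_map_mul, Nat.cast_add, mul_add, ENNReal.tsum_add]
    congr 1
    rw [ENNReal.tsum_mul_right, PMF.tsum_coe, one_mul]

lemma etime_pure (a : α) : etime (pure a : Comp α) = 0 := by
  rw [etime, toPMF_pure, tsum_pure_mul]
  simp

lemma etime_interrupt : etime (interrupt : Comp α) = 0 := by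
  rw [etime, toPMF_interrupt, tsum_pure_mul]
  simp

lemma etime_lift_bind (x : Timed α) (f : α → Comp β) :
    etime (lift x >>= f) = x.time + etime (f x.val) := by
  rw [etime_bind, toPMF_lift, tsum_pure_mul]

lemma etime_bind_le (x : Comp α) (f : α → Comp β) {B : ℝ≥0∞}
    (h : Ensures x fun o _ => ∀ a, o = some a → etime (f a) ≤ B) :
    etime (x >>= f) ≤ etime x + B := by
  rw [etime_bind]
  have hB : B = ∑' r : Option α × ℕ, toPMF x r * B := by
    rw [ENNReal.tsum_mul_right, PMF.tsum_coe, one_mul]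
  conv_rhs => rw [hB, etime]
  rw [← ENNReal.tsum_add]
  refine ENNReal.tsum_le_tsum fun r => ?_
  rw [← mul_add]
  by_cases hr : toPMF x r = 0
  · simp [hr]
  have hr' := h r ((PMF.mem_support_iff _ _).2 hr)
  gcongr
  obtain ⟨o, c⟩ := r
  cases o with
  | none => exact zero_le
  | some a => exact hr' a rfl

lemma etime_pick_bind_le {V : Type} [DecidableEq V] {vs : List V} (h : vs.toFinset.Nonempty)
    (f : V → Comp β) {g : V → ℝ} (hg : ∀ v ∈ vs.toFinset, 0 ≤ g v)
    (hf : ∀ v ∈ vs.toFinset, etime (f v) ≤ ENNReal.ofReal (g v)) :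
    etime (pick vs >>= f) ≤
      ENNReal.ofReal (1 + (∑ v ∈ vs.toFinset, g v) / vs.toFinset.card) := by
  have hc : (0 : ℝ) < vs.toFinset.card := by exact_mod_cast h.card_pos
  have hsum : 0 ≤ (∑ v ∈ vs.toFinset, g v) / vs.toFinset.card :=
    div_nonneg (Finset.sum_nonneg hg) hc.le
  rw [etime_bind, toPMF_pick h, tsum_map_mul]
  simp only [Nat.cast_one, mul_add, mul_one]
  rw [ENNReal.tsum_add, PMF.tsum_coe, ENNReal.ofReal_add zero_le_one hsum, ENNReal.ofReal_one]
  gcongr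
  rw [tsum_eq_sum (s := vs.toFinset) fun v hv => by
    rw [PMF.uniformOfFinset_apply_of_notMem _ hv, zero_mul]]
  rw [ENNReal.ofReal_div_of_pos hc, ENNReal.ofReal_sum_of_nonneg hg, ENNReal.ofReal_natCast,
    div_eq_mul_inv, Finset.sum_mul]
  refine Finset.sum_le_sum fun v hv => ?_
  rw [PMF.uniformOfFinset_apply_of_mem _ hv, mul_comm]
  gcongr
  exact hf v hv

lemma Ensures.mono {x : Comp α} {P P' : Option α → ℕ → Prop} (h : Ensures x P)
    (hP : ∀ o t, P o t → P' o t) : Ensures x P' := fun r hr => hP _ _ (h r hr)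

lemma ensures_bind {x : Comp α} {f : α → Comp β} {P : Option β → ℕ → Prop}
    (h : Ensures x fun o c => (o = none → P none c) ∧
      ∀ a, o = some a → Ensures (f a) fun o' t => P o' (c + t)) : Ensures (x >>= f) P := by
  intro r hr
  rw [toPMF_bind, PMF.mem_support_bind_iff] at hr
  obtain ⟨⟨o, c⟩, ho, hr⟩ := hr
  have h1 := h _ ho
  cases o with
  | none =>
    obtain rfl : r = (none, c) := by simpa using hr
    exact h1.1 rfl
  | some a =>
    simp only [PMF.mem_support_map_iff] at hr
    obtain ⟨s, hs, rfl⟩ := hr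
    exact h1.2 a rfl s hs

lemma ensures_pure {a : α} {P : Option α → ℕ → Prop} (h : P (some a) 0) :
    Ensures (pure a : Comp α) P := by
  intro r hr
  rw [toPMF_pure, PMF.mem_support_pure_iff] at hr
  subst hr
  exact h

lemma ensures_lift {x : Timed α} {P : Option α → ℕ → Prop} (h : P (some x.val) x.time) :
    Ensures (lift x) P := by
  intro r hr
  rw [toPMF_lift, PMF.mem_support_pure_iff] at hr
  subst hr
  exact h

lemma ensures_interrupt {P : Option α → ℕ → Prop} (h : P none 0) :
    Ensures (interrupt : Comp α) P := by
  intro r hr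
  rw [toPMF_interrupt, PMF.mem_support_pure_iff] at hr
  subst hr
  exact h

lemma ensures_lift_bind {x : Timed α} {f : α → Comp β} {P : Option β → ℕ → Prop}
    (h : Ensures (f x.val) fun o t => P o (x.time + t)) : Ensures (lift x >>= f) P := by
  refine ensures_bind (ensures_lift ⟨fun h => by simp at h, ?_⟩)
  rintro a ⟨⟩
  exact h

lemma ensures_pick_bind {V : Type} [DecidableEq V] {vs : List V} (hvs : vs.toFinset.Nonempty)
    {f : V → Comp β} {P : Option β → ℕ → Prop}
    (h : ∀ v ∈ vs, Ensures (f v) fun o t => P o (1 + t)) : Ensures (pick vs >>= f) P := by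
  refine ensures_bind fun r hr => ?_
  rw [toPMF_pick hvs, PMF.mem_support_map_iff] at hr
  obtain ⟨v, hv, rfl⟩ := hr
  rw [PMF.mem_support_uniformOfFinset_iff, List.mem_toFinset] at hv
  refine ⟨fun h => by simp at h, ?_⟩
  rintro a ⟨⟩
  exact h v hv

end Comp

/-! ### Correctness and expected time of the recursion -/

section Reconstruct

open Timed

variable {V : Type} [PartialOrder V]

/-- `E` lists every edge of the tree with node set `U` exactly once. -/
structure IsEdgeList (U : Finset V) (E : List (V × V)) : Prop where
  nodup : E.Nodup
  mem_iff : ∀ i j, (i, j) ∈ E ↔ i ∈ U ∧ j ∈ U ∧ i ⋖ j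
  length_eq : E.length + 1 = U.card

lemma IsEdgeList.nil {U : Finset V} (h : U.card = 1) : IsEdgeList U [] where
  nodup := List.nodup_nil
  mem_iff i j := by
    obtain ⟨a, rfl⟩ := Finset.card_eq_one.1 h
    simp only [List.not_mem_nil, Finset.mem_singleton, false_iff]
    rintro ⟨rfl, rfl, h⟩
    exact h.lt.false
  length_eq := by simp [h]

/-- Every edge other than the separator stays inside one of the two parts: by the chain property an
edge into `below U b` from outside has lower end `b`, and the parent of `b` is unique. -/
lemma IsEdgeList.append (hF : ∀ a b c : V, a ≤ c → b ≤ c → a ≤ b ∨ b ≤ a) {U : Finset V}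
    {a b : V} (ha : a ∈ U) (hb : b ∈ U) (hab : a ⋖ b) {E₁ E₂ : List (V × V)}
    (h₁ : IsEdgeList (notBelow U b) E₁) (h₂ : IsEdgeList (below U b) E₂) :
    IsEdgeList U (E₁ ++ E₂ ++ [(a, b)]) where
  nodup := by
    rw [List.nodup_append, List.nodup_append]
    refine ⟨⟨h₁.nodup, h₂.nodup, ?_⟩, List.nodup_singleton _, ?_⟩
    · rintro ⟨i, j⟩ hx y hy rfl
      rw [h₁.mem_iff] at hx
      rw [h₂.mem_iff] at hy
      exact (mem_notBelow.1 hx.1).2 (mem_below.1 hy.1).2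
    · rintro ⟨i, j⟩ hx y hy rfl
      rw [List.mem_singleton, Prod.mk.injEq] at hy
      obtain ⟨rfl, rfl⟩ := hy
      rw [List.mem_append, h₁.mem_iff, h₂.mem_iff] at hx
      rcases hx with hx | hx
      · exact (mem_notBelow.1 hx.2.1).2 le_rfl
      · exact hab.lt.not_ge (mem_below.1 hx.1).2
  mem_iff i j := by
    rw [List.mem_append, List.mem_append, h₁.mem_iff, h₂.mem_iff, List.mem_singleton,
      Prod.mk.injEq]
    simp only [mem_below, mem_notBelow]
    constructor
    · rintro ((h | h) | ⟨rfl, rfl⟩)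
      · exact ⟨h.1.1, h.2.1.1, h.2.2⟩
      · exact ⟨h.1.1, h.2.1.1, h.2.2⟩
      · exact ⟨ha, hb, hab⟩
    · rintro ⟨hi, hj, hij⟩
      by_cases hbi : b ≤ i
      · exact .inl (.inr ⟨⟨hi, hbi⟩, ⟨hj, hbi.trans hij.le⟩, hij⟩)
      by_cases hbj : b ≤ j
      · right
        have hjb : j = b := by
          rcases hF _ _ _ hbj hij.le with h | h
          · exact absurd h hbi
          · by_contra hne
            exact hij.2 (lt_of_le_not_ge h hbi) (lt_of_le_of_ne hbj (Ne.symm hne))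
        subst hjb
        refine ⟨?_, rfl⟩
        rcases hF _ _ _ hij.le hab.le with h | h
        · exact h.eq_or_lt.resolve_right fun h' => hij.2 h' hab.lt
        · exact (h.eq_or_lt.resolve_right fun h' => hab.2 h' hij.lt).symm
      · exact .inl (.inl ⟨⟨hi, hbi⟩, ⟨hj, hbj⟩, hij⟩)
  length_eq := by
    have := h₁.length_eq
    have := h₂.length_eq
    have := card_below_add_card_notBelow U b
    simp only [List.length_append, List.length_singleton]
    omega

variable [DecidableEq V] {Q : V → V → Timed Bool}

open Classical in
lemma splitTree_val (hQ : ∀ i j, (Q i j).val = true ↔ i < j) (b : V) (vs : List V) :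
    (splitTree Q b vs).val = (vs.filter fun k => ¬ b ≤ k, vs.filter fun k => b ≤ k) := by
  induction vs with
  | nil => rfl
  | cons k ks ih =>
    by_cases hk : k = b
    · subst hk
      simp [splitTree, val_bind, ih]
    · have h : (Q b k).val = decide (b ≤ k) := by
        rw [Bool.eq_iff_iff, hQ, decide_eq_true_iff]
        exact ⟨le_of_lt, fun h => lt_of_le_of_ne h (Ne.symm hk)⟩
      simp only [splitTree, val_bind, if_neg hk, h, ih]
      by_cases hb : b ≤ k <;> simp [hb]

omit [PartialOrder V] in
lemma splitTree_time_le (hT : ∀ i j, (Q i j).time = 1) (b : V) (vs : List V) :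
    (splitTree Q b vs).time ≤ 2 * vs.length := by
  induction vs with
  | nil => simp [splitTree]
  | cons k ks ih =>
    simp only [splitTree, time_bind, time_ite, time_tick, time_pure, hT, List.length_cons]
    split_ifs <;> omega

lemma exists_splitTree_val (hQ : ∀ i j, (Q i j).val = true ↔ i < j) (b : V) {vs : List V}
    (hvs : vs.Nodup) : ∃ v₁ v₂, (splitTree Q b vs).val = (v₁, v₂) ∧ v₁.Nodup ∧ v₂.Nodup ∧
      v₁.toFinset = notBelow vs.toFinset b ∧ v₂.toFinset = below vs.toFinset b := by
  classical
  refine ⟨_, _, splitTree_val hQ b vs, hvs.filter _, hvs.filter _, ?_, ?_⟩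
  · ext k; simp
  · ext k; simp

/-- The result of a round: another round or the two recursive calls. -/
noncomputable def afterRound (Q : V → V → Timed Bool) (d f : ℕ) (vs : List V) :
    Option (V × V) → Comp (List (V × V))
  | none => reconstructTree Q d f vs
  | some e => do
    let v ← Comp.lift (splitTree Q e.2 vs)
    let e₁ ← reconstructTree Q d f v.1
    let e₂ ← reconstructTree Q d f v.2
    Comp.lift (tick (e₁.length + e₂.length + 1))
    return e₁ ++ e₂ ++ [e]

omit [PartialOrder V] in
lemma reconstructTree_succ_of_one (d f : ℕ) {vs : List V} (h : vs.length = 1) :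
    reconstructTree Q d (f + 1) vs = (do Comp.lift (tick 1); pure []) := by
  rw [reconstructTree]
  simp only [h, if_true]

omit [PartialOrder V] in
lemma reconstructTree_succ (d f : ℕ) {vs : List V} (h : vs.length ≠ 1) :
    reconstructTree Q d (f + 1) vs = (do
      Comp.lift (tick 1)
      let i ← Comp.pick vs
      let j ← Comp.pick vs
      let sep ← Comp.lift (findEvenSeparator Q d vs i j)
      afterRound Q d f vs sep) := by
  rw [reconstructTree]
  simp only [h, if_false]
  refine congrArg _ (funext fun _ => congrArg _ (funext fun i => congrArg _ (funext fun j =>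
    congrArg _ (funext fun s => ?_))))
  cases s <;> rfl

/-- An interrupted run has taken at least as much time as its nesting depth, and every output lists
the edges of the tree. -/
def IsCorrectRun (U : Finset V) (f : ℕ) (o : Option (List (V × V))) (t : ℕ) : Prop :=
  (o = none → f ≤ t) ∧ ∀ E, o = some E → IsEdgeList U E

omit [DecidableEq V] in
lemma IsSubtree.card_pos {U : Finset V} (hU : IsSubtree U) : 0 < U.card := by
  obtain ⟨r, hr, -⟩ := hU.exists_root
  exact Finset.card_pos.2 ⟨r, hr⟩

/-- Each nesting level spends a unit before it descends, so the time of an interrupted run is at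
least the depth reached. This is what turns bounds on the expected time into bounds on the
probability of interruption. -/
theorem ensures_reconstructTree (hQ : ∀ i j, (Q i j).val = true ↔ i < j)
    (hF : ∀ a b c : V, a ≤ c → b ≤ c → a ≤ b ∨ b ≤ a) (d f : ℕ) {vs : List V} (hvs : vs.Nodup)
    (hU : IsSubtree vs.toFinset) :
    Comp.Ensures (reconstructTree Q d f vs) (IsCorrectRun vs.toFinset f) := by
  induction f generalizing vs with
  | zero =>
    rw [reconstructTree]
    exact Comp.ensures_interrupt ⟨fun _ => le_rfl, fun E h => by simp at h⟩
  | succ f ih =>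
    have hcard : vs.toFinset.card = vs.length := List.toFinset_card_of_nodup hvs
    by_cases h1 : vs.length = 1
    · rw [reconstructTree_succ_of_one d f h1]
      refine Comp.ensures_lift_bind (Comp.ensures_pure ⟨fun h => by simp at h, ?_⟩)
      rintro E ⟨⟩
      exact IsEdgeList.nil (hcard.trans h1)
    rw [reconstructTree_succ d f h1]
    have hne : vs.toFinset.Nonempty := Finset.card_pos.1 hU.card_pos
    refine Comp.ensures_lift_bind (Comp.ensures_pick_bind hne fun i hi =>
      Comp.ensures_pick_bind hne fun j hj => Comp.ensures_lift_bind ?_)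
    have hrule := isEvenSeparatorRule_findEvenSeparator hQ hF d hvs hU
    have hmono : ∀ {c t : ℕ} {o : Option (List (V × V))}, 1 ≤ c →
        IsCorrectRun vs.toFinset f o t → IsCorrectRun vs.toFinset (f + 1) o (c + t) :=
      fun hc h => ⟨fun ho => by have := h.1 ho; omega, h.2⟩
    rcases he : (findEvenSeparator Q d vs i j).val with _ | e
    · refine (ih hvs hU).mono fun o t h => ?_
      refine ⟨fun ho => ?_, h.2⟩
      have := h.1 ho
      simp only [time_tick]
      omega
    · obtain ⟨ha, hb, hab, -, -⟩ := hrule.even i (by simpa using hi) j (by simpa using hj) e he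
      obtain ⟨v₁, v₂, hv, hn₁, hn₂, hv₁, hv₂⟩ := exists_splitTree_val hQ e.2 hvs
      have ih₁ := ih hn₁ (by rw [hv₁]; exact isSubtree_notBelow hU ha hab.lt)
      have ih₂ := ih hn₂ (by rw [hv₂]; exact isSubtree_below hU hb)
      rw [hv₁] at ih₁
      rw [hv₂] at ih₂
      simp only [afterRound]
      refine Comp.ensures_lift_bind ?_
      rw [hv]
      refine Comp.ensures_bind (ih₁.mono fun o₁ t₁ h₁ => ⟨fun ho => ?_, fun E₁ hE₁ => ?_⟩)
      · refine ⟨fun _ => ?_, fun E h => by simp at h⟩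
        have := h₁.1 ho
        simp only [time_tick]
        omega
      refine Comp.ensures_bind (ih₂.mono fun o₂ t₂ h₂ => ⟨fun ho => ?_, fun E₂ hE₂ => ?_⟩)
      · refine ⟨fun _ => ?_, fun E h => by simp at h⟩
        have := h₂.1 ho
        simp only [time_tick]
        omega
      refine Comp.ensures_lift_bind (Comp.ensures_pure ⟨fun h => by simp at h, ?_⟩)
      rintro E ⟨⟩
      exact (h₁.2 E₁ hE₁).append hF ha hb hab (h₂.2 E₂ hE₂)

/-- A bound on the time of a round and of the assembly of its output. -/
lemma overhead_le {m c : ℕ} (hm : 2 ≤ m) :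
    3 + ((13 * m * c + 19 * m + 7) + 2 * m + m) ≤ 27 * m * (c + 1) := by
  nlinarith

lemma afterRound_some_etime_le (hQ : ∀ i j, (Q i j).val = true ↔ i < j)
    (hT : ∀ i j, (Q i j).time = 1)
    (hF : ∀ a b c : V, a ≤ c → b ≤ c → a ≤ b ∨ b ≤ a) (d f : ℕ) {vs : List V}
    (hU : IsSubtree vs.toFinset) {e : V × V} (he₁ : e.1 ∈ vs) (he₂ : e.2 ∈ vs) (he : e.1 ⋖ e.2)
    {v₁ v₂ : List V} (hv : (splitTree Q e.2 vs).val = (v₁, v₂)) (hvs : vs.Nodup) (hn₁ : v₁.Nodup)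
    (hn₂ : v₂.Nodup) (hv₁ : v₁.toFinset = notBelow vs.toFinset e.2)
    (hv₂ : v₂.toFinset = below vs.toFinset e.2) :
    Comp.etime (afterRound Q d f vs (some e)) ≤ (2 * vs.length + vs.length : ℕ) +
      (Comp.etime (reconstructTree Q d f v₁) + Comp.etime (reconstructTree Q d f v₂)) := by
  have hcard : vs.toFinset.card = vs.length := List.toFinset_card_of_nodup hvs
  have hs₁ : IsSubtree v₁.toFinset := by
    rw [hv₁]; exact isSubtree_notBelow hU (by simpa using he₁) he.lt
  have hs₂ : IsSubtree v₂.toFinset := by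
    rw [hv₂]; exact isSubtree_below hU (by simpa using he₂)
  have h₁ := ensures_reconstructTree hQ hF d f hn₁ hs₁
  have h₂ := ensures_reconstructTree hQ hF d f hn₂ hs₂
  have hsum := card_below_add_card_notBelow vs.toFinset e.2
  rw [← hv₁, ← hv₂, hcard] at hsum
  simp only [afterRound]
  rw [Comp.etime_lift_bind, hv]
  have hsplit := splitTree_time_le hT e.2 vs
  have hlast : Comp.etime (reconstructTree Q d f v₁ >>= fun e₁ =>
      reconstructTree Q d f v₂ >>= fun e₂ =>
        Comp.lift (tick (e₁.length + e₂.length + 1)) >>= fun _ => pure (e₁ ++ e₂ ++ [e])) ≤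
      Comp.etime (reconstructTree Q d f v₁) +
        (Comp.etime (reconstructTree Q d f v₂) + (vs.length : ℕ)) := by
    refine Comp.etime_bind_le _ _ (h₁.mono fun o₁ _ hr₁ E₁ hE₁ => ?_)
    refine Comp.etime_bind_le _ _ (h₂.mono fun o₂ _ hr₂ E₂ hE₂ => ?_)
    have l₁ := (hr₁.2 E₁ hE₁).length_eq
    have l₂ := (hr₂.2 E₂ hE₂).length_eq
    rw [Comp.etime_lift_bind, Comp.etime_pure, add_zero]
    simp only [time_tick]
    exact_mod_cast (by omega : E₁.length + E₂.length + 1 ≤ vs.length)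
  refine (add_le_add (Nat.cast_le.2 hsplit) hlast).trans (le_of_eq ?_)
  push_cast
  ring

/-- The expected time of the reconstruction of a tree is bounded by its potential. -/
theorem etime_reconstructTree_le [Finite V] (hQ : ∀ i j, (Q i j).val = true ↔ i < j)
    (hT : ∀ i j, (Q i j).time = 1)
    (hF : ∀ a b c : V, a ≤ c → b ≤ c → a ≤ b ∨ b ≤ a) {d : ℕ} (hd : 2 ≤ d) {N : ℕ} (f : ℕ)
    {vs : List V} (hvs : vs.Nodup) (hU : IsSubtree vs.toFinset) (hN : vs.length ≤ N)
    (hD : ∀ v, (neighbors vs.toFinset v).card ≤ d) {x : ℝ} (hx : IsPotential vs.toFinset d x) :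
    Comp.etime (reconstructTree Q d f vs) ≤
      ENNReal.ofReal (40000 * 27 * d * (Nat.clog 2 N + 1) * x + vs.length) := by
  -- The potential varies in the induction: a failed round keeps `x`, a cut replaces it by two new
  -- ones.
  induction f generalizing vs x with
  | zero =>
    rw [reconstructTree, Comp.etime_interrupt]
    exact zero_le
  | succ f ih =>
    have hcard : vs.toFinset.card = vs.length := List.toFinset_card_of_nodup hvs
    set A : ℝ := 40000 * 27 * d * (Nat.clog 2 N + 1) with hA
    have hA0 : 0 ≤ A := by positivity
    have hx0 := hx.nonneg hD
    -- A single node takes one unit although its potential may be `0`; the summand `vs.length` in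
    -- the bound pays for this and is additive under cuts.
    by_cases h1 : vs.length = 1
    · rw [reconstructTree_succ_of_one d f h1, Comp.etime_lift_bind, Comp.etime_pure, h1]
      simp only [time_tick, Nat.cast_one, add_zero]
      rw [← ENNReal.ofReal_one]
      exact ENNReal.ofReal_le_ofReal (by nlinarith)
    have hpos := hU.card_pos
    have hne : vs.toFinset.Nonempty := Finset.card_pos.1 hpos
    have hm : 2 ≤ vs.length := by omega
    have hmR : (0 : ℝ) < vs.toFinset.card := by exact_mod_cast hpos
    have hdR : (0 : ℝ) < d := by exact_mod_cast (show 0 < d by omega)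
    have hrule := isEvenSeparatorRule_findEvenSeparator hQ hF d hvs hU
    obtain ⟨y, hy, hgain⟩ := hx.exists_sum_gain hF hU (by omega) hd hD hrule
    set R : ℕ := (13 * vs.length * Nat.clog 2 vs.length + 19 * vs.length + 7) +
      2 * vs.length + vs.length with hR
    set sep : V → V → Option (V × V) := fun i j => (findEvenSeparator Q d vs i j).val with hsep
    -- The bound on the expected time that remains after a round with choices `i`, `j`. The cost `R`
    -- is charged to every round, including failed ones, which neither split nor assemble.
    set next : V → V → ℝ := fun i j =>
      A * (x - separatorGain x y (sep i j)) + vs.length with hnext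
    have hstep : ∀ i ∈ vs.toFinset, ∀ j ∈ vs.toFinset, 0 ≤ next i j ∧
        Comp.etime (Comp.lift (findEvenSeparator Q d vs i j) >>= afterRound Q d f vs) ≤
          ENNReal.ofReal (R + next i j) := by
      intro i hi j hj
      have htime := findEvenSeparator_time_le hQ hT hF d hvs hU (List.mem_toFinset.1 hi)
        (List.mem_toFinset.1 hj)
      rw [Comp.etime_lift_bind]
      rcases he : (findEvenSeparator Q d vs i j).val with _ | e
      · have hn : next i j = A * x + vs.length := by
          simp only [hnext, hsep, he, separatorGain, sub_zero]
        have hn0 : 0 ≤ next i j := by rw [hn]; positivity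
        refine ⟨hn0, ?_⟩
        rw [ENNReal.ofReal_add (by positivity) hn0, ENNReal.ofReal_natCast, hn]
        refine add_le_add (Nat.cast_le.2 (by omega)) (ih hvs hU hN hD hx)
      · obtain ⟨ha, hb, hab, -, -⟩ := hrule.even i hi j hj e he
        obtain ⟨v₁, v₂, hv, hn₁, hn₂, hv₁, hv₂⟩ := exists_splitTree_val hQ e.2 hvs
        obtain ⟨x₁, x₂, hx₁, hx₂, hxy⟩ := hy e.2
        have hsub₁ : notBelow vs.toFinset e.2 ⊆ vs.toFinset := fun k hk => (mem_notBelow.1 hk).1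
        have hsub₂ : below vs.toFinset e.2 ⊆ vs.toFinset := fun k hk => (mem_below.1 hk).1
        have hsum := card_below_add_card_notBelow vs.toFinset e.2
        have hl₁ : v₁.length = (notBelow vs.toFinset e.2).card := by
          rw [← hv₁, List.toFinset_card_of_nodup hn₁]
        have hl₂ : v₂.length = (below vs.toFinset e.2).card := by
          rw [← hv₂, List.toFinset_card_of_nodup hn₂]
        have hD₁ : ∀ v, (neighbors (notBelow vs.toFinset e.2) v).card ≤ d := fun v =>
          (Finset.card_le_card (neighbors_mono hsub₁ v)).trans (hD v)
        have hD₂ : ∀ v, (neighbors (below vs.toFinset e.2) v).card ≤ d := fun v =>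
          (Finset.card_le_card (neighbors_mono hsub₂ v)).trans (hD v)
        have ih₁ := ih hn₁ (by rw [hv₁]; exact isSubtree_notBelow hU ha hab.lt) (by omega)
          (by rwa [hv₁]) (x := x₁) (by rwa [hv₁])
        have ih₂ := ih hn₂ (by rw [hv₂]; exact isSubtree_below hU hb) (by omega)
          (by rwa [hv₂]) (x := x₂) (by rwa [hv₂])
        have hx₁0 := hx₁.nonneg hD₁
        have hx₂0 := hx₂.nonneg hD₂
        have hn : next i j = A * y e.2 + vs.length := by
          simp only [hnext, hsep, he, separatorGain, sub_sub_cancel]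
        have hlen : (v₁.length + v₂.length : ℝ) = vs.length := by
          exact_mod_cast (by omega : v₁.length + v₂.length = vs.length)
        have hle : (A * x₁ + v₁.length) + (A * x₂ + v₂.length) ≤ next i j := by
          rw [hn]
          have := mul_le_mul_of_nonneg_left hxy hA0
          linarith
        have hn0 : 0 ≤ next i j := le_trans (by positivity) hle
        refine ⟨hn0, ?_⟩
        have h2 := afterRound_some_etime_le hQ hT hF d f hU (by simpa using ha) (by simpa using hb)
          hab hv hvs hn₁ hn₂ hv₁ hv₂
        rw [ENNReal.ofReal_add (by positivity) hn0, ENNReal.ofReal_natCast]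
        calc _ ≤ ((13 * vs.length * Nat.clog 2 vs.length + 19 * vs.length + 7 : ℕ) : ℝ≥0∞) +
              ((2 * vs.length + vs.length : ℕ) + (ENNReal.ofReal (A * x₁ + v₁.length) +
                ENNReal.ofReal (A * x₂ + v₂.length))) :=
              add_le_add (Nat.cast_le.2 htime) (h2.trans (add_le_add le_rfl (add_le_add ih₁ ih₂)))
          _ = (R : ℝ≥0∞) + (ENNReal.ofReal (A * x₁ + v₁.length) +
                ENNReal.ofReal (A * x₂ + v₂.length)) := by
              rw [← add_assoc, ← Nat.cast_add, hR, add_assoc _ (2 * vs.length)]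
          _ ≤ _ := by
              rw [← ENNReal.ofReal_add (by positivity) (by positivity)]
              exact add_le_add le_rfl (ENNReal.ofReal_le_ofReal hle)
    have hinner : ∀ i ∈ vs.toFinset,
        0 ≤ 1 + (∑ j ∈ vs.toFinset, (R + next i j)) / vs.toFinset.card ∧
        Comp.etime (Comp.pick vs >>= fun j => Comp.lift (findEvenSeparator Q d vs i j) >>=
          afterRound Q d f vs) ≤
          ENNReal.ofReal (1 + (∑ j ∈ vs.toFinset, (R + next i j)) / vs.toFinset.card) := by
      intro i hi
      have h0 : ∀ j ∈ vs.toFinset, 0 ≤ R + next i j := fun j hj =>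
        add_nonneg (Nat.cast_nonneg _) (hstep i hi j hj).1
      refine ⟨add_nonneg zero_le_one (div_nonneg (Finset.sum_nonneg h0) hmR.le), ?_⟩
      exact Comp.etime_pick_bind_le hne _ h0 fun j hj => (hstep i hi j hj).2
    rw [reconstructTree_succ d f h1, Comp.etime_lift_bind]
    have houter := Comp.etime_pick_bind_le hne _ (fun i hi => (hinner i hi).1)
      fun i hi => (hinner i hi).2
    refine (add_le_add le_rfl houter).trans ?_
    simp only [time_tick, Nat.cast_one]
    have hS0 : 0 ≤ 1 + (∑ i ∈ vs.toFinset,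
        (1 + (∑ j ∈ vs.toFinset, (R + next i j)) / vs.toFinset.card)) / vs.toFinset.card :=
      add_nonneg zero_le_one (div_nonneg (Finset.sum_nonneg fun i hi => (hinner i hi).1) hmR.le)
    rw [← ENNReal.ofReal_one, ← ENNReal.ofReal_add zero_le_one hS0]
    refine ENNReal.ofReal_le_ofReal ?_
    have hsum : (∑ i ∈ vs.toFinset,
        (1 + (∑ j ∈ vs.toFinset, (R + next i j)) / vs.toFinset.card)) / vs.toFinset.card =
        1 + R + A * x + vs.length - A * (∑ i ∈ vs.toFinset, ∑ j ∈ vs.toFinset,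
          separatorGain x y (sep i j)) / (vs.toFinset.card : ℝ) ^ 2 := by
      simp only [hnext, mul_sub, Finset.sum_add_distrib, Finset.sum_sub_distrib, Finset.sum_const,
        nsmul_eq_mul, ← Finset.sum_div, ← Finset.mul_sum]
      field_simp
      ring
    rw [hsum]
    -- Averaged over the pairs, the potential falls by at least `m / (40000 d)`; times `A` this is
    -- just the cost of a round.
    have hdrop : A * ((vs.toFinset.card : ℝ) ^ 3 / (40000 * d)) / (vs.toFinset.card : ℝ) ^ 2 ≤
        A * (∑ i ∈ vs.toFinset, ∑ j ∈ vs.toFinset,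
          separatorGain x y (sep i j)) / (vs.toFinset.card : ℝ) ^ 2 := by
      gcongr
    have hdrop' : A * ((vs.toFinset.card : ℝ) ^ 3 / (40000 * d)) / (vs.toFinset.card : ℝ) ^ 2 =
        27 * vs.length * (Nat.clog 2 N + 1) := by
      rw [hcard, hA]
      have : (vs.length : ℝ) ≠ 0 := by rw [← hcard]; exact hmR.ne'
      field_simp
    have hover : (3 + R : ℝ) ≤ 27 * vs.length * (Nat.clog 2 N + 1) := by
      have h2 := overhead_le (c := Nat.clog 2 vs.length) hm
      have h3 : 27 * vs.length * (Nat.clog 2 vs.length + 1) ≤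
          27 * vs.length * (Nat.clog 2 N + 1) := by
        gcongr
      exact_mod_cast h2.trans h3
    rw [hdrop'] at hdrop
    linarith

end Reconstruct

/-! ### The ancestor order of a directed rooted tree and its path queries -/

section Tree

open Relation

variable {V : Type} {G : Digraph V}

lemma IsDirectedRootedTree.eq_of_adj (h : IsDirectedRootedTree G) {u u' v : V} (hu : G.Adj u v)
    (hu' : G.Adj u' v) : u = u' := by
  obtain ⟨r, hr, hp, -⟩ := h
  exact (hp v fun hv => hr u (hv ▸ hu)).unique hu hu'

/-- A cycle through a node passes through its only parent. Moving up in this way leads to a cycle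
through the root, which has no incoming edge. -/
lemma IsDirectedRootedTree.not_transGen_self (h : IsDirectedRootedTree G) (v : V) :
    ¬ TransGen G.Adj v v := by
  have h' := h
  obtain ⟨r, hr, -, hreach⟩ := h'
  induction hreach v with
  | refl =>
    intro hc
    obtain ⟨u, -, hu⟩ := TransGen.tail'_iff.1 hc
    exact hr u hu
  | @tail v w _ hvw ih =>
    intro hc
    obtain ⟨u, hwu, hu⟩ := TransGen.tail'_iff.1 hc
    obtain rfl := h.eq_of_adj hu hvw
    exact ih (TransGen.head' hvw hwu)

/-- The ancestor order of a directed rooted tree. -/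
abbrev IsDirectedRootedTree.partialOrder (h : IsDirectedRootedTree G) : PartialOrder V where
  le := ReflTransGen G.Adj
  lt := TransGen G.Adj
  le_refl _ := .refl
  le_trans _ _ _ := .trans
  lt_iff_le_not_ge a _ :=
    ⟨fun hab => ⟨hab.to_reflTransGen, fun hba => h.not_transGen_self a (hab.trans_left hba)⟩,
      fun hab => (reflTransGen_iff_eq_or_transGen.1 hab.1).resolve_left
        fun hba => hab.2 (hba ▸ .refl)⟩
  le_antisymm a _ hab hba := (reflTransGen_iff_eq_or_transGen.1 hab).elim Eq.symm
    fun h' => (h.not_transGen_self a (h'.trans_left hba)).elim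

/-- Going upwards from `c` there is at most one choice at each step, so one of `a`, `b` is met after
the other. -/
lemma IsDirectedRootedTree.le_or_le (h : IsDirectedRootedTree G) (a b c : V) :
    letI := h.partialOrder
    a ≤ c → b ≤ c → a ≤ b ∨ b ≤ a := by
  intro hac hbc
  have hac' : ReflTransGen G.Adj a c := hac
  have hbc' : ReflTransGen G.Adj b c := hbc
  rw [← reflTransGen_swap] at hac' hbc'
  rcases ReflTransGen.total_of_right_unique (r := Function.swap G.Adj) (fun _ _ _ => h.eq_of_adj)
    hac' hbc' with h' | h'
  · exact .inr (reflTransGen_swap.1 h')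
  · exact .inl (reflTransGen_swap.1 h')

lemma IsDirectedRootedTree.covBy_iff (h : IsDirectedRootedTree G) (a b : V) :
    letI := h.partialOrder
    a ⋖ b ↔ G.Adj a b := by
  constructor
  · rintro ⟨hab, hc⟩
    obtain ⟨c, hac, hcb⟩ := TransGen.head'_iff.1 hab
    rcases reflTransGen_iff_eq_or_transGen.1 hcb with rfl | hcb
    · exact hac
    · exact absurd hcb (hc (TransGen.single hac))
  · refine fun hab => ⟨TransGen.single hab, fun c hac hcb => ?_⟩
    obtain ⟨u, hcu, hu⟩ := TransGen.tail'_iff.1 hcb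
    obtain rfl := h.eq_of_adj hu hab
    exact h.not_transGen_self u (TransGen.trans_left hac hcu)

lemma IsDirectedRootedTree.isSubtree_univ [Fintype V] (h : IsDirectedRootedTree G) :
    letI := h.partialOrder
    IsSubtree (Finset.univ : Finset V) := by
  let := h.partialOrder
  have h' := h
  obtain ⟨r, -, -, hr⟩ := h'
  exact ⟨⟨r, Finset.mem_univ _, fun k _ => hr k⟩, fun _ _ _ _ _ _ _ => Finset.mem_univ _⟩

lemma IsDirectedRootedTree.card_neighbors_univ_le [Fintype V] (h : IsDirectedRootedTree G)
    (v : V) :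
    letI := h.partialOrder
    (neighbors (Finset.univ : Finset V) v).card ≤ G.totalDegree v := by
  let := h.partialOrder
  have hset : ((neighbors Finset.univ v : Finset V) : Set V) =
      {u | G.Adj v u} ∪ {u | G.Adj u v} := by
    ext u
    rw [Finset.mem_coe, mem_neighbors, h.covBy_iff, h.covBy_iff]
    simp
  rw [← Set.ncard_coe_finset, hset]
  exact Set.ncard_union_le _ _

lemma adj_of_mem_zip_tail {R : V → V → Prop} {l : List V} (h : l.IsChain R) :
    ∀ e ∈ l.zip l.tail, R e.1 e.2 := by
  induction l with
  | nil => simp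
  | cons a l ih =>
    cases l with
    | nil => simp
    | cons b l =>
      rw [List.isChain_cons_cons] at h
      intro e he
      rw [List.tail_cons, List.zip_cons_cons, List.mem_cons] at he
      rcases he with rfl | he
      · exact h.1
      · exact ih h.2 e he

lemma Digraph.IsPathFromTo.exists_eq_cons {i j : V} {l : List V} (h : G.IsPathFromTo i j l) :
    ∃ y l', l = i :: y :: l' ∧ G.Adj i y ∧ (y :: l').IsChain G.Adj ∧
      (y :: l').getLast (List.cons_ne_nil _ _) = j := by
  obtain ⟨h2, hi, hj, hc⟩ := h
  match l, h2 with
  | x :: y :: l', _ =>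
    obtain rfl : x = i := by simpa using hi
    rw [List.isChain_cons_cons] at hc
    refine ⟨y, l', rfl, hc.1, hc.2, ?_⟩
    rw [List.getLast?_eq_some_getLast (List.cons_ne_nil _ _),
      List.getLast_cons (List.cons_ne_nil _ _)] at hj
    exact Option.some.inj hj

lemma Digraph.exists_isPathFromTo_iff {i j : V} :
    (∃ l, G.IsPathFromTo i j l) ↔ TransGen G.Adj i j := by
  constructor
  · rintro ⟨l, hl⟩
    obtain ⟨y, l', -, hy, hc, hj⟩ := hl.exists_eq_cons
    exact TransGen.head' hy (List.relationReflTransGen_of_exists_isChain_cons l' hc hj)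
  · intro h
    obtain ⟨y, hy, hyj⟩ := TransGen.head'_iff.1 h
    obtain ⟨l, hl, hj⟩ := List.exists_isChain_cons_of_relationReflTransGen hyj
    refine ⟨i :: y :: l, by simp, rfl, ?_, List.isChain_cons_cons.2 ⟨hy, hl⟩⟩
    rw [List.getLast?_eq_some_getLast (List.cons_ne_nil _ _),
      List.getLast_cons (List.cons_ne_nil _ _), hj]

variable (T : WeightedRootedTree V)

lemma WeightedRootedTree.additiveQuery_pos_iff (i j : V) :
    0 < T.additiveQuery i j ↔ TransGen T.graph.Adj i j := by
  rw [← Digraph.exists_isPathFromTo_iff, WeightedRootedTree.additiveQuery]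
  split_ifs with h
  · refine iff_of_true ?_ h
    have hp := h.choose_spec
    obtain ⟨y, l', hl, -⟩ := hp.exists_eq_cons
    have hchain := adj_of_mem_zip_tail hp.2.2.2
    refine List.sum_pos _ (fun x hx => ?_) ?_
    · obtain ⟨e, he, rfl⟩ := List.mem_map.1 hx
      exact T.weight_pos _ _ (hchain e he)
    · rw [hl]
      simp
  · exact iff_of_false (lt_irrefl _) h

/-- The query sums along some chosen path. A path from `i` to `j` with more than one edge would
return to `i`, the only parent of `j`, and close a cycle; so the chosen path is the edge. -/
lemma WeightedRootedTree.additiveQuery_of_adj {i j : V} (h : T.graph.Adj i j) :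
    T.additiveQuery i j = T.weight i j := by
  have hex : ∃ l, T.graph.IsPathFromTo i j l := Digraph.exists_isPathFromTo_iff.2 (.single h)
  rw [WeightedRootedTree.additiveQuery, dif_pos hex]
  obtain ⟨y, l', hl, hy, hc, hj⟩ := hex.choose_spec.exists_eq_cons
  rw [hl]
  cases l' with
  | nil =>
    obtain rfl : y = j := hj
    simp [pathWeight]
  | cons z l' =>
    rw [List.isChain_cons_cons] at hc
    rw [List.getLast_cons (List.cons_ne_nil _ _)] at hj
    have hyj := TransGen.head' hc.1 (List.relationReflTransGen_of_exists_isChain_cons l' hc.2 hj)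
    obtain ⟨u, hyu, hu⟩ := TransGen.tail'_iff.1 hyj
    rw [T.isTree.eq_of_adj hu h] at hyu
    exact (T.isTree.not_transGen_self _ (TransGen.head' hy hyu)).elim

end Tree

/-! ### Reading the weights -/

section Weighted

open Timed

variable {V : Type} [DecidableEq V]

lemma readWeights_val (query : V → V → Timed ℝ) (E : List (V × V)) (W : V → V → ℝ) :
    (readWeights query E W).val =
      fun i j => if (i, j) ∈ E then (query i j).val else W i j := by
  induction E generalizing W with
  | nil => simp [readWeights]
  | cons e es ih =>
    simp only [readWeights, val_bind, ih]
    ext i j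
    by_cases h : (i, j) ∈ es
    · simp [h]
    · by_cases h' : i = e.1 ∧ j = e.2
      · obtain ⟨rfl, rfl⟩ := h'
        simp
      · have : (i, j) ≠ e := fun h => h' (by simp [← h])
        simp [h, h', this]

lemma readWeights_time {query : V → V → Timed ℝ} (hq : ∀ i j, (query i j).time = 1)
    (E : List (V × V)) (W : V → V → ℝ) : (readWeights query E W).time = 2 * E.length := by
  induction E generalizing W with
  | nil => simp [readWeights]
  | cons e es ih =>
    simp only [readWeights, time_bind, time_tick, ih, hq, List.length_cons]
    ring

open Classical in
/-- The path queries of a weighted tree. -/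
noncomputable def pathQuery (oracle : V → V → ℝ) (i j : V) : Timed Bool :=
  ⟨decide (0 < oracle i j), 1⟩

lemma reconstructWeightedTree_eq (oracle : V → V → ℝ) (d f : ℕ) (vs : List V) :
    reconstructWeightedTree oracle d f vs =
      reconstructTree (pathQuery oracle) d f vs >>= fun E =>
        Comp.lift (readWeights (fun i j => ⟨oracle i j, 1⟩) E 0) >>= fun W => pure (E, W) := rfl

variable [Fintype V] (T : WeightedRootedTree V)

/-- An interrupted run has taken at least as much time as its nesting depth, and every output is
correct. -/
lemma WeightedRootedTree.ensures_reconstructWeightedTree (d f : ℕ) {vs : List V} (hvs : vs.Nodup)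
    (hmem : ∀ v, v ∈ vs) :
    Comp.Ensures (reconstructWeightedTree T.additiveQuery d f vs) fun o t =>
      (o = none → f ≤ t) ∧ ∀ out, o = some out → T.IsReconstructedBy out := by
  let := T.isTree.partialOrder
  have huniv : vs.toFinset = Finset.univ := by ext v; simp [hmem]
  have hQ : ∀ i j, (pathQuery T.additiveQuery i j).val = true ↔ i < j := fun i j => by
    simp only [pathQuery, decide_eq_true_iff]
    exact T.additiveQuery_pos_iff i j
  have hrun := ensures_reconstructTree hQ T.isTree.le_or_le d f hvs
    (huniv ▸ T.isTree.isSubtree_univ)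
  rw [reconstructWeightedTree_eq]
  refine Comp.ensures_bind (hrun.mono fun o c h => ⟨fun ho => ⟨fun _ => h.1 ho, by simp⟩, ?_⟩)
  rintro E rfl
  refine Comp.ensures_lift_bind (Comp.ensures_pure ⟨by simp, ?_⟩)
  rintro out ⟨⟩
  have hE := h.2 E rfl
  have hadj : ∀ i j, (i, j) ∈ E ↔ T.graph.Adj i j := fun i j => by
    rw [hE.mem_iff, huniv, ← T.isTree.covBy_iff]
    simp
  refine ⟨hE.nodup, hadj, ?_⟩
  ext i j
  simp only [readWeights_val]
  split_ifs with hij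
  · exact T.additiveQuery_of_adj ((hadj i j).1 hij)
  · exact (T.weight_zero i j fun h => hij ((hadj i j).2 h)).symm

lemma WeightedRootedTree.etime_reconstructWeightedTree_le {d : ℕ} (hd : 2 ≤ d) (f : ℕ)
    {vs : List V} (hvs : vs.Nodup) (hmem : ∀ v, v ∈ vs) (hdeg : ∀ v, T.graph.totalDegree v ≤ d) :
    Comp.etime (reconstructWeightedTree T.additiveQuery d f vs) ≤
      ENNReal.ofReal (1080000 * d * (Nat.clog 2 (Fintype.card V) + 1) *
        mulLogSelf (Fintype.card V) + 3 * Fintype.card V) := by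
  let := T.isTree.partialOrder
  have huniv : vs.toFinset = Finset.univ := by ext v; simp [hmem]
  have hcard : vs.length = Fintype.card V := by
    rw [← List.toFinset_card_of_nodup hvs, huniv, Finset.card_univ]
  have hQ : ∀ i j, (pathQuery T.additiveQuery i j).val = true ↔ i < j := fun i j => by
    simp only [pathQuery, decide_eq_true_iff]
    exact T.additiveQuery_pos_iff i j
  have hU : IsSubtree vs.toFinset := huniv ▸ T.isTree.isSubtree_univ
  have hrun := ensures_reconstructTree hQ T.isTree.le_or_le d f hvs hU
  have htime := etime_reconstructTree_le hQ (fun _ _ => rfl) T.isTree.le_or_le hd f hvs hU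
    hcard.le (fun v => by
      rw [huniv]
      exact (T.isTree.card_neighbors_univ_le v).trans (hdeg v)) (.inl rfl)
  rw [reconstructWeightedTree_eq]
  have hbind := Comp.etime_bind_le (reconstructTree (pathQuery T.additiveQuery) d f vs)
    (fun E => Comp.lift (readWeights (fun i j => ⟨T.additiveQuery i j, 1⟩) E 0) >>=
      fun W => pure (E, W)) (B := ((2 * Fintype.card V : ℕ) : ℝ≥0∞)) (hrun.mono fun o t h E hE => by
        have := (h.2 E hE).length_eq
        rw [huniv, Finset.card_univ] at this
        rw [Comp.etime_lift_bind, Comp.etime_pure, add_zero,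
          readWeights_time (fun _ _ => rfl)]
        exact Nat.cast_le.2 (by omega))
  refine (hbind.trans (add_le_add htime le_rfl)).trans ?_
  have hlog := mulLogSelf_nonneg vs.toFinset.card
  rw [← ENNReal.ofReal_natCast, ← ENNReal.ofReal_add (by positivity) (by positivity)]
  refine ENNReal.ofReal_le_ofReal (le_of_eq ?_)
  rw [huniv, Finset.card_univ, hcard]
  push_cast
  ring

end Weighted

/-! ### The numerical constant of the time bound -/

lemma clog_two_add_one_le {n : ℕ} (hn : 2 ≤ n) : (Nat.clog 2 n + 1 : ℝ) ≤ 5 * Real.log n := by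
  have h2 := Real.log_two_gt_d9
  have hlog : Real.log 2 ≤ Real.log n := Real.log_le_log (by norm_num) (by exact_mod_cast hn)
  have hceil : (Nat.clog 2 n : ℝ) < Real.logb 2 n + 1 := by
    rw [← Real.natCeil_logb_natCast]
    exact Nat.ceil_lt_add_one (Real.logb_nonneg one_lt_two (by exact_mod_cast one_le_two.trans hn))
  have hlogb : Real.logb 2 n ≤ 2 * Real.log n := by
    rw [Real.logb, div_le_iff₀ (by linarith)]
    nlinarith
  linarith

/-- The logarithmic factor turns `1080000` into `5 * 1080000 = 5400000`; the remaining `600000`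
absorbs the linear term, as `log n ≥ 0.6` and `d ≥ 2`. -/
lemma time_bound_le {d n : ℕ} (hd : 2 ≤ d) (hn : 2 ≤ n) :
    1080000 * d * (Nat.clog 2 n + 1) * mulLogSelf n + 3 * n ≤
      6000000 * (d * n * Real.log n ^ 2) := by
  have h2 := Real.log_two_gt_d9
  have hlog : Real.log 2 ≤ Real.log n := Real.log_le_log (by norm_num) (by exact_mod_cast hn)
  have hL : 0 ≤ Real.log n := by linarith
  have hdR : (2 : ℝ) ≤ d := by exact_mod_cast hd
  have hc := clog_two_add_one_le hn
  have h1 : 1080000 * d * (Nat.clog 2 n + 1) * mulLogSelf n ≤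
      1080000 * d * (5 * Real.log n) * (n * Real.log n) := by
    rw [mulLogSelf]
    gcongr
  have h3 : (3 : ℝ) ≤ 600000 * (d * Real.log n ^ 2) := by
    have : (0.6 : ℝ) * 0.6 ≤ Real.log n ^ 2 := by nlinarith
    nlinarith
  have h4 := mul_le_mul_of_nonneg_right h3 (Nat.cast_nonneg (α := ℝ) n)
  nlinarith

/-! ### Markov's inequality, halting and the tail bound -/

namespace Comp

variable {α : Type}

/-- Markov's inequality for the time of a computation. -/
lemma one_le_toOuterMeasure_add {x : Comp α} {S : Set (Option α × ℕ)} {s b : ℝ≥0∞} (hs : s ≠ 0)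
    (hs' : s ≠ ⊤) (hb : etime x ≤ b) (h : Ensures x fun o t => (o, t) ∉ S → s ≤ t) :
    1 ≤ (toPMF x).toOuterMeasure S + b / s := by
  have hsplit : (∑' r, S.indicator (toPMF x) r) + ∑' r, Sᶜ.indicator (toPMF x) r = 1 := by
    rw [← ENNReal.tsum_add, ← PMF.tsum_coe (toPMF x)]
    exact tsum_congr fun r => congrFun (Set.indicator_self_add_compl S (toPMF x)) r
  rw [PMF.toOuterMeasure_apply, ← hsplit]
  refine add_le_add le_rfl ?_
  rw [ENNReal.le_div_iff_mul_le (.inl hs) (.inl hs'), ← ENNReal.tsum_mul_right]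
  refine (ENNReal.tsum_le_tsum fun r => ?_).trans hb
  by_cases hr : r ∈ S
  · rw [Set.indicator_of_notMem (by simpa using hr), zero_mul]
    exact zero_le
  rw [Set.indicator_of_mem (by simpa using hr)]
  by_cases h0 : toPMF x r = 0
  · simp [h0]
  · gcongr
    exact h r ((PMF.mem_support_iff _ _).2 h0) hr

lemma probHalts_le_one (A : ℕ → Comp α) (S : α → ℕ → Prop) : probHalts A S ≤ 1 := by
  refine iSup_le fun f => ?_
  rw [← PMF.tsum_coe (toPMF (A f))]
  erw [PMF.toOuterMeasure_apply]
  exact ENNReal.tsum_le_tsum fun r => Set.indicator_le_self _ _ r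

/-- An algorithm whose expected time is bounded halts almost surely. -/
lemma probHalts_eq_one {A : ℕ → Comp α} {S : α → Prop} {b : ℝ≥0∞} (hb : b ≠ ⊤)
    (hA : ∀ f, etime (A f) ≤ b)
    (h : ∀ f, Ensures (A f) fun o t => (o = none → f ≤ t) ∧ ∀ a, o = some a → S a) :
    probHalts A (fun a _ => S a) = 1 := by
  refine le_antisymm (probHalts_le_one _ _) ?_
  -- At depth `f` an interruption has probability at most `b / f`, which tends to `0`.
  have hlim : Filter.Tendsto (fun f : ℕ => probHalts A (fun a _ => S a) + b / f) Filter.atTop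
      (nhds (probHalts A (fun a _ => S a) + 0)) := by
    refine tendsto_const_nhds.add ?_
    rw [← ENNReal.div_top (a := b)]
    exact ENNReal.Tendsto.const_div ENNReal.tendsto_nat_nhds_top (.inr hb)
  rw [add_zero] at hlim
  refine ge_of_tendsto hlim ?_
  filter_upwards [Filter.eventually_ge_atTop 1] with f hf
  refine (one_le_toOuterMeasure_add (S := {r | ∃ a, r.1 = some a ∧ S a})
    (Nat.cast_ne_zero.2 (by omega)) (ENNReal.natCast_ne_top f) (hA f)
    ((h f).mono fun o t hot hr => ?_)).trans (add_le_add (le_iSup_of_le f le_rfl) le_rfl)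
  cases o with
  | none => exact Nat.cast_le.2 (hot.1 rfl)
  | some a => exact (hr ⟨a, rfl, hot.2 a rfl⟩).elim

/-- An algorithm halts with probability at least `1 - δ` in time at most its expected time divided
by `δ`. -/
lemma ofReal_one_sub_le_probHalts {A : ℕ → Comp α} {S : α → Prop} {b δ : ℝ} (hb : 0 < b)
    (hδ : 0 < δ) (hA : ∀ f, etime (A f) ≤ ENNReal.ofReal b)
    (h : ∀ f, Ensures (A f) fun o t => (o = none → f ≤ t) ∧ ∀ a, o = some a → S a) :
    ENNReal.ofReal (1 - δ) ≤ probHalts A (fun a t => S a ∧ (t : ℝ) ≤ b / δ) := by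
  -- A single truncation is enough: at a depth `f ≥ b / δ` an interrupted run has also used time at
  -- least `b / δ`, so Markov's inequality covers both kinds of failure.
  obtain ⟨f, hf⟩ := exists_nat_ge (b / δ)
  have hpos : 0 < b / δ := div_pos hb hδ
  have hM := one_le_toOuterMeasure_add (x := A f)
    (S := {r | ∃ a, r.1 = some a ∧ S a ∧ (r.2 : ℝ) ≤ b / δ}) (s := ENNReal.ofReal (b / δ))
    (ENNReal.ofReal_pos.2 hpos).ne' ENNReal.ofReal_ne_top (hA f)
    ((h f).mono fun o t hot hr => by
      rw [← ENNReal.ofReal_natCast]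
      refine ENNReal.ofReal_le_ofReal ?_
      cases o with
      | none => exact hf.trans (Nat.cast_le.2 (hot.1 rfl))
      | some a =>
        by_contra ht
        exact hr ⟨a, rfl, hot.2 a rfl, (not_le.1 ht).le⟩)
  rw [← ENNReal.ofReal_div_of_pos hpos, div_div_cancel₀ hb.ne'] at hM
  rw [ENNReal.ofReal_sub _ hδ.le, ENNReal.ofReal_one, tsub_le_iff_right]
  exact hM.trans (add_le_add (le_iSup_of_le f le_rfl) le_rfl)

end Comp

theorem mainTheorem5 :
    ∃ C : ℝ, 0 < C ∧
      ∀ (V : Type) [Fintype V] [DecidableEq V] (T : WeightedRootedTree V) (d : ℕ) (vs : List V),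
        2 ≤ d → (∀ v, T.graph.totalDegree v ≤ d) →
        vs.Nodup → (∀ v, v ∈ vs) →
        let n : ℝ := Fintype.card V
        let A : ℕ → Comp (List (V × V) × (V → V → ℝ)) :=
          fun f => reconstructWeightedTree T.additiveQuery d f vs
        (∀ f out t, (some out, t) ∈ PMF.support (A f) → T.IsReconstructedBy out) ∧
        Comp.probHalts A (fun out _ => T.IsReconstructedBy out) = 1 ∧
        (2 ≤ Fintype.card V →
          Comp.expectedTime A ≤ ENNReal.ofReal (C * (d * n * Real.log n ^ 2))) ∧
        (2 ≤ Fintype.card V → ∀ δ : ℝ, 0 < δ → δ < 1 →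
          ENNReal.ofReal (1 - δ) ≤
            Comp.probHalts A (fun out t => T.IsReconstructedBy out ∧
              (t : ℝ) ≤ C * (1 / δ * (d * n * Real.log n ^ 2)))) := by
  refine ⟨6000000, by norm_num, ?_⟩
  intro V _ _ T d vs hd hdeg hvs hmem n A
  have hrun : ∀ f, Comp.Ensures (A f) fun o t =>
      (o = none → f ≤ t) ∧ ∀ out, o = some out → T.IsReconstructedBy out := fun f =>
    T.ensures_reconstructWeightedTree d f hvs hmem
  have htime := fun f => T.etime_reconstructWeightedTree_le hd f hvs hmem hdeg
  have htime' : 2 ≤ Fintype.card V → ∀ f,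
      Comp.etime (A f) ≤ ENNReal.ofReal (6000000 * (d * n * Real.log n ^ 2)) := fun hn f =>
    (htime f).trans (ENNReal.ofReal_le_ofReal (time_bound_le hd hn))
  -- Halting relies on `htime`, which also covers `n = 1`, where `log n` vanishes and the bound with
  -- `log² n` fails.
  refine ⟨fun f out t h => (hrun f _ h).2 out rfl,
    Comp.probHalts_eq_one ENNReal.ofReal_ne_top htime hrun,
    fun hn => iSup_le (htime' hn), fun hn δ hδ _ => ?_⟩
  have hn1 : 1 < n := Nat.one_lt_cast.2 hn
  have hn0 : 0 < n := zero_lt_one.trans hn1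
  have hlog : 0 < Real.log n := Real.log_pos hn1
  have hd0 : (0 : ℝ) < d := by
    have : 0 < d := by omega
    exact_mod_cast this
  have := Comp.ofReal_one_sub_le_probHalts (by positivity) hδ (htime' hn) hrun
  rwa [div_eq_mul_one_div, mul_assoc, mul_comm _ (1 / δ)] at this
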